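/- A \emph{QBF} is a closed formula $\Phi=Q_1x_1\cdots Q_nx_n.\,\varphi$ with $Q_i\in\{\forall,\exists\}$, pairwise distinct variables $V(\Phi)=\{x_1,\dots,x_n\}$, and a matrix $\varphi$ that is a conjunction of constraints over $V(\Phi)$. A constraint is a clause, an affine equation over $\mathbb F_2$ (given by its set of variables and its right-hand side), or an atom $R(y_1,\dots,y_r)$ with $R\subseteq\{0,1\}^r$ given by its list of tuples. For a partial assignment $\tau$, $\Phi[\tau]$ is obtained by deleting the assigned variables from the prefix and simplifying every constraint by $\tau$ (satisfied clauses are removed). If $\varphi$ is in CNF and $S\subseteq V(\Phi)$, then $\Phi-S$ is obtained by removing the variables of $S$ from the prefix and from every clause. Let $\mathcal C$ be a class of QBFs. A set $B\subseteq V(\Phi)$ is a \emph{backdoor} to $\mathcal C$ for $\Phi$ if $\Phi[\tau]\in\mathcal C$ for every $\tau:B\to\{0,1\}$; if $\Phi$ is in CNF, $B$ is a \emph{deletion backdoor} to $\mathcal C$ for $\Phi$ if $\Phi-B\in\mathcal C$. The class $\mathcal C$ is \emph{(deletion) extendable} if the following problem is fixed-parameter tractable parameterized by $|B|$: given a QBF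 $\Phi$ and a (deletion) backdoor $B$ to $\mathcal C$ for $\Phi$, decide whether $\Phi$ is true. Here \emph{fixed-parameter tractable} with respect to a parameter $k$ means that a single algorithm decides the problem on all inputs of the stated form in time at most $f(k)\cdot N^{c}$, where $N$ is the size of the input, $f$ is a computable function, and $c$ is a constant; nothing is required on other inputs. The primal graph $G_{\mathsf P}(\Phi)$ has vertex set $V(\Phi)$, with two distinct variables adjacent if they occur in a common constraint. For $B\subseteq V(\Phi)$, let $U(\Phi,B)$ be the union of all connected components of $G_{\mathsf P}(\Phi)-B$ that contain only universal variables. For $Y\subseteq V(\Phi)$, let $\Delta(\Phi,Y)$ be the maximum number of variables of $Y$ occurring in a single constraint of $\Phi$ (and $0$ if there are no constraints). The set $B$ is an \emph{enhanced (deletion) backdoor} to $\mathcal C$ for $\Phi$ if $B\cup U(\Phi,B)$ is a (deletion) backdoor to $\mathcal C$ for $\Phi$. \textbf{Theorem.} Let $\mathcal C$ be a class of QBFs. (1) If $\mathcal C$ is extendable, then the following problem is fixed-parameter tractable parameterized by $|B|+\Delta(\Phi,U(\Phi,B))$: given a QBF $\Phi$ and an enhanced backdoor $B$ to $\mathcal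 C$ for $\Phi$, decide whether $\Phi$ is true. (2) Suppose that $\mathcal C$ is closed under taking subformulas, that is, whenever a CNF formula is in $\mathcal C$, so is every formula obtained from it by removing a set of variables (from the prefix and from all clauses) and a set of clauses. If $\mathcal C$ is deletion extendable, then the following problem is fixed-parameter tractable parameterized by $|B|+\Delta(\Phi,U(\Phi,B))$: given a QBF $\Phi$ in CNF and an enhanced deletion backdoor $B$ to $\mathcal C$ for $\Phi$, decide whether $\Phi$ is true. -/

import Mathlib

/-! ### Quantified Boolean formulas -/

/-- Universal and existential quantifiers. -/
inductive Quant where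
  | all
  | ex

/-- A literal: a variable together with its sign (`true` for the positive literal). -/
structure Lit where
  var : ℕ
  sign : Bool

/-- The constraints (atoms) of a matrix: a clause given as a collection of literals; an affine
equation `(A, b)`, saying that the sum modulo 2 of the variables in `A` is `b`; or an atom
`R(x₁, …, xᵣ)` for a Boolean relation `R` given by the list of its tuples. -/
inductive Constraint where
  | clause (ls : List Lit)
  | affine (A : List ℕ) (b : Bool)
  | rel (xs : List ℕ) (R : List (List Bool))

namespace Constraint

/-- The set of variables of a constraint. -/
def vars : Constraint → Finset ℕ
  | clause ls => (ls.map Lit.var).toFinset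
  | affine A _ => A.toFinset
  | rel xs _ => xs.toFinset

/-- In an affine equation `A` is a set, and the tuples of an `r`-ary relation have length `r`. -/
def WellFormed : Constraint → Prop
  | clause _ => True
  | affine A _ => A.Nodup
  | rel xs R => ∀ t ∈ R, t.length = xs.length

/-- The constraint is satisfied by the assignment `σ`. -/
def Sat (σ : ℕ → Bool) : Constraint → Prop
  | clause ls => ∃ l ∈ ls, σ l.var = l.sign
  | affine A b => (A.map σ).foldr Bool.xor false = b
  | rel xs R => xs.map σ ∈ R

/-- The constraint is a clause. -/
def IsClause : Constraint → Prop
  | clause _ => True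
  | _ => False

/-- Project the positions that carry a variable of `S` away from the tuple `t`. -/
def projTuple (S : Finset ℕ) (xs : List ℕ) (t : List Bool) : List Bool :=
  ((xs.zip t).filter (fun p => p.1 ∉ S)).map Prod.snd

/-- The constraint `c[τ]`, where `τ` is used as a partial assignment of the variables in `S` only;
`none` stands for a clause satisfied by `τ`, which is removed from the formula. In a relational
atom the tuples that contradict `τ` are removed and the positions of `S` are projected away. -/
def assign (S : Finset ℕ) (τ : ℕ → Bool) : Constraint → Option Constraint
  | clause ls =>
      if ∃ l ∈ ls, l.var ∈ S ∧ τ l.var = l.sign then none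
      else some (clause (ls.filter (fun l => l.var ∉ S)))
  | affine A b =>
      some (affine (A.filter (fun v => v ∉ S))
        (Bool.xor b (((A.filter (fun v => v ∈ S)).map τ).foldr Bool.xor false)))
  | rel xs R =>
      some (rel (xs.filter (fun v => v ∉ S))
        ((R.filter (fun t => ∀ p ∈ xs.zip t, p.1 ∈ S → τ p.1 = p.2)).map (projTuple S xs)))

/-- Remove the variables in `S` from a constraint (used for clauses only, where the literals over
`S` are removed). -/
def delete (S : Finset ℕ) : Constraint → Constraint
  | clause ls => clause (ls.filter (fun l => l.var ∉ S))
  | affine A b => affine (A.filter (fun v => v ∉ S)) b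
  | rel xs R => rel (xs.filter (fun v => v ∉ S)) (R.map (projTuple S xs))

theorem length_projTuple (S : Finset ℕ) (xs : List ℕ) (t : List Bool) (h : t.length = xs.length) :
    (projTuple S xs t).length = (xs.filter (fun v => v ∉ S)).length := by
  unfold projTuple
  induction xs generalizing t with
  | nil => simp
  | cons x xs ih =>
    cases t with
    | nil => simp at h
    | cons b t =>
      have h2 := ih t (by simpa using h)
      rw [List.length_map] at h2 ⊢
      by_cases hx : x ∈ S <;> simp_all

theorem wellFormed_delete (S : Finset ℕ) (c : Constraint) (h : c.WellFormed) :
    (c.delete S).WellFormed := by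
  cases c with
  | clause ls => trivial
  | affine A b => exact List.Nodup.filter _ h
  | rel xs R =>
    intro t ht
    obtain ⟨u, hu, rfl⟩ := List.mem_map.1 ht
    exact length_projTuple S xs u (h u hu)

theorem vars_delete (S : Finset ℕ) (c : Constraint) : (c.delete S).vars = c.vars \ S := by
  cases c <;> ext v <;> simp [delete, vars]
  grind

theorem wellFormed_assign (S : Finset ℕ) (τ : ℕ → Bool) (c d : Constraint) (h : c.WellFormed)
    (hd : c.assign S τ = some d) : d.WellFormed := by
  cases c with
  | clause ls =>
    simp only [assign] at hd
    split at hd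
    · simp at hd
    · obtain rfl := Option.some.inj hd
      trivial
  | affine A b =>
    obtain rfl := Option.some.inj hd
    exact List.Nodup.filter _ h
  | rel xs R =>
    obtain rfl := Option.some.inj hd
    intro t ht
    obtain ⟨u, hu, rfl⟩ := List.mem_map.1 ht
    exact length_projTuple S xs u (h u (List.mem_filter.1 hu).1)

theorem vars_assign (S : Finset ℕ) (τ : ℕ → Bool) (c d : Constraint)
    (hd : c.assign S τ = some d) : d.vars = c.vars \ S := by
  rw [← vars_delete]
  cases c with
  | clause ls =>
    simp only [assign] at hd
    split at hd
    · simp at hd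
    · obtain rfl := Option.some.inj hd
      rfl
  | affine A b =>
    obtain rfl := Option.some.inj hd
    rfl
  | rel xs R =>
    obtain rfl := Option.some.inj hd
    rfl

end Constraint

/-- A quantified Boolean formula `Q₁ x₁ … Qₙ xₙ. φ` with pairwise distinct variables, whose matrix
`φ` is a conjunction of constraints over `x₁, …, xₙ`. -/
@[ext]
structure QBF where
  prefx : List (Quant × ℕ)
  matrix : List Constraint
  nodup : (prefx.map Prod.snd).Nodup
  wellFormed : ∀ c ∈ matrix, c.WellFormed
  closed : ∀ c ∈ matrix, c.vars ⊆ (prefx.map Prod.snd).toFinset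

/-- Truth of `Q₁ x₁ … Qₙ xₙ. φ` when the remaining variables are interpreted by `σ`. -/
def PrefixTrue (φ : List Constraint) : List (Quant × ℕ) → (ℕ → Bool) → Prop
  | [], σ => ∀ c ∈ φ, c.Sat σ
  | (Quant.ex, x) :: Q, σ => ∃ b : Bool, PrefixTrue φ Q (Function.update σ x b)
  | (Quant.all, x) :: Q, σ => ∀ b : Bool, PrefixTrue φ Q (Function.update σ x b)

namespace QBF

/-- The set `V(Φ)` of variables of `Φ`. -/
def vars (Φ : QBF) : Finset ℕ := (Φ.prefx.map Prod.snd).toFinset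

/-- `v` is a universal variable of `Φ`. -/
def IsUniversal (Φ : QBF) (v : ℕ) : Prop := (Quant.all, v) ∈ Φ.prefx

/-- `Φ` is true (valid). The start assignment is irrelevant, since `Φ` is closed. -/
def IsTrue (Φ : QBF) : Prop := PrefixTrue Φ.matrix Φ.prefx (fun _ => false)

/-- The matrix of `Φ` is in conjunctive normal form. -/
def IsCNF (Φ : QBF) : Prop := ∀ c ∈ Φ.matrix, c.IsClause

theorem toFinset_prefix_filter (Q : List (Quant × ℕ)) (S : Finset ℕ) :
    ((Q.filter (fun p => p.2 ∉ S)).map Prod.snd).toFinset = (Q.map Prod.snd).toFinset \ S := by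
  ext v
  simp

/-- The formula `Φ[τ]`, where `τ` is used as a partial assignment of the variables in `S` only. -/
def assign (Φ : QBF) (S : Finset ℕ) (τ : ℕ → Bool) : QBF where
  prefx := Φ.prefx.filter (fun p => p.2 ∉ S)
  matrix := Φ.matrix.filterMap (fun c => c.assign S τ)
  nodup := Φ.nodup.sublist (List.filter_sublist.map _)
  wellFormed := by
    intro d hd
    obtain ⟨c, hc, h⟩ := List.mem_filterMap.1 hd
    exact Constraint.wellFormed_assign S τ c d (Φ.wellFormed c hc) h
  closed := by
    intro d hd
    obtain ⟨c, hc, h⟩ := List.mem_filterMap.1 hd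
    rw [Constraint.vars_assign S τ c d h, toFinset_prefix_filter]
    exact Finset.sdiff_subset_sdiff (Φ.closed c hc) (Finset.Subset.refl S)

/-- The formula `Φ - S`: remove the variables in `S` from the prefix and from every constraint. -/
def delete (Φ : QBF) (S : Finset ℕ) : QBF where
  prefx := Φ.prefx.filter (fun p => p.2 ∉ S)
  matrix := Φ.matrix.map (fun c => c.delete S)
  nodup := Φ.nodup.sublist (List.filter_sublist.map _)
  wellFormed := by
    intro d hd
    obtain ⟨c, hc, rfl⟩ := List.mem_map.1 hd
    exact Constraint.wellFormed_delete S c (Φ.wellFormed c hc)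
  closed := by
    intro d hd
    obtain ⟨c, hc, rfl⟩ := List.mem_map.1 hd
    rw [Constraint.vars_delete S c, toFinset_prefix_filter]
    exact Finset.sdiff_subset_sdiff (Φ.closed c hc) (Finset.Subset.refl S)

/-- The primal graph: its vertices are the variables of `Φ`, and two distinct variables are
adjacent if they occur in a common constraint. -/
def primalGraph (Φ : QBF) : SimpleGraph {v : ℕ // v ∈ Φ.vars} where
  Adj u v := u ≠ v ∧ ∃ c ∈ Φ.matrix, (u : ℕ) ∈ c.vars ∧ (v : ℕ) ∈ c.vars
  symm := ⟨fun _ _ h => ⟨h.1.symm, h.2.imp fun _ hc => ⟨hc.1, hc.2.2, hc.2.1⟩⟩⟩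
  loopless := ⟨fun _ h => h.1 rfl⟩

/-- The graph obtained from the primal graph of `Φ` by deleting the vertices in `B`. -/
def primalGraphMinus (Φ : QBF) (B : Finset ℕ) :
    SimpleGraph ({w | w.1 ∉ B} : Set {v : ℕ // v ∈ Φ.vars}) :=
  Φ.primalGraph.induce {w | w.1 ∉ B}

open Classical in
/-- The set `U(Φ, B)`: the union of all connected components of the primal graph minus `B` that
contain only universal variables. -/
noncomputable def universalPart (Φ : QBF) (B : Finset ℕ) : Finset ℕ :=
  Φ.vars.filter fun v =>
    ∃ K : (Φ.primalGraphMinus B).ConnectedComponent,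
      (∃ w ∈ K.supp, w.1.1 = v) ∧ ∀ w ∈ K.supp, Φ.IsUniversal w.1.1

/-- `Δ(Φ, Y)`: the maximum number of variables of `Y` in a constraint of `Φ`. -/
def maxOcc (Φ : QBF) (Y : Finset ℕ) : ℕ :=
  (Φ.matrix.map (fun c => (c.vars ∩ Y).card)).foldr max 0

/-- `B` is a (strong) backdoor to the class `C` for `Φ`. -/
def IsBackdoor (C : Set QBF) (Φ : QBF) (B : Finset ℕ) : Prop :=
  B ⊆ Φ.vars ∧ ∀ τ : ℕ → Bool, Φ.assign B τ ∈ C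

/-- `B` is a deletion backdoor to the class `C` for the CNF formula `Φ`. -/
def IsDeletionBackdoor (C : Set QBF) (Φ : QBF) (B : Finset ℕ) : Prop :=
  B ⊆ Φ.vars ∧ Φ.IsCNF ∧ Φ.delete B ∈ C

/-- `B` is an enhanced backdoor to the class `C` for `Φ`. -/
def IsEnhancedBackdoor (C : Set QBF) (Φ : QBF) (B : Finset ℕ) : Prop :=
  B ⊆ Φ.vars ∧ IsBackdoor C Φ (B ∪ Φ.universalPart B)

/-- `B` is an enhanced deletion backdoor to the class `C` for `Φ`. -/
def IsEnhancedDeletionBackdoor (C : Set QBF) (Φ : QBF) (B : Finset ℕ) : Prop :=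
  B ⊆ Φ.vars ∧ IsDeletionBackdoor C Φ (B ∪ Φ.universalPart B)

/-- The class `C` is closed under removing variables and clauses from its CNF formulas. -/
def ClosedUnderSubformulas (C : Set QBF) : Prop :=
  ∀ Φ ∈ C, Φ.IsCNF → ∀ (S : Finset ℕ) (Ψ : QBF),
    Ψ.prefx = (Φ.delete S).prefx → Ψ.matrix.Sublist (Φ.delete S).matrix → Ψ ∈ C

end QBF

/-! ### A machine model with a step count

The WHILE language: imperative programs over binary trees, in which every elementary operation
(a constant number of pointer operations on shared trees) takes one step. Its running times agree
with those of Turing machines up to a polynomial. -/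

/-- Binary trees, the data of the programs. -/
inductive Data where
  | nil
  | cons (a b : Data)

namespace Data

/-- The head of a tree. -/
def hd : Data → Data
  | nil => nil
  | cons a _ => a

/-- The tail of a tree. -/
def tl : Data → Data
  | nil => nil
  | cons _ b => b

/-- The size of a tree: its number of nodes. -/
def size : Data → ℕ
  | nil => 1
  | cons a b => a.size + b.size + 1

end Data

/-- WHILE programs. The program variables are numbered by natural numbers. -/
inductive Prog where
  | setNil (x : ℕ)
  | copy (x y : ℕ)
  | cons (x y z : ℕ)
  | hd (x y : ℕ)
  | tl (x y : ℕ)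
  | seq (p q : Prog)
  | ite (x : ℕ) (p q : Prog)
  | loop (x : ℕ) (p : Prog)

namespace Prog

/-- `Exec p s s' t`: started in the store `s`, the program `p` halts after exactly `t` steps in the
store `s'`. The command `ite x p q` runs `p` if `x` is not `nil`, else `q`; the command `loop x p`
runs `p` as long as `x` is not `nil`. -/
inductive Exec : Prog → (ℕ → Data) → (ℕ → Data) → ℕ → Prop
  | setNil (x : ℕ) (s : ℕ → Data) : Exec (setNil x) s (Function.update s x Data.nil) 1
  | copy (x y : ℕ) (s : ℕ → Data) : Exec (copy x y) s (Function.update s x (s y)) 1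
  | cons (x y z : ℕ) (s : ℕ → Data) :
      Exec (cons x y z) s (Function.update s x (Data.cons (s y) (s z))) 1
  | hd (x y : ℕ) (s : ℕ → Data) : Exec (hd x y) s (Function.update s x (s y).hd) 1
  | tl (x y : ℕ) (s : ℕ → Data) : Exec (tl x y) s (Function.update s x (s y).tl) 1
  | seq {p q : Prog} {s s' s'' : ℕ → Data} {m n : ℕ} :
      Exec p s s' m → Exec q s' s'' n → Exec (seq p q) s s'' (m + n)
  | iteTrue {x : ℕ} {p q : Prog} {s s' : ℕ → Data} {n : ℕ} :
      s x ≠ Data.nil → Exec p s s' n → Exec (ite x p q) s s' (n + 1)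
  | iteFalse {x : ℕ} {p q : Prog} {s s' : ℕ → Data} {n : ℕ} :
      s x = Data.nil → Exec q s s' n → Exec (ite x p q) s s' (n + 1)
  | loopDone {x : ℕ} {p : Prog} {s : ℕ → Data} :
      s x = Data.nil → Exec (loop x p) s s 1
  | loopStep {x : ℕ} {p : Prog} {s s' s'' : ℕ → Data} {m n : ℕ} :
      s x ≠ Data.nil → Exec p s s' m → Exec (loop x p) s' s'' n →
        Exec (loop x p) s s'' (m + n + 1)

/-- On input `d` (in variable `0`, all other variables being `nil`) the program `p` halts after
exactly `t` steps with output `e` (in variable `0`). -/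
def Outputs (p : Prog) (d e : Data) (t : ℕ) : Prop :=
  ∃ s' : ℕ → Data, Exec p (Function.update (fun _ => Data.nil) 0 d) s' t ∧ s' 0 = e

end Prog

/-- Fixed-parameter tractability of a decision problem on instances that satisfy a promise:
a single program decides the problem on every such instance `x` in time at most
`f (param x) * |x| ^ c`, with `f` computable and `c` constant, where `|x|` is the size of the
encoding of `x`. The answer is yes if the output is not `nil`. -/
def FixedParameterTractable {α : Type} (encode : α → Data) (promise yes : α → Prop)
    (param : α → ℕ) : Prop :=
  ∃ (p : Prog) (f : ℕ → ℕ) (c : ℕ), Computable f ∧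
    ∀ x : α, promise x →
      ∃ (e : Data) (t : ℕ), p.Outputs (encode x) e t ∧
        t ≤ f (param x) * (encode x).size ^ c ∧ (e ≠ Data.nil ↔ yes x)

/-! ### Encoding of formulas; variable names are written in binary -/

namespace Data

def ofBool : Bool → Data
  | false => nil
  | true => cons nil nil

def ofList {α : Type} (enc : α → Data) (l : List α) : Data :=
  l.foldr (fun a d => cons (enc a) d) nil

def ofNat (n : ℕ) : Data := ofList ofBool n.bits

def ofQuant : Quant → Data
  | Quant.all => nil
  | Quant.ex => cons nil nil

def ofLit (l : Lit) : Data := cons (ofNat l.var) (ofBool l.sign)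

def ofConstraint : Constraint → Data
  | Constraint.clause ls => cons (ofNat 0) (ofList ofLit ls)
  | Constraint.affine A b => cons (ofNat 1) (cons (ofList ofNat A) (ofBool b))
  | Constraint.rel xs R => cons (ofNat 2) (cons (ofList ofNat xs) (ofList (ofList ofBool) R))

def ofQBF (Φ : QBF) : Data :=
  cons (ofList (fun p => cons (ofQuant p.1) (ofNat p.2)) Φ.prefx) (ofList ofConstraint Φ.matrix)

/-- A formula together with a list of variables. -/
def ofInstance (I : QBF × List ℕ) : Data := cons (ofQBF I.1) (ofList ofNat I.2)

end Data

namespace QBF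

/-- `C` is extendable: deciding the validity of a formula, given together with a backdoor `B` to
`C`, is fixed-parameter tractable parameterized by `|B|`. -/
def Extendable (C : Set QBF) : Prop :=
  FixedParameterTractable Data.ofInstance
    (fun I => IsBackdoor C I.1 I.2.toFinset) (fun I => I.1.IsTrue)
    (fun I => I.2.toFinset.card)

/-- `C` is deletion extendable: deciding the validity of a formula, given together with a deletion
backdoor `B` to `C`, is fixed-parameter tractable parameterized by `|B|`. -/
def DeletionExtendable (C : Set QBF) : Prop :=
  FixedParameterTractable Data.ofInstance
    (fun I => IsDeletionBackdoor C I.1 I.2.toFinset) (fun I => I.1.IsTrue)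
    (fun I => I.2.toFinset.card)

end QBF

/-! Write `U` for the universal part of `Φ` with respect to `B`, and `k` for the parameter. The
variables outside `B` of a constraint lie in one component of the primal graph minus `B`. So a
constraint that meets `U` has all its variables in `B ∪ U` (`QBF.vars_subset_of_touches`), hence at
most `k` variables and at most `2 ^ k` falsifying assignments, which are regarded as terms. Let `F₀`
be the family of all these terms. On `U`, the universal player only tries to make some term of `F₀`
true.

The aim is a set `X` with `B ⊆ X ⊆ B ∪ U`, of size bounded in terms of `k` alone, and one assignment
`τ` of `Y = U \ X` that dominates all others: if a term of `F₀` holds, then some term of `F₀` still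
holds after the values on `Y` are reset to `τ` (`Covers`). The universal player then loses nothing
by playing `τ` on `Y`, so `Φ[τ]` and `Φ` have the same truth value (`QBF.isTrue_assign_iff`). Since
`Y ∪ X = B ∪ U`, the set `X` is a (deletion) backdoor for `Φ[τ]`, and the algorithm assumed for the
class finishes the job. In the deletion case closure under subformulas is needed because `τ` also
removes the clauses that it satisfies.

To find `X` and `τ`, split `F₀` by the parts of its terms on `B` and strip these parts. It is enough
that `τ` makes one term of each resulting family true. Go through the families and greedily pick a
term that avoids `X` and all variables fixed so far. If a family has no such term, the set `Z` of
these variables hits all its terms: then `Z` becomes the new `X`, the family is split by the parts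
on `Z`, and all families are treated anew with nothing fixed. The new families have strictly shorter
terms, and their number is bounded by `|Z|` and `k`, however many terms there are. Hence the process
ends. By induction on the length of terms, `exists_stuck` bounds the steps and the number of entries
of the state by `workBound`, a function with an Ackermann-like recursion that depends on the
parameter only; it is computable, which suffices.

The rest is bookkeeping about running times: closure properties of `PolyTime` and `FptRuns` yield an
actual WHILE program for the reduction (`exists_reduction`). -/

/-! ### A calculus for running times of programs -/

namespace Prog

/-- Started in `s`, the program `p` halts after at most `t` steps in a store that satisfies `Q`. -/
def WP (p : Prog) (s : ℕ → Data) (t : ℕ) (Q : (ℕ → Data) → Prop) : Prop :=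
  ∃ s' n, n ≤ t ∧ Exec p s s' n ∧ Q s'

namespace WP

variable {p q : Prog} {s : ℕ → Data} {t u : ℕ} {Q R : (ℕ → Data) → Prop}

theorem mono (h : WP p s t Q) (htu : t ≤ u) (hQ : ∀ s', Q s' → R s') : WP p s u R := by
  obtain ⟨s', n, hn, he, hq⟩ := h
  exact ⟨s', n, hn.trans htu, he, hQ _ hq⟩

theorem setNil {x : ℕ} (h : Q (Function.update s x Data.nil)) : WP (setNil x) s 1 Q :=
  ⟨_, _, le_rfl, Exec.setNil x s, h⟩

theorem copy {x y : ℕ} (h : Q (Function.update s x (s y))) : WP (copy x y) s 1 Q :=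
  ⟨_, _, le_rfl, Exec.copy x y s, h⟩

theorem cons {x y z : ℕ} (h : Q (Function.update s x (Data.cons (s y) (s z)))) :
    WP (cons x y z) s 1 Q :=
  ⟨_, _, le_rfl, Exec.cons x y z s, h⟩

theorem hd {x y : ℕ} (h : Q (Function.update s x (s y).hd)) : WP (hd x y) s 1 Q :=
  ⟨_, _, le_rfl, Exec.hd x y s, h⟩

theorem tl {x y : ℕ} (h : Q (Function.update s x (s y).tl)) : WP (tl x y) s 1 Q :=
  ⟨_, _, le_rfl, Exec.tl x y s, h⟩

theorem seq (h : WP p s t (fun s' => WP q s' u Q)) : WP (seq p q) s (t + u) Q := by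
  obtain ⟨s', n, hn, he, s'', m, hm, he', hq⟩ := h
  exact ⟨s'', n + m, by omega, he.seq he', hq⟩

theorem iteTrue {x : ℕ} (hx : s x ≠ Data.nil) (h : WP p s t Q) :
    WP (ite x p q) s (t + 1) Q := by
  obtain ⟨s', n, hn, he, hq⟩ := h
  exact ⟨s', n + 1, by omega, he.iteTrue hx, hq⟩

theorem iteFalse {x : ℕ} (hx : s x = Data.nil) (h : WP q s t Q) :
    WP (ite x p q) s (t + 1) Q := by
  obtain ⟨s', n, hn, he, hq⟩ := h
  exact ⟨s', n + 1, by omega, he.iteFalse hx, hq⟩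

theorem loopDone {x : ℕ} (hx : s x = Data.nil) (h : Q s) : WP (loop x p) s 1 Q :=
  ⟨s, 1, le_rfl, Exec.loopDone hx, h⟩

theorem loopStep {x : ℕ} (hx : s x ≠ Data.nil) (h : WP p s t (fun s' => WP (loop x p) s' u Q)) :
    WP (loop x p) s (t + u + 1) Q := by
  obtain ⟨s', n, hn, he, s'', m, hm, he', hq⟩ := h
  exact ⟨s'', n + m + 1, by omega, he.loopStep hx he', hq⟩

end WP

/-- On input `d` in variable `0` the program `p` computes `e` in variable `0` in at most `t` steps;
variable `1` (used as a stack) is preserved and the only other variables used are `2`, `3`, `4`. -/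
def Runs (p : Prog) (d e : Data) (t : ℕ) : Prop :=
  ∀ s : ℕ → Data, s 0 = d →
    WP p s t (fun s' => s' 0 = e ∧ s' 1 = s 1 ∧ ∀ i, 5 ≤ i → s' i = s i)

theorem Runs.mono {p : Prog} {d e : Data} {t u : ℕ} (h : Runs p d e t) (htu : t ≤ u) :
    Runs p d e u :=
  fun s hs => (h s hs).mono htu fun _ => id

theorem Runs.wp {p : Prog} {d e : Data} {t : ℕ} {s : ℕ → Data} {Q : (ℕ → Data) → Prop}
    (h : Runs p d e t) (hs : s 0 = d)
    (hQ : ∀ s', s' 0 = e → s' 1 = s 1 → (∀ i, 5 ≤ i → s' i = s i) → Q s') : WP p s t Q :=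
  (h s hs).mono le_rfl fun s' h' => hQ s' h'.1 h'.2.1 h'.2.2

theorem runs_id (d : Data) : Runs (copy 0 0) d d 1 := by
  intro s hs
  refine WP.copy ⟨by simp [hs], by simp, fun i hi => ?_⟩
  rw [Function.update_of_ne (by omega)]

theorem runs_nil (d : Data) : Runs (setNil 0) d Data.nil 1 := by
  intro s hs
  refine WP.setNil ⟨by simp, by simp, fun i hi => ?_⟩
  rw [Function.update_of_ne (by omega)]

theorem runs_hd (d : Data) : Runs (hd 0 0) d d.hd 1 := by
  intro s hs
  refine WP.hd ⟨by simp [hs], by simp, fun i hi => ?_⟩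
  rw [Function.update_of_ne (by omega)]

theorem runs_tl (d : Data) : Runs (tl 0 0) d d.tl 1 := by
  intro s hs
  refine WP.tl ⟨by simp [hs], by simp, fun i hi => ?_⟩
  rw [Function.update_of_ne (by omega)]

theorem Runs.seq {p q : Prog} {d e g : Data} {t u : ℕ} (hp : Runs p d e t) (hq : Runs q e g u) :
    Runs (seq p q) d g (t + u) := by
  intro s hs
  refine WP.seq (hp.wp hs fun s' h0 h1 h5 => hq.wp h0 fun s'' h0' h1' h5' => ?_)
  exact ⟨h0', h1'.trans h1, fun i hi => (h5' i hi).trans (h5 i hi)⟩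

/-- Run `p` on a copy of the input and save the result in variable `2`. -/
def withSaved (p : Prog) : Prog :=
  seq (cons 1 0 1) (seq p (seq (copy 2 0) (seq (hd 0 1) (tl 1 1))))

theorem withSaved_wp {p : Prog} {d e : Data} {t : ℕ} (hp : Runs p d e t) {s : ℕ → Data}
    {Q : (ℕ → Data) → Prop} (hs : s 0 = d)
    (hQ : ∀ s', s' 0 = d → s' 1 = s 1 → s' 2 = e → (∀ i, 5 ≤ i → s' i = s i) → Q s') :
    WP (withSaved p) s (1 + (t + (1 + (1 + 1)))) Q := by
  refine WP.seq (WP.cons (WP.seq (hp.wp (by simp [hs]) fun s' h0 h1 h5 => ?_)))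
  refine WP.seq (WP.copy (WP.seq (WP.hd (WP.tl (hQ _ ?_ ?_ ?_ ?_)))))
  · simp [h1, hs, Data.hd]
  · simp [h1, Data.tl]
  · simp [h0]
  · intro i hi
    have := h5 i hi
    simp only [Function.update_of_ne (show i ≠ 0 by omega), Function.update_of_ne (show i ≠ 1 by omega),
      Function.update_of_ne (show i ≠ 2 by omega)] at this ⊢
    exact this

/-- Pair the results of two programs. -/
def pairing (p q : Prog) : Prog :=
  seq (withSaved p) (seq (cons 1 2 1) (seq q (seq (hd 2 1) (seq (tl 1 1) (cons 0 2 0)))))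

theorem Runs.pairing {p q : Prog} {d e g : Data} {t u : ℕ} (hp : Runs p d e t)
    (hq : Runs q d g u) : Runs (pairing p q) d (Data.cons e g) (t + u + 8) := by
  intro s hs
  refine WP.mono (u := t + u + 8) (WP.seq (withSaved_wp hp hs fun s1 h0 h1 h2 h5 =>
    WP.seq (WP.cons (WP.seq (hq.wp (by simp [h0]) fun s2 g0 g1 g5 =>
      WP.seq (WP.hd (WP.seq (WP.tl (WP.cons ?_))))))))) (by omega) (fun _ => id)
  refine ⟨by simp [g1, g0, h2, Data.hd], by simp [g1, h1, Data.tl], fun i hi => ?_⟩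
  have := g5 i hi
  have := h5 i hi
  simp_all [Function.update_of_ne (show i ≠ 0 by omega), Function.update_of_ne (show i ≠ 1 by omega),
      Function.update_of_ne (show i ≠ 2 by omega)]

/-- Branch on the result of a test. -/
def branch (r p q : Prog) : Prog := seq (withSaved r) (ite 2 p q)

theorem Runs.branch_true {r p q : Prog} {d c e : Data} {t u : ℕ} (hr : Runs r d c t)
    (hc : c ≠ Data.nil) (hp : Runs p d e u) : Runs (branch r p q) d e (t + u + 5) := by
  intro s hs
  refine WP.mono (u := t + u + 5) (WP.seq (withSaved_wp hr hs fun s1 h0 h1 h2 h5 =>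
    WP.iteTrue (by rwa [h2]) (hp.wp h0 fun s2 g0 g1 g5 => ?_))) (by omega) (fun _ => id)
  exact ⟨g0, g1.trans h1, fun i hi => (g5 i hi).trans (h5 i hi)⟩

theorem Runs.branch_false {r p q : Prog} {d c e : Data} {t u : ℕ} (hr : Runs r d c t)
    (hc : c = Data.nil) (hq : Runs q d e u) : Runs (branch r p q) d e (t + u + 5) := by
  intro s hs
  refine WP.mono (u := t + u + 5) (WP.seq (withSaved_wp hr hs fun s1 h0 h1 h2 h5 =>
    WP.iteFalse (by rwa [h2]) (hq.wp h0 fun s2 g0 g1 g5 => ?_))) (by omega) (fun _ => id)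
  exact ⟨g0, g1.trans h1, fun i hi => (g5 i hi).trans (h5 i hi)⟩

/-- Repeat `p` as long as the test `r` is positive. -/
def while_ (r p : Prog) : Prog := seq (withSaved r) (loop 2 (seq p (withSaved r)))

/-- `d i` is the datum after `i` rounds; the test is evaluated `n + 1` times, the body `n` times. -/
theorem Runs.while {r p : Prog} (d c : ℕ → Data) (n t u : ℕ)
    (hr : ∀ i ≤ n, Runs r (d i) (c i) t) (hp : ∀ i < n, Runs p (d i) (d (i + 1)) u)
    (hc : ∀ i < n, c i ≠ Data.nil) (hn : c n = Data.nil) :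
    Runs (while_ r p) (d 0) (d n) ((n + 1) * (t + u + 6)) := by
  -- Here `j` counts the rounds that are left, and variable `2` holds the result of the test just
  -- made.
  have key : ∀ j ≤ n, ∀ s : ℕ → Data, s 0 = d (n - j) → s 2 = c (n - j) →
      WP (loop 2 (Prog.seq p (withSaved r))) s (j * (t + u + 5) + 1)
        (fun s' => s' 0 = d n ∧ s' 1 = s 1 ∧ ∀ i, 5 ≤ i → s' i = s i) := by
    intro j
    induction j with
    | zero =>
      intro _ s h0 h2
      exact (WP.loopDone (by simpa [hn] using h2) ⟨by simpa using h0, rfl, fun _ _ => rfl⟩).mono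
        (by omega) fun _ => id
    | succ j ih =>
      intro hj s h0 h2
      have e : n - (j + 1) + 1 = n - j := by omega
      refine WP.mono (WP.loopStep (by rw [h2]; exact hc _ (by omega))
        (WP.seq ((hp _ (by omega)).wp h0 fun s1 g0 g1 g5 =>
          withSaved_wp (hr _ (by omega)) g0 fun s2 k0 k1 k2 k5 => ?_)))
          (u := (j + 1) * (t + u + 5) + 1) (t := (u + (1 + (t + (1 + (1 + 1))))) +
            (j * (t + u + 5) + 1) + 1) (by ring_nf; omega) (fun _ => id)
      refine (ih (by omega) s2 (by rw [k0, e]) (by rw [k2, e])).mono le_rfl ?_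
      rintro s3 ⟨l0, l1, l5⟩
      exact ⟨l0, l1.trans (k1.trans g1), fun i hi => (l5 i hi).trans ((k5 i hi).trans (g5 i hi))⟩
  intro s hs
  refine WP.mono (WP.seq (withSaved_wp (hr 0 (by omega)) hs fun s1 h0 h1 h2 h5 =>
    (key n le_rfl s1 (by simpa using h0) (by simpa using h2)).mono le_rfl
      (R := fun s' => s' 0 = d n ∧ s' 1 = s 1 ∧ ∀ i, 5 ≤ i → s' i = s i) ?_))
    (by ring_nf; omega) (fun _ => id)
  rintro s2 ⟨g0, g1, g5⟩
  exact ⟨g0, g1.trans h1, fun i hi => (g5 i hi).trans (h5 i hi)⟩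

/-- One round of a fold, on data of the form `(c, (b, a :: l))`. -/
def foldBody (p : Prog) : Prog :=
  -- The input is pushed, `p` is run on `(c, (b, a))`, and the saved copy is popped to rebuild `(c,
  -- (b', l))`. Variable `2` ends up holding `l`, which the loop of the fold tests.
  seq (cons 1 0 1) (seq (hd 2 0) (seq (tl 3 0) (seq (hd 4 3) (seq (tl 3 3) (seq (hd 3 3)
    (seq (cons 3 4 3) (seq (cons 0 2 3) (seq p (seq (hd 2 1) (seq (tl 1 1) (seq (hd 3 2)
      (seq (tl 2 2) (seq (tl 2 2) (seq (tl 2 2) (seq (cons 0 0 2) (cons 0 3 0))))))))))))))))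

theorem foldBody_wp {p : Prog} {c b a l b' : Data} {t : ℕ}
    (hp : Runs p (Data.cons c (Data.cons b a)) b' t) {s : ℕ → Data} {Q : (ℕ → Data) → Prop}
    (hs : s 0 = Data.cons c (Data.cons b (Data.cons a l)))
    (hQ : ∀ s', s' 0 = Data.cons c (Data.cons b' l) → s' 1 = s 1 → s' 2 = l →
      (∀ i, 5 ≤ i → s' i = s i) → Q s') : WP (foldBody p) s (t + 16) Q := by
  refine WP.mono (u := t + 16) (WP.seq (WP.cons (WP.seq (WP.hd (WP.seq (WP.tl (WP.seq (WP.hd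
    (WP.seq (WP.tl (WP.seq (WP.hd (WP.seq (WP.cons (WP.seq (WP.cons (WP.seq (hp.wp ?_
      fun s1 h0 h1 h5 => WP.seq (WP.hd (WP.seq (WP.tl (WP.seq (WP.hd (WP.seq (WP.tl (WP.seq (WP.tl
        (WP.seq (WP.tl (WP.seq (WP.cons (WP.cons (hQ _ ?_ ?_ ?_ ?_)))))))))))))))))))))))))))))))))
          (by omega) (fun _ => id)
  · simp [hs, Data.hd, Data.tl]
  · simp at h1
    simp [h0, h1, hs, Data.hd, Data.tl]
  · simp at h1
    simp [h1, Data.tl]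
  · simp at h1
    simp [h1, hs, Data.tl, Data.hd]
  · intro i hi
    have := h5 i hi
    simp_all [Function.update_of_ne (show i ≠ 0 by omega),
      Function.update_of_ne (show i ≠ 1 by omega), Function.update_of_ne (show i ≠ 2 by omega),
      Function.update_of_ne (show i ≠ 3 by omega), Function.update_of_ne (show i ≠ 4 by omega)]

/-- Fold over a list, on data of the form `(c, (b, l))`. -/
def fold (p : Prog) : Prog :=
  seq (tl 2 0) (seq (tl 2 2) (seq (loop 2 (foldBody p)) (seq (tl 0 0) (hd 0 0))))

/-- `b l₁` is the accumulator after the prefix `l₁`, and `c` is a context visible in each round. The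
bound `t` is only required for the splittings of this `l`, so it may depend on `l`. -/
theorem Runs.fold {p : Prog} {α : Type} (ea : α → Data) (c : Data) (b : List α → Data)
    (l : List α) (t : ℕ)
    (hp : ∀ l₁ a l₂, l = l₁ ++ a :: l₂ →
      Runs p (Data.cons c (Data.cons (b l₁) (ea a))) (b (l₁ ++ [a])) t) :
    Runs (fold p) (Data.cons c (Data.cons (b []) (Data.ofList ea l))) (b l)
      ((l.length + 1) * (t + 22)) := by
  have key : ∀ l₂ l₁ : List α, l = l₁ ++ l₂ → ∀ s : ℕ → Data,
      s 0 = Data.cons c (Data.cons (b l₁) (Data.ofList ea l₂)) → s 2 = Data.ofList ea l₂ →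
      WP (loop 2 (foldBody p)) s (l₂.length * (t + 17) + 1)
        (fun s' => s' 0 = Data.cons c (Data.cons (b l) Data.nil) ∧ s' 1 = s 1 ∧
          ∀ i, 5 ≤ i → s' i = s i) := by
    intro l₂
    induction l₂ with
    | nil =>
      intro l₁ hl s h0 h2
      obtain rfl : l = l₁ := by simpa using hl
      refine (WP.loopDone (by simpa [Data.ofList] using h2)
        ⟨by simpa [Data.ofList] using h0, rfl, fun _ _ => rfl⟩).mono (by omega) fun _ => id
    | cons a l₂ ih =>
      intro l₁ hl s h0 h2
      refine WP.mono (WP.loopStep (by rw [h2]; simp [Data.ofList])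
        (foldBody_wp (hp l₁ a l₂ hl) h0 fun s1 g0 g1 g2 g5 =>
          (ih (l₁ ++ [a]) (by simp [hl]) s1 g0 g2).mono le_rfl ?_))
          (by simp only [List.length_cons]; ring_nf; omega) (fun _ => id)
      rintro s2 ⟨k0, k1, k5⟩
      exact ⟨k0, k1.trans g1, fun i hi => (k5 i hi).trans (g5 i hi)⟩
  intro s hs
  refine WP.mono (WP.seq (WP.tl (WP.seq (WP.tl (WP.seq ((key l [] rfl _ ?_ ?_).mono le_rfl ?_))))))
    (u := (l.length + 1) * (t + 22)) (t := 1 + (1 + ((l.length * (t + 17) + 1) + (1 + 1))))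
      (by ring_nf; omega) (fun _ => id)
  · simp [hs]
  · simp [hs, Data.tl]
  · rintro s1 ⟨g0, g1, g5⟩
    refine WP.seq (WP.tl (WP.hd ⟨by simp [g0, Data.tl, Data.hd], by simp [g1], fun i hi => ?_⟩))
    have := g5 i hi
    simp_all [Function.update_of_ne (show i ≠ 0 by omega),
      Function.update_of_ne (show i ≠ 2 by omega)]

end Prog

/-! ### Encoded types and polynomial time -/

/-- Types with an encoding as binary trees. -/
class Enc (α : Type) where
  enc : α → Data

open Enc (enc)

instance : Enc Data := ⟨id⟩
instance : Enc Bool := ⟨Data.ofBool⟩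
instance : Enc ℕ := ⟨Data.ofNat⟩
instance : Enc Quant := ⟨Data.ofQuant⟩
instance : Enc Lit := ⟨Data.ofLit⟩
instance : Enc Constraint := ⟨Data.ofConstraint⟩
instance {α : Type} [Enc α] : Enc (List α) := ⟨Data.ofList enc⟩
instance {α β : Type} [Enc α] [Enc β] : Enc (α × β) := ⟨fun p => Data.cons (enc p.1) (enc p.2)⟩

/-- The size of the encoding. -/
def esize {α : Type} [Enc α] (a : α) : ℕ := (enc a).size

theorem Data.size_pos (d : Data) : 0 < d.size := by
  cases d <;> simp [Data.size]

section

variable {α β γ δ : Type} [Enc α] [Enc β] [Enc γ] [Enc δ]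

theorem esize_pos (a : α) : 0 < esize a := Data.size_pos _

@[simp] theorem enc_nil : enc ([] : List α) = Data.nil := rfl

@[simp] theorem enc_cons (a : α) (l : List α) : enc (a :: l) = Data.cons (enc a) (enc l) := rfl

@[simp] theorem enc_pair (a : α) (b : β) : enc (a, b) = Data.cons (enc a) (enc b) := rfl

@[simp] theorem esize_nil : esize ([] : List α) = 1 := rfl

@[simp] theorem esize_cons (a : α) (l : List α) : esize (a :: l) = esize a + esize l + 1 := rfl

@[simp] theorem esize_pair (a : α) (b : β) : esize (a, b) = esize a + esize b + 1 := rfl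

theorem esize_bool (b : Bool) : esize b ≤ 3 := by
  cases b <;> decide

theorem length_lt_esize (l : List α) : l.length < esize l := by
  induction l with
  | nil => simp
  | cons a l ih => simp only [List.length_cons, esize_cons]; omega

theorem esize_append (l l' : List α) : esize (l ++ l') + 1 = esize l + esize l' := by
  induction l with
  | nil => simp; omega
  | cons a l ih => simp only [List.cons_append, esize_cons]; omega

theorem List.Sublist.esize_le {l l' : List α} (h : l.Sublist l') : esize l ≤ esize l' := by
  induction h with
  | slnil => rfl
  | cons a h ih => simp only [esize_cons]; omega
  | cons_cons a h ih => simp only [esize_cons]; omega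

theorem esize_lt_of_mem {a : α} {l : List α} (h : a ∈ l) : esize a < esize l := by
  induction l with
  | nil => simp at h
  | cons b l ih =>
    rw [List.mem_cons] at h
    rw [esize_cons]
    rcases h with rfl | h
    · omega
    · have := ih h
      omega

theorem esize_reverse (l : List α) : esize l.reverse = esize l := by
  induction l with
  | nil => rfl
  | cons a l ih =>
    have := esize_append l.reverse [a]
    simp only [List.reverse_cons, esize_cons, esize_nil] at *
    omega

/-- A list is small if it is short and its entries are small. -/
theorem esize_le_of_forall {l : List α} {m : ℕ} (h : ∀ a ∈ l, esize a ≤ m) :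
    esize l ≤ l.length * (m + 1) + 1 := by
  induction l with
  | nil => simp
  | cons a l ih =>
    have h1 := ih fun b hb => h b (List.mem_cons_of_mem _ hb)
    have h2 := h a List.mem_cons_self
    simp only [List.length_cons, esize_cons]
    ring_nf at *
    omega

/-- Polynomially bounded functions. -/
def PolyBdd (g : α → ℕ) : Prop := ∃ c, ∀ a, g a ≤ (esize a + 1) ^ c

namespace PolyBdd

variable {f g : α → ℕ}

theorem mono (hg : PolyBdd g) (h : ∀ a, f a ≤ g a) : PolyBdd f :=
  hg.imp fun _ hc a => (h a).trans (hc a)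

/-- The base `esize a + 1` is at least `2`, so a constant is absorbed by the exponent. -/
theorem const (n : ℕ) : PolyBdd (fun _ : α => n) :=
  ⟨n, fun a => n.lt_two_pow_self.le.trans
    (Nat.pow_le_pow_left (by have := esize_pos a; omega) n)⟩

theorem size : PolyBdd (fun a : α => esize a) := ⟨1, fun a => by simp⟩

theorem mul (hf : PolyBdd f) (hg : PolyBdd g) : PolyBdd (fun a => f a * g a) := by
  obtain ⟨c, hc⟩ := hf
  obtain ⟨d, hd⟩ := hg
  exact ⟨c + d, fun a => by rw [pow_add]; exact Nat.mul_le_mul (hc a) (hd a)⟩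

theorem add (hf : PolyBdd f) (hg : PolyBdd g) : PolyBdd (fun a => f a + g a) := by
  obtain ⟨c, hc⟩ := hf
  obtain ⟨d, hd⟩ := hg
  refine ⟨c + d + 1, fun a => ?_⟩
  have h2 : 2 ≤ esize a + 1 := by have := esize_pos a; omega
  have h1 : 1 ≤ esize a + 1 := by omega
  calc f a + g a ≤ (esize a + 1) ^ (c + d) + (esize a + 1) ^ (c + d) :=
        Nat.add_le_add ((hc a).trans (Nat.pow_le_pow_right h1 (by omega)))
          ((hd a).trans (Nat.pow_le_pow_right h1 (by omega)))
    _ = (esize a + 1) ^ (c + d) * 2 := by ring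
    _ ≤ (esize a + 1) ^ (c + d) * (esize a + 1) := Nat.mul_le_mul_left _ h2
    _ = _ := by rw [pow_succ]

theorem pow (hf : PolyBdd f) (n : ℕ) : PolyBdd (fun a => f a ^ n) := by
  induction n with
  | zero => simpa using const 1
  | succ n ih => simpa only [pow_succ] using ih.mul hf

theorem comp {g : β → ℕ} (hg : PolyBdd g) {f : α → β} (hf : PolyBdd fun a => esize (f a)) :
    PolyBdd (fun a => g (f a)) := by
  obtain ⟨c, hc⟩ := hg
  exact ((hf.add (const 1)).pow c).mono fun a => hc (f a)

end PolyBdd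

/-- Functions that a program computes in polynomial time, with results of polynomial size. -/
def PolyTime (f : α → β) : Prop :=
  (∃ (p : Prog) (T : α → ℕ), PolyBdd T ∧ ∀ a, p.Runs (enc a) (enc (f a)) (T a)) ∧
    PolyBdd fun a => esize (f a)

/-! ### Closure properties of polynomial time -/

namespace PolyTime

theorem of_enc_eq {f : α → β} (h : ∀ a, enc (f a) = enc a) : PolyTime f :=
  ⟨⟨Prog.copy 0 0, fun _ => 1, PolyBdd.const 1, fun a => by rw [h]; exact Prog.runs_id _⟩,
    PolyBdd.size.mono fun a => by rw [esize, h, esize]⟩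

theorem of_eq {f g : α → β} (hf : PolyTime f) (h : ∀ a, f a = g a) : PolyTime g :=
  funext h ▸ hf

theorem id : PolyTime (fun a : α => a) := of_enc_eq fun _ => rfl

theorem enc : PolyTime (Enc.enc : α → Data) := of_enc_eq fun _ => rfl

theorem comp {g : β → γ} {f : α → β} (hg : PolyTime g) (hf : PolyTime f) :
    PolyTime (fun a => g (f a)) := by
  obtain ⟨⟨p, T, hT, hp⟩, hs⟩ := hf
  obtain ⟨⟨q, U, hU, hq⟩, hs'⟩ := hg
  exact ⟨⟨p.seq q, _, hT.add (hU.comp hs), fun a => (hp a).seq (hq (f a))⟩, hs'.comp hs⟩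

theorem pair {f : α → β} {g : α → γ} (hf : PolyTime f) (hg : PolyTime g) :
    PolyTime (fun a => (f a, g a)) := by
  obtain ⟨⟨p, T, hT, hp⟩, hs⟩ := hf
  obtain ⟨⟨q, U, hU, hq⟩, hs'⟩ := hg
  exact ⟨⟨p.pairing q, _, (hT.add hU).add (PolyBdd.const 8), fun a => (hp a).pairing (hq a)⟩,
    (hs.add hs').add (PolyBdd.const 1)⟩

theorem _root_.Data.size_hd_le (d : Data) : d.hd.size ≤ d.size := by
  cases d <;> simp [Data.hd, Data.size]; omega

theorem _root_.Data.size_tl_le (d : Data) : d.tl.size ≤ d.size := by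
  cases d <;> simp [Data.tl, Data.size]; omega

theorem hd : PolyTime Data.hd :=
  ⟨⟨Prog.hd 0 0, fun _ => 1, PolyBdd.const 1, Prog.runs_hd⟩,
    PolyBdd.size.mono Data.size_hd_le⟩

theorem tl : PolyTime Data.tl :=
  ⟨⟨Prog.tl 0 0, fun _ => 1, PolyBdd.const 1, Prog.runs_tl⟩,
    PolyBdd.size.mono Data.size_tl_le⟩

/-- Polynomial time depends on the encodings only. -/
theorem of_data {f : α → β} {g : Data → Data} (hg : PolyTime g)
    (h : ∀ a, Enc.enc (f a) = g (Enc.enc a)) : PolyTime f := by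
  obtain ⟨⟨p, T, hT, hp⟩, hs⟩ := hg
  refine ⟨⟨p, fun a => T (Enc.enc a), ?_, fun a => by rw [h]; exact hp _⟩, ?_⟩
  · exact hT.comp PolyBdd.size
  · refine (hs.comp (f := fun a : α => Enc.enc a) PolyBdd.size).mono fun a => ?_
    rw [esize, h]
    rfl

theorem fst : PolyTime (fun x : α × β => x.1) := of_data hd fun _ => rfl

theorem snd : PolyTime (fun x : α × β => x.2) := of_data tl fun _ => rfl

theorem const (b : β) : PolyTime (fun _ : α => b) := by
  suffices h : ∀ d : Data, PolyTime (fun _ : Data => d) from of_data (h (Enc.enc b)) fun _ => rfl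
  intro d
  induction d with
  | nil => exact ⟨⟨Prog.setNil 0, fun _ => 1, PolyBdd.const 1, Prog.runs_nil⟩, PolyBdd.const _⟩
  | cons a b ha hb => exact of_data (PolyTime.pair ha hb |>.comp PolyTime.enc) fun _ => rfl

theorem cond {p : α → Bool} {f g : α → β} (hp : PolyTime p) (hf : PolyTime f) (hg : PolyTime g) :
    PolyTime (fun a => bif p a then f a else g a) := by
  obtain ⟨⟨r, R, hR, hr⟩, -⟩ := hp
  obtain ⟨⟨p', T, hT, hp'⟩, hs⟩ := hf
  obtain ⟨⟨q, U, hU, hq⟩, hs'⟩ := hg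
  refine ⟨⟨r.branch p' q, fun a => R a + (T a + U a) + 5,
    (hR.add (hT.add hU)).add (PolyBdd.const 5), fun a => ?_⟩, (hs.add hs').mono fun a => ?_⟩
  · have := hr a
    beta_reduce
    cases h : p a with
    | true =>
      exact ((hr a).branch_true (by rw [h]; nofun) ((hp' a).mono (Nat.le_add_right _ _)))
    | false =>
      exact ((hr a).branch_false (by rw [h]; rfl) ((hq a).mono (Nat.le_add_left _ _)))
  · beta_reduce
    cases h : p a <;> simp

/-- The empty list is encoded by `nil`, so the program for `l` doubles as the test; in the nonempty
branch it is run again to pair its result with the input. -/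
theorem listCases {l : δ → List α} {g : δ → β} {h : δ × (α × List α) → β} (hl : PolyTime l)
    (hg : PolyTime g) (hh : PolyTime h) :
    PolyTime (fun x => match l x with
      | [] => g x
      | a :: as => h (x, (a, as))) := by
  obtain ⟨⟨r, R, hR, hr⟩, hsl⟩ := hl
  obtain ⟨⟨q, U, hU, hq⟩, hs'⟩ := hg
  obtain ⟨⟨p, T, hT, hp⟩, hs⟩ := hh
  obtain ⟨c, hc⟩ := hT
  obtain ⟨e, he⟩ := hs
  have key : PolyBdd fun x => esize x + esize (l x) + 2 :=
    (PolyBdd.size.add hsl).add (PolyBdd.const 2)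
  refine ⟨⟨r.branch ((Prog.pairing (Prog.copy 0 0) r).seq p) q,
    fun a => R a + ((1 + R a + 8 + (esize a + esize (l a) + 2) ^ c) + U a) + 5,
    (hR.add (((((PolyBdd.const 1).add hR).add (PolyBdd.const 8)).add (key.pow c)).add hU)).add
      (PolyBdd.const 5), fun x => ?_⟩, ((key.pow e).add hs').mono fun x => ?_⟩
  · have h1 := hr x
    beta_reduce
    cases hx : l x with
    | nil =>
      rw [hx] at h1
      exact h1.branch_false rfl ((hq x).mono (Nat.le_add_left _ _))
    | cons a as =>
      rw [hx] at h1
      refine h1.branch_true (by simp) (Prog.Runs.mono (u := _ + _)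
        (((Prog.runs_id _).pairing h1).seq ((hp (x, (a, as))).mono (hc _))) ?_)
      simp only [esize_cons, esize_pair]
      exact (Nat.le_add_right _ _).trans' le_rfl
  · beta_reduce
    cases hx : l x with
    | nil => simp
    | cons a as =>
      refine ((he (x, (a, as))).trans ?_).trans (Nat.le_add_right _ _)
      simp only [esize_cons, esize_pair]
      exact le_rfl

theorem cons {f : δ → α} {g : δ → List α} (hf : PolyTime f) (hg : PolyTime g) :
    PolyTime (fun x => f x :: g x) :=
  (of_enc_eq (α := α × List α) (f := fun p => p.1 :: p.2) fun _ => rfl).comp (hf.pair hg)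

/-- Polynomial time per round is not enough, since the accumulator could double each time; `hsize`
keeps it polynomial on all prefixes of the list. -/
theorem foldl {l : δ → List α} {b : δ → β} {f : δ × (β × α) → β} (hf : PolyTime f)
    (hl : PolyTime l) (hb : PolyTime b) {g : δ → ℕ} (hg : PolyBdd g)
    (hsize : ∀ x l₁, l₁ <+: l x → esize (l₁.foldl (fun b a => f (x, (b, a))) (b x)) ≤ g x) :
    PolyTime (fun x => (l x).foldl (fun b a => f (x, (b, a))) (b x)) := by
  obtain ⟨⟨p, T, hT, hp⟩, hs⟩ := hf
  obtain ⟨⟨q, U, hU, hq⟩, hsl⟩ := hl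
  obtain ⟨⟨r, R, hR, hr⟩, hsb⟩ := hb
  obtain ⟨c, hc⟩ := hT
  refine ⟨⟨(Prog.pairing (Prog.copy 0 0) (r.pairing q)).seq p.fold, fun x =>
    (1 + (R x + U x + 8) + 8) +
      (esize (l x) + 1) * ((esize x + (g x + esize (l x)) + 3) ^ c + 22), ?_, fun x => ?_⟩, ?_⟩
  · exact (((PolyBdd.const 1).add ((hR.add hU).add (PolyBdd.const 8))).add (PolyBdd.const 8)).add
      ((hsl.add (PolyBdd.const 1)).mul ((((PolyBdd.size.add (hg.add hsl)).add
        (PolyBdd.const 3)).pow c).add (PolyBdd.const 22)))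
  · refine ((Prog.runs_id _).pairing ((hr x).pairing (hq x))).seq ?_
    refine Prog.Runs.mono (Prog.Runs.fold Enc.enc (Enc.enc x)
      (fun l₁ => Enc.enc (l₁.foldl (fun b a => f (x, (b, a))) (b x))) (l x) _
      fun l₁ a l₂ h => ?_) (Nat.mul_le_mul_right _ (Nat.succ_le_succ (length_lt_esize (l x)).le))
    rw [List.foldl_append]
    refine (hp (x, (_, a))).mono ((hc _).trans (Nat.pow_le_pow_left ?_ c))
    have h1 := hsize x l₁ ⟨_, h.symm⟩
    have h2 : esize a < esize (l x) := esize_lt_of_mem (by simp [h])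
    simp only [esize_pair]
    omega
  · exact hg.mono fun x => hsize x _ (List.prefix_refl _)

theorem reverse {l : δ → List α} (hl : PolyTime l) : PolyTime (fun x => (l x).reverse) := by
  have h := foldl (f := fun y : δ × (List α × α) => y.2.2 :: y.2.1)
    (cons (snd.comp snd) (fst.comp snd)) hl (const []) hl.2 fun x l₁ h1 => by
      have e : ∀ (l l' : List α), l.foldl (fun b a => a :: b) l' = l.reverse ++ l' := by
        intro l
        induction l <;> simp_all
      rw [e, List.append_nil, esize_reverse]
      exact h1.sublist.esize_le
  convert h using 2 with x
  have e : ∀ (l l' : List α), l.foldl (fun b a => a :: b) l' = l.reverse ++ l' := by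
    intro l
    induction l <;> simp_all
  simp [e]

theorem foldr {l : δ → List α} {b : δ → β} {f : δ × (β × α) → β} (hf : PolyTime f)
    (hl : PolyTime l) (hb : PolyTime b) {g : δ → ℕ} (hg : PolyBdd g)
    (hsize : ∀ x l₁, l₁ <:+ l x → esize (l₁.foldr (fun a b => f (x, (b, a))) (b x)) ≤ g x) :
    PolyTime (fun x => (l x).foldr (fun a b => f (x, (b, a))) (b x)) := by
  have h := foldl hf hl.reverse hb hg fun x l₁ h1 => by
    have := hsize x l₁.reverse (by simpa using List.reverse_suffix.2 h1)
    simpa using this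
  simpa using h

theorem append {l l' : δ → List α} (hl : PolyTime l) (hl' : PolyTime l') :
    PolyTime (fun x => l x ++ l' x) := by
  have e : ∀ (l l' : List α), l.foldr (fun a b => a :: b) l' = l ++ l' := by
    intro l
    induction l <;> simp_all
  have h := foldr (f := fun y : δ × (List α × α) => y.2.2 :: y.2.1)
    (cons (snd.comp snd) (fst.comp snd)) hl hl' (hl.2.add hl'.2) fun x l₁ h1 => by
      rw [e]
      have h2 := esize_append l₁ (l' x)
      have h3 := h1.sublist.esize_le
      omega
  simpa [e] using h

theorem map {l : δ → List α} {f : δ × α → β} (hf : PolyTime f) (hl : PolyTime l) :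
    PolyTime (fun x => (l x).map fun a => f (x, a)) := by
  obtain ⟨c, hc⟩ := hf.2
  have e : ∀ x (l : List α),
      l.foldr (fun a b => f (x, a) :: b) [] = l.map fun a => f (x, a) := by
    intro x l
    induction l <;> simp_all
  have h := foldr (f := fun y : δ × (List β × α) => f (y.1, y.2.2) :: y.2.1)
    (cons (hf.comp (fst.pair (snd.comp snd))) (fst.comp snd)) hl (const [])
    (g := fun x => esize (l x) * ((esize x + esize (l x) + 2) ^ c + 1) + 1)
    ((hl.2.mul ((((PolyBdd.size.add hl.2).add (PolyBdd.const 2)).pow c).add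
      (PolyBdd.const 1))).add (PolyBdd.const 1)) fun x l₁ h1 => by
      simp only [e]
      refine (esize_le_of_forall (m := (esize x + esize (l x) + 2) ^ c) ?_).trans ?_
      · intro b hb
        obtain ⟨a, ha, rfl⟩ := List.mem_map.1 hb
        refine (hc _).trans (Nat.pow_le_pow_left ?_ c)
        have := esize_lt_of_mem (h1.mem ha)
        simp only [esize_pair]
        omega
      · have := length_lt_esize (l x)
        have := h1.length_le
        gcongr
        simp only [List.length_map]
        omega
  simpa only [e] using h

theorem filter {l : δ → List α} {p : δ × α → Bool} (hp : PolyTime p) (hl : PolyTime l) :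
    PolyTime (fun x => (l x).filter fun a => p (x, a)) := by
  have e : ∀ x (l : List α), l.foldr (fun a b => bif p (x, a) then a :: b else b) [] =
      l.filter fun a => p (x, a) := by
    intro x l
    induction l with
    | nil => rfl
    | cons a l ih => rw [List.foldr_cons, ih, List.filter_cons]; cases p (x, a) <;> rfl
  have h := foldr (f := fun y : δ × (List α × α) => bif p (y.1, y.2.2) then y.2.2 :: y.2.1 else y.2.1)
    (cond (hp.comp (fst.pair (snd.comp snd))) (cons (snd.comp snd) (fst.comp snd)) (fst.comp snd))
    hl (const []) hl.2 fun x l₁ h1 => by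
      simp only [e]
      exact (List.filter_sublist.trans h1.sublist).esize_le
  simpa only [e] using h

theorem flatMap {l : δ → List α} {f : δ × α → List β} (hf : PolyTime f) (hl : PolyTime l) :
    PolyTime (fun x => (l x).flatMap fun a => f (x, a)) := by
  have hm := (map hf hl).2
  have e : ∀ x (l : List α), l.foldr (fun a b => f (x, a) ++ b) [] =
      l.flatMap fun a => f (x, a) := by
    intro x l
    induction l <;> simp_all
  have h := foldr (f := fun y : δ × (List β × α) => f (y.1, y.2.2) ++ y.2.1)
    (append (hf.comp (fst.pair (snd.comp snd))) (fst.comp snd)) hl (const []) hm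
    fun x l₁ h1 => by
      simp only [e]
      refine le_trans ?_ ((h1.sublist.map fun a => f (x, a)).esize_le)
      clear h1
      induction l₁ with
      | nil => simp
      | cons a l₁ ih =>
        have := esize_append (f (x, a)) (l₁.flatMap fun a => f (x, a))
        simp only [List.flatMap_cons, List.map_cons, esize_cons]
        omega
  simpa only [e] using h

theorem not {p : δ → Bool} (hp : PolyTime p) : PolyTime (fun x => !p x) := by
  have := hp.cond (const false) (const true)
  convert this using 2 with x
  cases p x <;> rfl

theorem and {p q : δ → Bool} (hp : PolyTime p) (hq : PolyTime q) :
    PolyTime (fun x => p x && q x) := by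
  have := hp.cond hq (const false)
  convert this using 2 with x
  cases p x <;> rfl

theorem or {p q : δ → Bool} (hp : PolyTime p) (hq : PolyTime q) :
    PolyTime (fun x => p x || q x) := by
  have := hp.cond (const true) hq
  convert this using 2 with x
  cases p x <;> rfl

theorem xor {p q : δ → Bool} (hp : PolyTime p) (hq : PolyTime q) :
    PolyTime (fun x => Bool.xor (p x) (q x)) := by
  have := hp.cond hq.not hq
  convert this using 2 with x
  cases p x <;> cases q x <;> rfl

theorem isEmpty {l : δ → List α} (hl : PolyTime l) : PolyTime (fun x => (l x).isEmpty) := by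
  have := listCases hl (const true) (const (α := δ × (α × List α)) false)
  convert this using 2 with x
  cases l x <;> rfl

theorem any {l : δ → List α} {p : δ × α → Bool} (hp : PolyTime p) (hl : PolyTime l) :
    PolyTime (fun x => (l x).any fun a => p (x, a)) := by
  have := (isEmpty (filter hp hl)).not
  convert this using 2 with x
  rw [Bool.eq_iff_iff]
  simp

theorem all {l : δ → List α} {p : δ × α → Bool} (hp : PolyTime p) (hl : PolyTime l) :
    PolyTime (fun x => (l x).all fun a => p (x, a)) := by
  have := (any hp.not hl).not
  convert this using 2 with x
  rw [Bool.eq_iff_iff]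
  simp

end PolyTime

end

section

variable {α β γ δ : Type} [Enc α] [Enc β] [Enc γ] [Enc δ]

namespace PolyTime

theorem of_enc_comp {f : α → β} {g : α → Data} (hg : PolyTime g)
    (h : ∀ a, Enc.enc (f a) = g a) : PolyTime f := by
  obtain ⟨⟨p, T, hT, hp⟩, hs⟩ := hg
  exact ⟨⟨p, T, hT, fun a => by rw [h]; exact hp _⟩, hs.mono fun a => by rw [esize, h]; rfl⟩

/-- One program works for all inputs, with the number of rounds `n` and the size bound `S` left
open, so that it serves polynomial and fixed-parameter bounds alike. -/
theorem runs_while {step : α → α} {test : α → Bool} (hs : PolyTime step) (ht : PolyTime test) :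
    ∃ (p : Prog) (c : ℕ), ∀ (a : α) (n S : ℕ), (∀ i < n, test (step^[i] a) = true) →
      test (step^[n] a) = false → (∀ i ≤ n, esize (step^[i] a) ≤ S) →
      p.Runs (Enc.enc a) (Enc.enc (step^[n] a)) ((n + 1) * (2 * (S + 1) ^ c + 6)) := by
  obtain ⟨⟨p, T, ⟨c, hc⟩, hp⟩, -⟩ := hs
  obtain ⟨⟨r, R, ⟨d, hd⟩, hr⟩, -⟩ := ht
  refine ⟨Prog.while_ r p, c + d, fun a n S h1 h2 h3 => ?_⟩
  have hS : ∀ {i e}, i ≤ n → e ≤ c + d → (esize (step^[i] a) + 1) ^ e ≤ (S + 1) ^ (c + d) :=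
    fun hi he => (Nat.pow_le_pow_left (Nat.succ_le_succ (h3 _ hi)) _).trans
      (Nat.pow_le_pow_right (by omega) he)
  refine (Prog.Runs.while (fun i => Enc.enc (step^[i] a)) (fun i => Enc.enc (test (step^[i] a))) n
    ((S + 1) ^ (c + d)) ((S + 1) ^ (c + d))
    (fun i hi => (hr _).mono ((hd _).trans (hS hi (by omega))))
    (fun i hi => ?_) (fun i hi => ?_) ?_).mono (by rw [two_mul])
  · rw [Function.iterate_succ_apply']
    exact (hp _).mono ((hc _).trans (hS hi.le (by omega)))
  · rw [h1 i hi]; nofun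
  · rw [h2]; rfl

/-- The number of rounds need not be computed: the test tells the program when to stop. -/
theorem iterate {step : α → α} {test : α → Bool} (hs : PolyTime step) (ht : PolyTime test)
    {n g : α → ℕ} (hn : PolyBdd n) (hg : PolyBdd g)
    (h1 : ∀ a, ∀ i < n a, test (step^[i] a) = true) (h2 : ∀ a, test (step^[n a] a) = false)
    (h3 : ∀ a, ∀ i ≤ n a, esize (step^[i] a) ≤ g a) : PolyTime (fun a => step^[n a] a) := by
  obtain ⟨p, c, h⟩ := runs_while hs ht
  exact ⟨⟨p, _, (hn.add (PolyBdd.const 1)).mul (((PolyBdd.const 2).mul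
    ((hg.add (PolyBdd.const 1)).pow c)).add (PolyBdd.const 6)),
    fun a => h a (n a) (g a) (h1 a) (h2 a) (h3 a)⟩, hg.mono fun a => h3 a _ le_rfl⟩

end PolyTime

/-! ### Equality of encoded objects -/

/-- A tree, viewed as a list of trees. -/
def Data.toList : Data → List Data
  | nil => []
  | cons a b => a :: b.toList

theorem Data.enc_toList (d : Data) : enc d.toList = d := by
  induction d with
  | nil => rfl
  | cons a b _ hb => simp only [toList, enc_cons, hb]; rfl

/-- The tree is not a leaf. -/
def Data.isCons (d : Data) : Bool := !d.toList.isEmpty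

theorem PolyTime.isCons {f : α → Data} (hf : PolyTime f) : PolyTime (fun x => (f x).isCons) :=
  (PolyTime.isEmpty ((PolyTime.of_enc_eq Data.enc_toList).comp hf)).not

namespace Data

/-- One step of the comparison of a list of pairs of trees. -/
def eqStep (p : Bool × List (Data × Data)) : Bool × List (Data × Data) :=
  match p.2 with
  | [] => p
  | q :: l =>
    bif q.1.isCons then
      bif q.2.isCons then (p.1, (q.1.hd, q.2.hd) :: (q.1.tl, q.2.tl) :: l) else (false, [])
    else bif q.2.isCons then (false, []) else (p.1, l)

theorem polyTime_eqStep : PolyTime eqStep := by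
  have h1 : PolyTime fun x : (Bool × List (Data × Data)) × ((Data × Data) × List (Data × Data)) =>
    x.2.1.1 := PolyTime.fst.comp (PolyTime.fst.comp PolyTime.snd)
  have h2 : PolyTime fun x : (Bool × List (Data × Data)) × ((Data × Data) × List (Data × Data)) =>
    x.2.1.2 := PolyTime.snd.comp (PolyTime.fst.comp PolyTime.snd)
  have h3 : PolyTime fun x : (Bool × List (Data × Data)) × ((Data × Data) × List (Data × Data)) =>
    x.1.1 := PolyTime.fst.comp PolyTime.fst
  have h4 : PolyTime fun x : (Bool × List (Data × Data)) × ((Data × Data) × List (Data × Data)) =>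
    x.2.2 := PolyTime.snd.comp PolyTime.snd
  refine PolyTime.of_eq (PolyTime.listCases PolyTime.snd PolyTime.id (h1.isCons.cond (h2.isCons.cond
    (h3.pair (PolyTime.cons ((PolyTime.hd.comp h1).pair (PolyTime.hd.comp h2))
      (PolyTime.cons ((PolyTime.tl.comp h1).pair (PolyTime.tl.comp h2)) h4))) (PolyTime.const (false, [])))
      (h2.isCons.cond (PolyTime.const (false, [])) (h3.pair h4)))) fun p => ?_
  obtain ⟨b, _ | ⟨q, l⟩⟩ := p <;> rfl

/-- The invariant of the comparison. On a mismatch the flag is lowered and the list is emptied, and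
then both sides are false. -/
theorem eqStep_spec (p : Bool × List (Data × Data)) :
    ((eqStep p).1 = true ∧ ∀ q ∈ (eqStep p).2, q.1 = q.2) ↔ (p.1 = true ∧ ∀ q ∈ p.2, q.1 = q.2) := by
  obtain ⟨b, _ | ⟨⟨_ | ⟨a, c⟩, _ | ⟨a', c'⟩⟩, l⟩⟩ := p <;>
    simp [eqStep, isCons, toList, hd, tl]
  tauto

/-- Each step uses up at least one node of the left components, which bounds the number of steps. -/
theorem eqStep_sum (p : Bool × List (Data × Data)) (h : p.2 ≠ []) :
    ((eqStep p).2.map fun q => q.1.size).sum < (p.2.map fun q => q.1.size).sum := by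
  obtain ⟨b, _ | ⟨⟨_ | ⟨a, c⟩, _ | ⟨a', c'⟩⟩, l⟩⟩ := p <;>
    simp [eqStep, isCons, toList, hd, tl, size] at h ⊢
  omega

theorem eqStep_esize (p : Bool × List (Data × Data)) : esize (eqStep p) ≤ esize p := by
  have e : ∀ d : Data, esize d = d.size := fun _ => rfl
  obtain ⟨b, _ | ⟨⟨_ | ⟨a, c⟩, _ | ⟨a', c'⟩⟩, l⟩⟩ := p <;>
    simp [eqStep, isCons, toList, hd, tl, size, e] <;>
    have : esize false ≤ esize b := esize_pos b <;> omega

theorem exists_eqStep (m : ℕ) (p : Bool × List (Data × Data))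
    (hm : (p.2.map fun q => q.1.size).sum ≤ m) :
    ∃ n ≤ m, (∀ i < n, (!(eqStep^[i] p).2.isEmpty) = true) ∧
      (!(eqStep^[n] p).2.isEmpty) = false := by
  induction m generalizing p with
  | zero =>
    by_cases h : p.2 = []
    · exact ⟨0, le_rfl, by simp, by simp [h]⟩
    · have := eqStep_sum p h
      omega
  | succ m ih =>
    by_cases h : p.2 = []
    · exact ⟨0, by omega, by simp, by simp [h]⟩
    · have := eqStep_sum p h
      obtain ⟨n, hn, h1, h2⟩ := ih (eqStep p) (by omega)
      refine ⟨n + 1, by omega, fun i hi => ?_, h2⟩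
      cases i with
      | zero => simpa using h
      | succ i => exact h1 i (by omega)

theorem exists_polyTime_eq : ∃ f : Data × Data → Bool, PolyTime f ∧ ∀ a b, f (a, b) = true ↔ a = b := by
  choose n hn h1 h2 using fun p => exists_eqStep _ p le_rfl
  have hs : ∀ i p, esize (eqStep^[i] p) ≤ esize p := by
    intro i p
    induction i with
    | zero => rfl
    | succ i ih =>
      rw [Function.iterate_succ_apply']
      exact (eqStep_esize _).trans ih
  have hinv : ∀ i p, ((eqStep^[i] p).1 = true ∧ ∀ q ∈ (eqStep^[i] p).2, q.1 = q.2) ↔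
      (p.1 = true ∧ ∀ q ∈ p.2, q.1 = q.2) := by
    intro i p
    induction i with
    | zero => rfl
    | succ i ih =>
      rw [Function.iterate_succ_apply', eqStep_spec, ih]
  have key : PolyTime fun p => eqStep^[n p] p := by
    refine PolyTime.iterate polyTime_eqStep (PolyTime.isEmpty PolyTime.snd).not
      (PolyBdd.size.mono fun p => ?_) PolyBdd.size h1 h2 fun a i _ => hs i a
    refine (hn p).trans ?_
    obtain ⟨b, l⟩ := p
    have : (l.map fun q => q.1.size).sum ≤ esize l := by
      induction l with
      | nil => simp
      | cons q l ih =>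
        have : esize q = q.1.size + q.2.size + 1 := rfl
        simp only [List.map_cons, List.sum_cons, esize_cons]
        omega
    simp only [esize_pair]
    omega
  -- Once no pairs are pending, the invariant says that the flag is the answer.
  refine ⟨fun p => (eqStep^[n (true, [p])] (true, [p])).1,
    PolyTime.fst.comp (key.comp ((PolyTime.const true).pair
      (PolyTime.cons PolyTime.id (PolyTime.const [])))), fun a b => ?_⟩
  have h := hinv (n (true, [(a, b)])) (true, [(a, b)])
  have h' := h2 (true, [(a, b)])
  simp only [Bool.not_eq_eq_eq_not, Bool.not_false, List.isEmpty_iff] at h'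
  simpa [h'] using h

end Data

/-- Types with an injective encoding. -/
class EncInj (α : Type) [Enc α] : Prop where
  inj : Function.Injective (enc : α → Data)

instance : EncInj Bool := ⟨fun a b h => by cases a <;> cases b <;> first | rfl | exact absurd h nofun⟩

instance [EncInj α] : EncInj (List α) := ⟨fun l l' h => by
  revert l'
  induction l with
  | nil =>
    intro l' h
    cases l' with
    | nil => rfl
    | cons a l' => simp at h
  | cons a l ih =>
    intro l' h
    cases l' with
    | nil => simp at h
    | cons b l' =>
      simp only [enc_cons, Data.cons.injEq] at h
      rw [EncInj.inj h.1, ih l' h.2]⟩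

instance [EncInj α] [EncInj β] : EncInj (α × β) := ⟨fun p q h => by
  obtain ⟨a, b⟩ := p
  obtain ⟨c, d⟩ := q
  simp only [enc_pair, Data.cons.injEq] at h
  rw [EncInj.inj h.1, EncInj.inj h.2]⟩

instance : EncInj ℕ := ⟨fun m n h => by
  have h1 : m.bits = n.bits := EncInj.inj (α := List Bool) h
  refine Nat.eq_of_testBit_eq fun i => ?_
  rw [Nat.testBit_eq_inth, Nat.testBit_eq_inth, h1]⟩

/-! ### Operations on lists that need equality tests -/

namespace PolyTime

theorem eq [DecidableEq α] [EncInj α] {f g : δ → α} (hf : PolyTime f) (hg : PolyTime g) :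
    PolyTime (fun x => decide (f x = g x)) := by
  obtain ⟨e, he, h⟩ := Data.exists_polyTime_eq
  have := he.comp ((PolyTime.enc.comp hf).pair (PolyTime.enc.comp hg))
  convert this using 2 with x
  rw [Bool.eq_iff_iff, h, decide_eq_true_iff]
  exact EncInj.inj.eq_iff.symm

theorem mem [DecidableEq α] [EncInj α] {f : δ → α} {l : δ → List α} (hf : PolyTime f)
    (hl : PolyTime l) : PolyTime (fun x => decide (f x ∈ l x)) := by
  have := any (p := fun y : δ × α => decide (f y.1 = y.2)) (eq (hf.comp fst) snd) hl
  convert this using 2 with x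
  rw [Bool.eq_iff_iff]
  simp

theorem dedup [DecidableEq α] [EncInj α] {l : δ → List α} (hl : PolyTime l) :
    PolyTime (fun x => (l x).dedup) := by
  have e : ∀ l : List α, l.foldr (fun a b => bif decide (a ∈ b) then b else a :: b) [] = l.dedup := by
    intro l
    induction l with
    | nil => rfl
    | cons a l ih =>
      rw [List.foldr_cons, ih]
      by_cases h : a ∈ l
      · simp [h]
      · simp [h]
  have h := foldr (f := fun y : δ × (List α × α) =>
      bif decide (y.2.2 ∈ y.2.1) then y.2.1 else y.2.2 :: y.2.1)
    (cond (mem (snd.comp snd) (fst.comp snd)) (fst.comp snd) (cons (snd.comp snd) (fst.comp snd)))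
    hl (const []) hl.2 fun x l₁ h1 => by
      rw [e]
      exact ((List.dedup_sublist l₁).trans h1.sublist).esize_le
  simpa only [e] using h

theorem zip {l : δ → List α} {l' : δ → List β} (hl : PolyTime l) (hl' : PolyTime l') :
    PolyTime (fun x => (l x).zip (l' x)) := by
  -- The accumulator holds the pairs formed so far, in reverse order, and the unused rest of the
  -- second list.
  let f : δ × ((List (α × β) × List β) × α) → List (α × β) × List β := fun y =>
    match y.2.1.2 with
    | [] => y.2.1
    | b :: bs => ((y.2.2, b) :: y.2.1.1, bs)
  have hf : PolyTime f := listCases (snd.comp (fst.comp snd)) (fst.comp snd)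
    ((cons (((snd.comp snd).comp fst).pair (fst.comp snd)) ((fst.comp (fst.comp snd)).comp fst)).pair
      (snd.comp snd))
  have e : ∀ x (l : List α) (l' : List β) acc, l.foldl (fun b a => f (x, (b, a))) (acc, l') =
      ((l.zip l').reverse ++ acc, l'.drop l.length) := by
    intro x l
    induction l with
    | nil => simp
    | cons a l ih =>
      intro l' acc
      cases l' with
      | nil =>
        have := ih [] acc
        simp only [List.foldl_cons]
        change l.foldl _ (acc, []) = _
        rw [this]
        simp
      | cons b bs =>
        have := ih bs ((a, b) :: acc)
        simp only [List.foldl_cons]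
        change l.foldl _ ((a, b) :: acc, bs) = _
        rw [this]
        simp
  have hz : ∀ (l : List α) (l' : List β), esize (l.zip l') ≤ esize l + esize l' := by
    intro l
    induction l with
    | nil => simp
    | cons a l ih =>
      intro l'
      cases l' with
      | nil => simp
      | cons b bs =>
        have := ih bs
        simp only [List.zip_cons_cons, esize_cons, esize_pair]
        omega
  have h := foldl hf hl ((const []).pair hl') ((hl.2.add hl'.2).add (hl'.2.add (PolyBdd.const 1)))
    fun x l₁ h1 => by
      rw [e, esize_pair, List.append_nil, esize_reverse]
      have := hz l₁ (l' x)
      have := h1.sublist.esize_le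
      have := (List.drop_sublist l₁.length (l' x)).esize_le
      omega
  have h' := reverse (fst.comp h)
  simpa only [e, List.append_nil, List.reverse_reverse] using h'

theorem xorList {l : δ → List Bool} (hl : PolyTime l) :
    PolyTime (fun x => (l x).foldr Bool.xor false) :=
  foldr (f := fun y : δ × (Bool × Bool) => Bool.xor y.2.2 y.2.1)
    (xor (snd.comp snd) (fst.comp snd)) hl (const false) (PolyBdd.const 3) fun _ _ _ => esize_bool _

theorem litVar : PolyTime Lit.var := of_data hd fun _ => rfl

theorem litSign : PolyTime Lit.sign := of_data tl fun _ => rfl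

end PolyTime

/-! ### Case distinction on constraints -/

namespace Constraint

/-- The literals of a clause. -/
def clauseData : Constraint → List Lit
  | clause ls => ls
  | _ => []

/-- The data of an affine equation. -/
def affineData : Constraint → List ℕ × Bool
  | affine A b => (A, b)
  | _ => ([], false)

/-- The data of a relational atom. -/
def relData : Constraint → List ℕ × List (List Bool)
  | rel xs R => (xs, R)
  | _ => ([], [])

theorem enc_clause (ls : List Lit) : enc (clause ls) = Data.cons Data.nil (enc ls) := by
  change Data.ofConstraint _ = _
  simp only [Data.ofConstraint, Data.ofNat, Nat.zero_bits]
  rfl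

theorem enc_affine (A : List ℕ) (b : Bool) : enc (affine A b) =
    Data.cons (Data.cons (Data.cons Data.nil Data.nil) Data.nil) (enc (A, b)) := by
  change Data.ofConstraint _ = _
  simp only [Data.ofConstraint, Data.ofNat, Nat.one_bits]
  rfl

theorem enc_rel (xs : List ℕ) (R : List (List Bool)) : enc (rel xs R) =
    Data.cons (Data.cons Data.nil (Data.cons (Data.cons Data.nil Data.nil) Data.nil))
      (enc (xs, R)) := by
  change Data.ofConstraint _ = _
  have : Nat.bits 2 = [false, true] := by
    have := Nat.bit0_bits 1 one_ne_zero
    simpa using this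
  simp only [Data.ofConstraint, Data.ofNat, this]
  rfl

/-- The tags `0`, `1`, `2` are the bit lists `[]`, `[true]`, `[false, true]`; whether the tag and
its head are leaves separates the three kinds. -/
theorem polyTime_cases {c : δ → Constraint} {f : δ × List Lit → β} {g : δ × (List ℕ × Bool) → β}
    {h : δ × (List ℕ × List (List Bool)) → β} (hc : PolyTime c) (hf : PolyTime f)
    (hg : PolyTime g) (hh : PolyTime h) :
    PolyTime (fun x => match c x with
      | clause ls => f (x, ls)
      | affine A b => g (x, (A, b))
      | rel xs R => h (x, (xs, R))) := by
  have h1 : PolyTime fun c : Constraint => (enc c).hd.isCons :=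
    (PolyTime.hd.comp PolyTime.enc).isCons
  have h2 : PolyTime fun c : Constraint => (enc c).hd.hd.isCons :=
    (PolyTime.hd.comp (PolyTime.hd.comp PolyTime.enc)).isCons
  have ht : PolyTime fun c : Constraint => (enc c).tl := PolyTime.tl.comp PolyTime.enc
  have k1 : PolyTime clauseData := by
    refine PolyTime.of_enc_comp (h1.cond (PolyTime.const Data.nil) ht) fun c => ?_
    cases c <;> simp only [enc_clause, enc_affine, enc_rel] <;> rfl
  have k2 : PolyTime affineData := by
    refine PolyTime.of_enc_comp (h2.cond ht (PolyTime.const (enc (([], false) : List ℕ × Bool))))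
      fun c => ?_
    cases c <;> simp only [enc_clause, enc_affine, enc_rel] <;> rfl
  have k3 : PolyTime relData := by
    refine PolyTime.of_enc_comp ((h1.and h2.not).cond ht
      (PolyTime.const (enc (([], []) : List ℕ × List (List Bool))))) fun c => ?_
    cases c <;> simp only [enc_clause, enc_affine, enc_rel] <;> rfl
  have := ((h1.comp hc).cond ((h2.comp hc).cond (hg.comp (PolyTime.id.pair (k2.comp hc)))
    (hh.comp (PolyTime.id.pair (k3.comp hc)))) (hf.comp (PolyTime.id.pair (k1.comp hc))))
  convert this using 2 with x
  cases c x <;> simp only [enc_clause, enc_affine, enc_rel] <;> rfl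

theorem polyTime_clause {f : δ → List Lit} (hf : PolyTime f) : PolyTime (fun x => clause (f x)) :=
  PolyTime.of_enc_comp (PolyTime.enc.comp ((PolyTime.const Data.nil).pair hf)) fun _ =>
    enc_clause _

theorem polyTime_affine {f : δ → List ℕ} {g : δ → Bool} (hf : PolyTime f) (hg : PolyTime g) :
    PolyTime (fun x => affine (f x) (g x)) :=
  PolyTime.of_enc_comp (PolyTime.enc.comp ((PolyTime.const
    (Data.cons (Data.cons Data.nil Data.nil) Data.nil)).pair (hf.pair hg))) fun _ => enc_affine _ _

theorem polyTime_rel {f : δ → List ℕ} {g : δ → List (List Bool)} (hf : PolyTime f)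
    (hg : PolyTime g) : PolyTime (fun x => rel (f x) (g x)) :=
  PolyTime.of_enc_comp (PolyTime.enc.comp ((PolyTime.const
    (Data.cons Data.nil (Data.cons (Data.cons Data.nil Data.nil) Data.nil))).pair (hf.pair hg)))
    fun _ => enc_rel _ _

end Constraint

end

/-! ### The operations of the reduction and their running times -/

/-- A term: a conjunction of literals, given as variables with values. -/
abbrev Term := List (ℕ × Bool)

/-- The assignment given by a term; variables that do not occur are false. -/
def valOf (A : Term) (v : ℕ) : Bool := decide ((v, true) ∈ A)

namespace Constraint

/-- The list of variables of a constraint. -/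
def varList : Constraint → List ℕ
  | clause ls => ls.map Lit.var
  | affine A _ => A
  | rel xs _ => xs

/-- The constraint under the assignment `A` of the variables in `Y`; the empty list stands for a
satisfied clause. -/
def assignList (Y : List ℕ) (A : Term) : Constraint → List Constraint
  | clause ls =>
    bif ls.any (fun l => decide (l.var ∈ Y) && decide (valOf A l.var = l.sign)) then []
    else [clause (ls.filter fun l => !decide (l.var ∈ Y))]
  | affine B b =>
    [affine (B.filter fun v => !decide (v ∈ Y))
      (Bool.xor b (((B.filter fun v => decide (v ∈ Y)).map (valOf A)).foldr Bool.xor false))]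
  | rel xs R =>
    [rel (xs.filter fun v => !decide (v ∈ Y))
      ((R.filter fun t => (xs.zip t).all fun p =>
        !decide (p.1 ∈ Y) || decide (valOf A p.1 = p.2)).map fun t =>
          ((xs.zip t).filter fun p => !decide (p.1 ∈ Y)).map Prod.snd)]

/-- A constraint without variables is violated. -/
def violated : Constraint → Bool
  | clause _ => true
  -- The empty sum is `0`, so the equation fails exactly for right-hand side `1`.
  | affine _ b => b
  -- In a well-formed atom without variables the only possible tuple is the empty one.
  | rel _ R => R.isEmpty

/-- The constraint is violated by an assignment of all its variables. -/
def falsifiedBy (c : Constraint) (t : Term) : Bool :=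
  (c.assignList (t.map Prod.fst) t).any violated

end Constraint

/-- All assignments of a list of variables. -/
def allTerms (l : List ℕ) : List Term :=
  l.foldl (fun acc v => acc.map (fun t => (v, false) :: t) ++ acc.map (fun t => (v, true) :: t)) [[]]

/-- The terms over the variables of a constraint that falsify it. -/
def Constraint.falsifyingTerms (c : Constraint) : List Term :=
  (allTerms c.varList.dedup).filter c.falsifiedBy

/-- One round of the computation of the variables outside of `B` that are reachable from `E₀`. -/
def reachStep (E₀ B : List ℕ) (M : List Constraint) (E : List ℕ) : List ℕ :=
  -- Each round starts from `E₀` again instead of enlarging `E`; this bounds the size of the result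
  -- independently of the number of rounds.
  E₀ ++ M.flatMap fun c =>
    bif c.varList.any (fun v => !decide (v ∈ B) && decide (v ∈ E)) then
      c.varList.filter fun v => !decide (v ∈ B) else []

/-- The existential variables outside of `B`. -/
def exVars (Q : List (Quant × ℕ)) (B : List ℕ) : List ℕ :=
  (Q.filter fun p => (match p.1 with | Quant.ex => true | Quant.all => false) &&
    !decide (p.2 ∈ B)).map Prod.snd

/-- The variables outside of `B` that are connected to an existential variable. -/
def reached (Q : List (Quant × ℕ)) (M : List Constraint) (B : List ℕ) : List ℕ :=
  -- The prefix only serves as a counter: a path visits each variable at most once, so that many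
  -- rounds suffice.
  Q.foldl (fun E _ => reachStep (exVars Q B) B M E) (exVars Q B)

/-- The list of variables in the universal part. -/
def universalList (Q : List (Quant × ℕ)) (M : List Constraint) (B : List ℕ) : List ℕ :=
  (Q.map Prod.snd).filter fun v => !decide (v ∈ B) && !decide (v ∈ reached Q M B)

/-- The constraints that contain a variable of `U`. -/
def touching (U : List ℕ) (M : List Constraint) : List Constraint :=
  M.filter fun c => c.varList.any fun v => decide (v ∈ U)

namespace Term

/-- The part of the term on the variables in `Z`. -/
def restrict (Z : List ℕ) (t : Term) : Term := t.filter fun p => decide (p.1 ∈ Z)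

/-- The part of the term on the variables outside of `Z`. -/
def remove (Z : List ℕ) (t : Term) : Term := t.filter fun p => !decide (p.1 ∈ Z)

/-- The term has no variable in `Z`. -/
def avoids (Z : List ℕ) (t : Term) : Bool := t.all fun p => !decide (p.1 ∈ Z)

end Term

/-- Split a family of terms according to their parts on `Z`, which are removed. -/
def splitFamily (Z : List ℕ) (F : List Term) : List (List Term) :=
  (F.map (Term.restrict Z)).dedup.map fun κ =>
    (F.filter fun t => decide (t.restrict Z = κ)).map (Term.remove Z)

/-- The state of the work loop: the variables to be kept, the assignment built so far, the families
to be treated, and those for which the assignment contains a term. -/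
abbrev WorkState := List ℕ × Term × List (List Term) × List (List Term)

/-- One step of the work loop. -/
def workStep (σ : WorkState) : WorkState :=
  match σ.2.2.1 with
  | [] => σ
  | F :: rest =>
    match F.filter (Term.avoids (σ.1 ++ σ.2.1.map Prod.fst)) with
    -- A term over fresh variables exists: fix its values, and the family is done.
    | t :: _ => (σ.1, t ++ σ.2.1, rest, F :: σ.2.2.2)
    -- Every term of `F` meets the kept or fixed variables. All of these are kept from now on, `F`
    -- is split along them, and the assignment starts afresh, so the finished families return to the
    -- queue.
    | [] => (σ.1 ++ σ.2.1.map Prod.fst, [],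
        splitFamily (σ.1 ++ σ.2.1.map Prod.fst) F ++ (σ.2.2.2 ++ rest), [])

/-- There is work to do. -/
def workTest (σ : WorkState) : Bool := !σ.2.2.1.isEmpty

/-! ### Polynomial time bounds for the operations -/

section

variable {δ : Type} [Enc δ]

open PolyTime

theorem polyTime_valOf {A : δ → Term} {v : δ → ℕ} (hA : PolyTime A) (hv : PolyTime v) :
    PolyTime (fun x => valOf (A x) (v x)) :=
  of_eq (mem (hv.pair (const true)) hA) fun x => by rw [valOf, decide_eq_decide]

theorem Constraint.polyTime_varList : PolyTime varList := by
  refine of_eq (polyTime_cases id (f := fun y => y.2.map Lit.var) (g := fun y => y.2.1)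
    (h := fun y => y.2.1) (map (litVar.comp snd) snd) (fst.comp snd) (fst.comp snd)) fun c => ?_
  cases c <;> rfl

theorem polyTime_notMem {α : Type} [Enc α] [DecidableEq α] [EncInj α] {f : δ → α} {l : δ → List α}
    (hf : PolyTime f) (hl : PolyTime l) : PolyTime (fun x => !decide (f x ∈ l x)) :=
  (mem hf hl).not

theorem Constraint.polyTime_assignList {Y : δ → List ℕ} {A : δ → Term} {c : δ → Constraint}
    (hY : PolyTime Y) (hA : PolyTime A) (hc : PolyTime c) :
    PolyTime (fun x => (c x).assignList (Y x) (A x)) := by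
  have h1 : PolyTime fun y : δ × List Lit =>
      bif y.2.any (fun l => decide (l.var ∈ Y y.1) && decide (valOf (A y.1) l.var = l.sign)) then []
      else [clause (y.2.filter fun l => !decide (l.var ∈ Y y.1))] := by
    refine (any (p := fun z : (δ × List Lit) × Lit => decide (z.2.var ∈ Y z.1.1) &&
      decide (valOf (A z.1.1) z.2.var = z.2.sign)) ?_ snd).cond (const [])
        ((polyTime_clause (filter (p := fun z : (δ × List Lit) × Lit =>
          !decide (z.2.var ∈ Y z.1.1)) ?_ snd)).cons (const []))
    · exact (mem (litVar.comp snd) (hY.comp (fst.comp fst))).and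
        (eq (polyTime_valOf (hA.comp (fst.comp fst)) (litVar.comp snd)) (litSign.comp snd))
    · exact polyTime_notMem (litVar.comp snd) (hY.comp (fst.comp fst))
  have h2 : PolyTime fun y : δ × (List ℕ × Bool) =>
      [affine (y.2.1.filter fun v => !decide (v ∈ Y y.1))
        (Bool.xor y.2.2 (((y.2.1.filter fun v => decide (v ∈ Y y.1)).map
          (valOf (A y.1))).foldr Bool.xor false))] := by
    refine (polyTime_affine (filter (p := fun z : (δ × (List ℕ × Bool)) × ℕ =>
      !decide (z.2 ∈ Y z.1.1)) ?_ (fst.comp snd)) (xor (snd.comp snd) (xorList (map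
        (f := fun z : (δ × (List ℕ × Bool)) × ℕ => valOf (A z.1.1) z.2) ?_ (filter
        (p := fun z : (δ × (List ℕ × Bool)) × ℕ => decide (z.2 ∈ Y z.1.1)) ?_
          (fst.comp snd)))))).cons (const [])
    · exact polyTime_notMem snd (hY.comp (fst.comp fst))
    · exact polyTime_valOf (hA.comp (fst.comp fst)) snd
    · exact mem snd (hY.comp (fst.comp fst))
  have h3 : PolyTime fun y : δ × (List ℕ × List (List Bool)) =>
      [rel (y.2.1.filter fun v => !decide (v ∈ Y y.1))
        ((y.2.2.filter fun t => (y.2.1.zip t).all fun p =>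
          !decide (p.1 ∈ Y y.1) || decide (valOf (A y.1) p.1 = p.2)).map fun t =>
            ((y.2.1.zip t).filter fun p => !decide (p.1 ∈ Y y.1)).map Prod.snd)] := by
    have hz : PolyTime fun z : (δ × (List ℕ × List (List Bool))) × List Bool =>
      z.1.2.1.zip z.2 := zip (fst.comp (snd.comp fst)) snd
    refine (polyTime_rel (filter (p := fun z : (δ × (List ℕ × List (List Bool))) × ℕ =>
      !decide (z.2 ∈ Y z.1.1)) (polyTime_notMem snd (hY.comp (fst.comp fst))) (fst.comp snd))
      (map (f := fun z : (δ × (List ℕ × List (List Bool))) × List Bool =>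
        ((z.1.2.1.zip z.2).filter fun p => !decide (p.1 ∈ Y z.1.1)).map Prod.snd)
        (map (f := fun w => w.2.2) (snd.comp snd) (filter (p := fun w : ((δ × (List ℕ ×
          List (List Bool))) × List Bool) × (ℕ × Bool) => !decide (w.2.1 ∈ Y w.1.1.1))
          (polyTime_notMem (fst.comp snd) (hY.comp (fst.comp (fst.comp fst)))) hz))
        (filter (p := fun z : (δ × (List ℕ × List (List Bool))) × List Bool =>
          (z.1.2.1.zip z.2).all fun p =>
            !decide (p.1 ∈ Y z.1.1) || decide (valOf (A z.1.1) p.1 = p.2))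
          (all (p := fun w : ((δ × (List ℕ × List (List Bool))) × List Bool) × (ℕ × Bool) =>
            !decide (w.2.1 ∈ Y w.1.1.1) || decide (valOf (A w.1.1.1) w.2.1 = w.2.2)) ?_ hz)
          (snd.comp snd)))).cons (const [])
    exact (polyTime_notMem (fst.comp snd) (hY.comp (fst.comp (fst.comp fst)))).or
      (eq (polyTime_valOf (hA.comp (fst.comp (fst.comp fst))) (fst.comp snd)) (snd.comp snd))
  refine of_eq (polyTime_cases hc h1 h2 h3) fun x => ?_
  cases c x <;> rfl

theorem Constraint.polyTime_falsifiedBy {c : δ → Constraint} {t : δ → Term} (hc : PolyTime c)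
    (ht : PolyTime t) : PolyTime (fun x => (c x).falsifiedBy (t x)) := by
  have hv : PolyTime violated := by
    refine of_eq (polyTime_cases id (f := fun _ => true) (g := fun y => y.2.2)
      (h := fun y => y.2.2.isEmpty) (const true) (snd.comp snd) (isEmpty (snd.comp snd)))
        fun c => ?_
    cases c <;> rfl
  exact any (hv.comp snd) (polyTime_assignList (map (fst.comp snd) ht) ht hc)

theorem polyTime_reachStep {E₀ B E : δ → List ℕ} {M : δ → List Constraint} (hE₀ : PolyTime E₀)
    (hB : PolyTime B) (hM : PolyTime M) (hE : PolyTime E) :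
    PolyTime (fun x => reachStep (E₀ x) (B x) (M x) (E x)) := by
  have hv : PolyTime fun y : δ × Constraint => y.2.varList :=
    Constraint.polyTime_varList.comp snd
  refine hE₀.append (flatMap (f := fun y : δ × Constraint =>
    bif y.2.varList.any (fun v => !decide (v ∈ B y.1) && decide (v ∈ E y.1)) then
      y.2.varList.filter fun v => !decide (v ∈ B y.1) else []) (cond (any
        (p := fun z : (δ × Constraint) × ℕ => !decide (z.2 ∈ B z.1.1) && decide (z.2 ∈ E z.1.1))
        ?_ hv) (filter (p := fun z : (δ × Constraint) × ℕ => !decide (z.2 ∈ B z.1.1)) ?_ hv)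
          (const [])) hM)
  · exact (polyTime_notMem snd (hB.comp (fst.comp fst))).and (mem snd (hE.comp (fst.comp fst)))
  · exact polyTime_notMem snd (hB.comp (fst.comp fst))

/-- The bound does not mention `E`, so it survives iteration. -/
theorem esize_reachStep_le (E₀ B E : List ℕ) (M : List Constraint) :
    esize (reachStep E₀ B M E) ≤ esize E₀ + esize (M.map Constraint.varList) := by
  have h := esize_append E₀ (M.flatMap fun c =>
    bif c.varList.any (fun v => !decide (v ∈ B) && decide (v ∈ E)) then
      c.varList.filter fun v => !decide (v ∈ B) else [])
  have h2 : esize (M.flatMap fun c =>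
      bif c.varList.any (fun v => !decide (v ∈ B) && decide (v ∈ E)) then
      c.varList.filter fun v => !decide (v ∈ B) else []) ≤ esize (M.map Constraint.varList) := by
    clear h
    induction M with
    | nil => simp
    | cons c M ih =>
      rw [List.flatMap_cons, List.map_cons, esize_cons]
      have h3 := esize_append (bif c.varList.any (fun v => !decide (v ∈ B) && decide (v ∈ E)) then
        c.varList.filter fun v => !decide (v ∈ B) else []) (M.flatMap fun c =>
        bif c.varList.any (fun v => !decide (v ∈ B) && decide (v ∈ E)) then
        c.varList.filter fun v => !decide (v ∈ B) else [])
      have h4 : esize (bif c.varList.any (fun v => !decide (v ∈ B) && decide (v ∈ E)) then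
        c.varList.filter fun v => !decide (v ∈ B) else []) ≤ esize c.varList := by
        cases c.varList.any (fun v => !decide (v ∈ B) && decide (v ∈ E))
        · exact esize_pos _
        · exact List.filter_sublist.esize_le
      omega
  unfold reachStep
  omega

theorem polyTime_exVars {Q : δ → List (Quant × ℕ)} {B : δ → List ℕ} (hQ : PolyTime Q)
    (hB : PolyTime B) : PolyTime (fun x => exVars (Q x) (B x)) := by
  have hq : PolyTime fun q : Quant => match q with | Quant.ex => true | Quant.all => false :=
    of_enc_eq fun q => by cases q <;> rfl
  exact map (snd.comp snd) (filter (p := fun y : δ × (Quant × ℕ) =>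
    (match y.2.1 with | Quant.ex => true | Quant.all => false) && !decide (y.2.2 ∈ B y.1))
    ((hq.comp (fst.comp snd)).and (polyTime_notMem (snd.comp snd) (hB.comp fst))) hQ)

theorem polyTime_reached {Q : δ → List (Quant × ℕ)} {M : δ → List Constraint} {B : δ → List ℕ}
    (hQ : PolyTime Q) (hM : PolyTime M) (hB : PolyTime B) :
    PolyTime (fun x => reached (Q x) (M x) (B x)) := by
  have hE := polyTime_exVars hQ hB
  refine foldl (f := fun y : δ × (List ℕ × (Quant × ℕ)) =>
    reachStep (exVars (Q y.1) (B y.1)) (B y.1) (M y.1) y.2.1)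
    (polyTime_reachStep (hE.comp fst) (hB.comp fst) (hM.comp fst) (fst.comp snd)) hQ hE
    (hE.2.add (map (Constraint.polyTime_varList.comp snd) hM).2) fun x l₁ h1 => ?_
  clear h1
  induction l₁ using List.reverseRecOn with
  | nil => exact Nat.le_add_right _ _
  | append_singleton l a ih =>
    rw [List.foldl_append]
    exact esize_reachStep_le _ _ _ _

theorem polyTime_universalList {Q : δ → List (Quant × ℕ)} {M : δ → List Constraint}
    {B : δ → List ℕ} (hQ : PolyTime Q) (hM : PolyTime M) (hB : PolyTime B) :
    PolyTime (fun x => universalList (Q x) (M x) (B x)) :=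
  filter (p := fun y : δ × ℕ => !decide (y.2 ∈ B y.1) &&
    !decide (y.2 ∈ reached (Q y.1) (M y.1) (B y.1)))
    ((polyTime_notMem snd (hB.comp fst)).and
      (polyTime_notMem snd ((polyTime_reached hQ hM hB).comp fst))) (map (snd.comp snd) hQ)

theorem polyTime_touching {U : δ → List ℕ} {M : δ → List Constraint} (hU : PolyTime U)
    (hM : PolyTime M) : PolyTime (fun x => touching (U x) (M x)) :=
  filter (p := fun y : δ × Constraint => y.2.varList.any fun v => decide (v ∈ U y.1))
    (any (p := fun z : (δ × Constraint) × ℕ => decide (z.2 ∈ U z.1.1))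
      (mem snd (hU.comp (fst.comp fst))) (Constraint.polyTime_varList.comp snd)) hM

theorem polyTime_restrict {Z : δ → List ℕ} {t : δ → Term} (hZ : PolyTime Z) (ht : PolyTime t) :
    PolyTime (fun x => (t x).restrict (Z x)) :=
  filter (p := fun y : δ × (ℕ × Bool) => decide (y.2.1 ∈ Z y.1))
    (mem (fst.comp snd) (hZ.comp fst)) ht

theorem polyTime_remove {Z : δ → List ℕ} {t : δ → Term} (hZ : PolyTime Z) (ht : PolyTime t) :
    PolyTime (fun x => (t x).remove (Z x)) :=
  filter (p := fun y : δ × (ℕ × Bool) => !decide (y.2.1 ∈ Z y.1))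
    (polyTime_notMem (fst.comp snd) (hZ.comp fst)) ht

theorem polyTime_avoids {Z : δ → List ℕ} {t : δ → Term} (hZ : PolyTime Z) (ht : PolyTime t) :
    PolyTime (fun x => (t x).avoids (Z x)) :=
  all (p := fun y : δ × (ℕ × Bool) => !decide (y.2.1 ∈ Z y.1))
    (polyTime_notMem (fst.comp snd) (hZ.comp fst)) ht

theorem polyTime_splitFamily {Z : δ → List ℕ} {F : δ → List Term} (hZ : PolyTime Z)
    (hF : PolyTime F) : PolyTime (fun x => splitFamily (Z x) (F x)) := by
  have h : PolyTime fun z : (δ × Term) × Term => decide (z.2.restrict (Z z.1.1) = z.1.2) :=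
    of_eq (eq (polyTime_restrict (hZ.comp (fst.comp fst)) snd) (snd.comp fst)) fun x => by
      rw [decide_eq_decide]
  have h' : PolyTime fun x => ((F x).map (Term.restrict (Z x))).dedup :=
    of_eq (dedup (map (f := fun y : δ × Term => y.2.restrict (Z y.1))
      (polyTime_restrict (hZ.comp fst) snd) hF)) fun x => by congr!
  exact map (f := fun y : δ × Term =>
    ((F y.1).filter fun t => decide (t.restrict (Z y.1) = y.2)).map (Term.remove (Z y.1)))
    (map (f := fun z : (δ × Term) × Term => z.2.remove (Z z.1.1))
      (polyTime_remove (hZ.comp (fst.comp fst)) snd)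
      (filter (p := fun z : (δ × Term) × Term => decide (z.2.restrict (Z z.1.1) = z.1.2))
        h (hF.comp fst))) h'

theorem polyTime_workStep : PolyTime workStep := by
  have hz : PolyTime fun σ : WorkState => σ.1 ++ σ.2.1.map Prod.fst :=
    fst.append (map (fst.comp snd) (fst.comp snd))
  have hf : PolyTime fun y : WorkState × (List Term × List (List Term)) =>
      y.2.1.filter (Term.avoids (y.1.1 ++ y.1.2.1.map Prod.fst)) :=
    filter (p := fun z : (WorkState × (List Term × List (List Term))) × Term =>
      z.2.avoids (z.1.1.1 ++ z.1.1.2.1.map Prod.fst))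
      (polyTime_avoids (hz.comp (fst.comp fst)) snd) (fst.comp snd)
  have h1 : PolyTime fun y : (WorkState × (List Term × List (List Term))) × (Term × List Term) =>
      (y.1.1.1, y.2.1 ++ y.1.1.2.1, y.1.2.2, y.1.2.1 :: y.1.1.2.2.2) :=
    (fst.comp (fst.comp fst)).pair (((fst.comp snd).append (fst.comp (snd.comp (fst.comp fst)))).pair
      ((snd.comp (snd.comp fst)).pair ((fst.comp (snd.comp fst)).cons
        (snd.comp (snd.comp (snd.comp (fst.comp fst)))))))
  have h2 : PolyTime fun y : WorkState × (List Term × List (List Term)) =>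
      ((y.1.1 ++ y.1.2.1.map Prod.fst, [],
        splitFamily (y.1.1 ++ y.1.2.1.map Prod.fst) y.2.1 ++ (y.1.2.2.2 ++ y.2.2), []) :
          WorkState) :=
    (hz.comp fst).pair ((const []).pair (((polyTime_splitFamily (hz.comp fst)
      (fst.comp snd)).append ((snd.comp (snd.comp (snd.comp fst))).append (snd.comp snd))).pair
        (const [])))
  refine of_eq (listCases (fst.comp (snd.comp snd)) id (listCases hf h2 h1)) fun σ => ?_
  obtain ⟨X, A, _ | ⟨F, rest⟩, D⟩ := σ
  · rfl
  · simp only [workStep]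
    cases F.filter (Term.avoids (X ++ A.map Prod.fst)) <;> rfl

theorem polyTime_workTest : PolyTime workTest :=
  (isEmpty (fst.comp (snd.comp snd))).not

end

/-! ### Assignments and truth -/

/-- The assignment that follows `τ` on `S` and `σ` elsewhere. -/
def override (S : Finset ℕ) (τ σ : ℕ → Bool) (v : ℕ) : Bool := if v ∈ S then τ v else σ v

namespace Constraint

theorem mem_varList {c : Constraint} {v : ℕ} : v ∈ c.varList ↔ v ∈ c.vars := by
  cases c <;> simp [varList, vars]

theorem toFinset_varList (c : Constraint) : c.varList.toFinset = c.vars := by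
  ext v
  rw [List.mem_toFinset, mem_varList]

theorem sat_congr {c : Constraint} {σ τ : ℕ → Bool} (h : ∀ v ∈ c.vars, σ v = τ v) :
    c.Sat σ ↔ c.Sat τ := by
  cases c with
  | clause ls =>
    refine exists_congr fun l => and_congr_right fun hl => ?_
    rw [h l.var (by simpa [vars] using ⟨l, hl, rfl⟩)]
  | affine A b =>
    have : A.map σ = A.map τ := List.map_congr_left fun v hv => h v (by simpa [vars] using hv)
    simp only [Sat, this]
  | rel xs R =>
    have : xs.map σ = xs.map τ := List.map_congr_left fun v hv => h v (by simpa [vars] using hv)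
    simp only [Sat, this]

theorem foldr_xor_filter (A : List ℕ) (f : ℕ → Bool) (p : ℕ → Prop) [DecidablePred p] :
    (A.map f).foldr Bool.xor false = Bool.xor (((A.filter fun v => p v).map f).foldr Bool.xor false)
      (((A.filter fun v => ¬ p v).map f).foldr Bool.xor false) := by
  induction A with
  | nil => rfl
  | cons a A ih =>
    by_cases h : p a
    · simp only [List.map_cons, List.foldr_cons, List.filter_cons, h, ih]
      simp
    · simp only [List.map_cons, List.foldr_cons, List.filter_cons, h, ih]
      simp only [decide_false, Bool.false_eq_true, not_false_eq_true, decide_true, if_true, if_false,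
        List.map_cons, List.foldr_cons]
      generalize List.foldr _ _ _ = x
      generalize List.foldr _ _ _ = y
      cases f a <;> cases x <;> cases y <;> rfl

theorem projTuple_map (S : Finset ℕ) (σ : ℕ → Bool) (xs : List ℕ) :
    projTuple S xs (xs.map σ) = (xs.filter fun v => v ∉ S).map σ := by
  unfold projTuple
  induction xs with
  | nil => rfl
  | cons x xs ih =>
    rw [List.map_cons, List.zip_cons_cons, List.filter_cons, List.filter_cons]
    by_cases h : x ∈ S
    · simpa [h] using ih
    · simpa [h] using ih

theorem snd_eq_of_mem_zip_map {σ : ℕ → Bool} {xs : List ℕ} {p : ℕ × Bool}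
    (h : p ∈ xs.zip (xs.map σ)) : p.2 = σ p.1 := by
  induction xs with
  | nil => simp at h
  | cons x xs ih =>
    rw [List.map_cons, List.zip_cons_cons, List.mem_cons] at h
    rcases h with rfl | h
    · rfl
    · exact ih h

/-- The entries at positions in `S` are determined by `h1`, the others by the projection; equal
lengths prevent `zip` from truncating. -/
theorem eq_map_override {S : Finset ℕ} {τ σ : ℕ → Bool} {xs : List ℕ} {t : List Bool}
    (ht : t.length = xs.length) (h1 : ∀ p ∈ xs.zip t, p.1 ∈ S → τ p.1 = p.2)
    (h2 : projTuple S xs t = (xs.filter fun v => v ∉ S).map σ) : t = xs.map (override S τ σ) := by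
  unfold projTuple at h2
  induction xs generalizing t with
  | nil => simpa using ht
  | cons x xs ih =>
    cases t with
    | nil => simp at ht
    | cons b t =>
      simp only [List.zip_cons_cons, List.filter_cons] at h1 h2
      have h3 := ih (by simpa using ht) fun p hp => h1 p (List.mem_cons_of_mem _ hp)
      have h4 := h1 (x, b) List.mem_cons_self
      by_cases h : x ∈ S
      · simp only [h, not_true_eq_false, decide_false, Bool.false_eq_true, if_false] at h2
        rw [List.map_cons, ← h3 h2, override, if_pos h, h4 h]
      · simp only [h, not_false_eq_true, decide_true, if_true, List.map_cons, List.cons.injEq] at h2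
        rw [List.map_cons, ← h3 h2.2, override, if_neg h, h2.1]

theorem sat_override_of_assign_eq_none {c : Constraint} {S : Finset ℕ} {τ : ℕ → Bool}
    (h : c.assign S τ = none) (σ : ℕ → Bool) : c.Sat (override S τ σ) := by
  cases c with
  | clause ls =>
    simp only [assign] at h
    split at h
    · next h1 =>
      obtain ⟨l, hl, hS, hτ⟩ := h1
      exact ⟨l, hl, by rw [override, if_pos hS, hτ]⟩
    · simp at h
  | affine A b => simp [assign] at h
  | rel xs R => simp [assign] at h

/-- In a surviving clause no literal over `S` is true; in an affine equation the part of the sum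
over `S` moves to the right-hand side; for a relation, a tuple is recovered from its projection by
`eq_map_override`, which is where well-formedness enters. -/
theorem sat_of_assign_eq_some {c d : Constraint} {S : Finset ℕ} {τ : ℕ → Bool}
    (hc : c.WellFormed) (h : c.assign S τ = some d) (σ : ℕ → Bool) :
    d.Sat σ ↔ c.Sat (override S τ σ) := by
  cases c with
  | clause ls =>
    simp only [assign] at h
    split at h
    · simp at h
    · next h1 =>
      obtain rfl := Option.some.inj h
      push Not at h1
      simp only [Sat, List.mem_filter, decide_eq_true_eq]
      constructor
      · rintro ⟨l, ⟨hl, hS⟩, hσ⟩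
        exact ⟨l, hl, by rw [override, if_neg hS, hσ]⟩
      · rintro ⟨l, hl, hσ⟩
        by_cases hS : l.var ∈ S
        · rw [override, if_pos hS] at hσ
          exact absurd hσ (h1 l hl hS)
        · rw [override, if_neg hS] at hσ
          exact ⟨l, ⟨hl, hS⟩, hσ⟩
  | affine A b =>
    obtain rfl := Option.some.inj h
    simp only [Sat]
    rw [foldr_xor_filter A (override S τ σ) (· ∈ S)]
    have e1 : (A.filter fun v => v ∈ S).map (override S τ σ) = (A.filter fun v => v ∈ S).map τ :=
      List.map_congr_left fun v hv => by
        rw [override, if_pos (by simpa using (List.mem_filter.1 hv).2)]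
    have e2 : (A.filter fun v => ¬ v ∈ S).map (override S τ σ) =
        (A.filter fun v => v ∉ S).map σ :=
      List.map_congr_left fun v hv => by
        rw [override, if_neg (by simpa using (List.mem_filter.1 hv).2)]
    rw [e1, e2]
    generalize List.foldr _ _ _ = x
    generalize List.foldr _ _ _ = y
    cases x <;> cases y <;> cases b <;> simp
  | rel xs R =>
    obtain rfl := Option.some.inj h
    simp only [Sat, List.mem_map, List.mem_filter, decide_eq_true_eq]
    constructor
    · rintro ⟨t, ⟨ht, h1⟩, h2⟩
      rwa [← eq_map_override (hc t ht) h1 h2]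
    · intro h1
      refine ⟨_, ⟨h1, ?_⟩, ?_⟩
      · intro p hp hS
        rw [snd_eq_of_mem_zip_map hp, override, if_pos hS]
      · rw [projTuple_map]
        exact List.map_congr_left fun v hv => by
          rw [override, if_neg (by simpa using (List.mem_filter.1 hv).2)]

/-- Connects the version that programs compute with the one in the definition of `Φ[τ]`. -/
theorem assignList_eq (Y : List ℕ) (A : Term) (c : Constraint) :
    c.assignList Y A = (c.assign Y.toFinset (valOf A)).toList := by
  cases c with
  | clause ls =>
    simp only [assignList, assign, List.mem_toFinset]
    split
    · next h =>
      have : (ls.any fun l => decide (l.var ∈ Y) && decide (valOf A l.var = l.sign)) = true := by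
        simpa using h
      rw [this]
      rfl
    · next h =>
      have : (ls.any fun l => decide (l.var ∈ Y) && decide (valOf A l.var = l.sign)) = false := by
        rw [← Bool.not_eq_true]
        simpa using h
      rw [this]
      simp
  | affine B b => simp [assignList, assign]
  | rel xs R =>
    simp only [assignList, assign, List.mem_toFinset, Option.toList_some, List.cons.injEq,
      rel.injEq, and_true]
    refine ⟨by simp, ?_⟩
    congr 1
    · ext t
      simp [projTuple]
    · refine List.filter_congr fun t _ => ?_
      rw [Bool.eq_iff_iff]
      simp only [List.all_eq_true, Bool.or_eq_true, Bool.not_eq_true', decide_eq_false_iff_not,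
        decide_eq_true_eq]
      exact forall_congr' fun p => forall_congr' fun _ => by tauto

end Constraint

/-- The term is satisfied by the assignment. -/
def Term.Holds (σ : ℕ → Bool) (t : Term) : Prop := ∀ p ∈ t, σ p.1 = p.2

namespace Term

/-- A term that holds somewhere contains no variable with both values, so the default value false of
`valOf` is correct for its negative entries. -/
theorem Holds.valOf_eq {σ : ℕ → Bool} {t : Term} (h : t.Holds σ) {v : ℕ}
    (hv : v ∈ t.map Prod.fst) : valOf t v = σ v := by
  obtain ⟨⟨w, b⟩, hp, rfl⟩ := List.mem_map.1 hv
  have h1 := h _ hp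
  cases b with
  | true => simpa [valOf, h1] using hp
  | false =>
    rw [h1, valOf, decide_eq_false_iff_not]
    intro h2
    exact absurd ((h _ h2).symm.trans h1) (by simp)

theorem Holds.override_eq {σ : ℕ → Bool} {t : Term} (h : t.Holds σ) :
    override (t.map Prod.fst).toFinset (valOf t) σ = σ := by
  funext v
  unfold override
  split
  · next hv => exact h.valOf_eq (List.mem_toFinset.1 hv)
  · rfl

theorem holds_valOf {t : Term} (h : (t.map Prod.fst).Nodup) : t.Holds (valOf t) := by
  rintro ⟨v, b⟩ hp
  cases b with
  | true => simpa [valOf] using hp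
  | false =>
    rw [valOf, decide_eq_false_iff_not]
    intro h2
    exact absurd (List.inj_on_of_nodup_map h hp h2 rfl) (by simp)

end Term

theorem mem_allTerms {l : List ℕ} {t : Term} : t ∈ allTerms l ↔ t.map Prod.fst = l.reverse := by
  have key : ∀ (l : List ℕ) (acc : List Term) (t : Term), t ∈ l.foldl (fun acc v =>
      acc.map (fun t => (v, false) :: t) ++ acc.map (fun t => (v, true) :: t)) acc ↔
      ∃ t₀ ∈ acc, ∃ u : Term, u.map Prod.fst = l.reverse ∧ t = u ++ t₀ := by
    intro l
    induction l with
    | nil => simp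
    | cons v l ih =>
      intro acc t
      rw [List.foldl_cons, ih]
      constructor
      · rintro ⟨t₀, h0, u, hu, rfl⟩
        rw [List.mem_append, List.mem_map, List.mem_map] at h0
        rcases h0 with ⟨t₁, h1, rfl⟩ | ⟨t₁, h1, rfl⟩
        · exact ⟨t₁, h1, u ++ [(v, false)], by simp [hu], by simp⟩
        · exact ⟨t₁, h1, u ++ [(v, true)], by simp [hu], by simp⟩
      · rintro ⟨t₀, h0, u, hu, rfl⟩
        rw [List.reverse_cons] at hu
        obtain ⟨u₁, u₂, rfl, h1, h2⟩ := List.map_eq_append_iff.1 hu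
        obtain ⟨⟨w, b⟩, rfl, h3⟩ := List.map_eq_singleton_iff.1 h2
        obtain rfl : w = v := h3
        refine ⟨(w, b) :: t₀, ?_, u₁, h1, by simp⟩
        cases b <;> simp [h0]
  simp [allTerms, key]

theorem length_allTerms (l : List ℕ) : (allTerms l).length = 2 ^ l.length := by
  have key : ∀ (l : List ℕ) (acc : List Term), (l.foldl (fun acc v =>
      acc.map (fun t => (v, false) :: t) ++ acc.map (fun t => (v, true) :: t)) acc).length =
      2 ^ l.length * acc.length := by
    intro l
    induction l with
    | nil => simp
    | cons v l ih =>
      intro acc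
      rw [List.foldl_cons, ih]
      simp [pow_succ]
      ring
  simp [allTerms, key]

/-! ### Falsifying terms of a constraint -/

namespace Constraint

theorem violated_iff {d : Constraint} (hd : d.WellFormed) (h : d.vars = ∅) (σ : ℕ → Bool) :
    d.violated = true ↔ ¬ d.Sat σ := by
  cases d with
  | clause ls =>
    obtain rfl : ls = [] := by simpa [vars] using h
    simp [violated, Sat]
  | affine A b =>
    obtain rfl : A = [] := by simpa [vars] using h
    cases b <;> simp [violated, Sat]
  | rel xs R =>
    obtain rfl : xs = [] := by simpa [vars] using h
    cases R with
    | nil => simp [violated, Sat]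
    | cons t R =>
      have : t = [] := by simpa using hd t List.mem_cons_self
      simp [violated, Sat, this]

/-- Assigning all variables leaves either nothing (a satisfied clause) or a constraint without
variables, whose truth value `violated` reads off. -/
theorem falsifiedBy_iff {c : Constraint} (hc : c.WellFormed) {t : Term} {σ : ℕ → Bool}
    (ht : t.Holds σ) (h : c.vars ⊆ (t.map Prod.fst).toFinset) :
    c.falsifiedBy t = true ↔ ¬ c.Sat σ := by
  rw [falsifiedBy, assignList_eq]
  cases h1 : c.assign (t.map Prod.fst).toFinset (valOf t) with
  | none =>
    have := sat_override_of_assign_eq_none h1 σ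
    rw [ht.override_eq] at this
    simp [this]
  | some d =>
    have h2 := sat_of_assign_eq_some hc h1 σ
    rw [ht.override_eq] at h2
    have h3 := vars_assign _ _ _ _ h1
    rw [Finset.sdiff_eq_empty_iff_subset.2 h] at h3
    simpa [← h2] using violated_iff (wellFormed_assign _ _ _ _ hc h1) h3 σ

theorem toFinset_dedup_varList (c : Constraint) : c.varList.dedup.toFinset = c.vars := by
  ext v
  rw [List.mem_toFinset, List.mem_dedup, mem_varList]

theorem keys_of_mem_falsifyingTerms {c : Constraint} {t : Term} (h : t ∈ c.falsifyingTerms) :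
    t.map Prod.fst = c.varList.dedup.reverse :=
  mem_allTerms.1 (List.mem_filter.1 h).1

theorem toFinset_keys_of_mem_falsifyingTerms {c : Constraint} {t : Term}
    (h : t ∈ c.falsifyingTerms) : (t.map Prod.fst).toFinset = c.vars := by
  rw [keys_of_mem_falsifyingTerms h, List.toFinset_reverse, toFinset_dedup_varList]

theorem length_dedup_varList (c : Constraint) : c.varList.dedup.length = c.vars.card := by
  rw [← toFinset_varList, List.card_toFinset]

theorem length_of_mem_falsifyingTerms {c : Constraint} {t : Term}
    (h : t ∈ c.falsifyingTerms) : t.length = c.vars.card := by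
  rw [← length_dedup_varList, ← List.length_reverse (as := c.varList.dedup),
    ← keys_of_mem_falsifyingTerms h, List.length_map]

theorem nodup_of_mem_falsifyingTerms {c : Constraint} {t : Term}
    (h : t ∈ c.falsifyingTerms) : (t.map Prod.fst).Nodup := by
  rw [keys_of_mem_falsifyingTerms h, List.nodup_reverse]
  exact List.nodup_dedup _

theorem not_sat_of_mem_falsifyingTerms {c : Constraint} (hc : c.WellFormed) {t : Term}
    (h : t ∈ c.falsifyingTerms) {σ : ℕ → Bool} (ht : t.Holds σ) : ¬ c.Sat σ :=
  (falsifiedBy_iff hc ht (toFinset_keys_of_mem_falsifyingTerms h).ge).1 (List.mem_filter.1 h).2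

theorem exists_falsifyingTerm {c : Constraint} (hc : c.WellFormed) {σ : ℕ → Bool}
    (h : ¬ c.Sat σ) : ∃ t ∈ c.falsifyingTerms, t.Holds σ := by
  let t : Term := c.varList.dedup.reverse.map fun v => (v, σ v)
  have ht : t.Holds σ := by
    intro p hp
    obtain ⟨v, -, rfl⟩ := List.mem_map.1 hp
    rfl
  have hk : t.map Prod.fst = c.varList.dedup.reverse := by simp [t, Function.comp_def]
  refine ⟨t, List.mem_filter.2 ⟨mem_allTerms.2 hk, (falsifiedBy_iff hc ht ?_).2 h⟩, ht⟩
  rw [hk, List.toFinset_reverse, toFinset_dedup_varList]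

end Constraint

/-! ### Removing dominated universal variables -/

theorem update_override {S : Finset ℕ} {τ σ : ℕ → Bool} {x : ℕ} (hx : x ∉ S) (b : Bool) :
    override S τ (Function.update σ x b) = Function.update (override S τ σ) x b := by
  funext v
  by_cases h : v = x
  · subst h; simp [override, hx]
  · simp [override, Function.update_of_ne h]

theorem override_update {S : Finset ℕ} {τ σ : ℕ → Bool} {x : ℕ} (hx : x ∈ S) (b : Bool) :
    override S τ (Function.update σ x b) = override S τ σ := by
  funext v
  by_cases h : v = x
  · subst h; simp [override, hx]
  · simp [override, Function.update_of_ne h]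

theorem prefixTrue_assign {φ : List Constraint} (hφ : ∀ c ∈ φ, c.WellFormed) {S : Finset ℕ}
    {τ : ℕ → Bool} {Q : List (Quant × ℕ)} (hQ : ∀ p ∈ Q, p.2 ∉ S) (σ : ℕ → Bool) :
    PrefixTrue (φ.filterMap fun c => c.assign S τ) Q σ ↔ PrefixTrue φ Q (override S τ σ) := by
  induction Q generalizing σ with
  | nil =>
    simp only [PrefixTrue, List.mem_filterMap]
    constructor
    · intro h c hc
      cases h1 : c.assign S τ with
      | none => exact Constraint.sat_override_of_assign_eq_none h1 σ
      | some d => exact (Constraint.sat_of_assign_eq_some (hφ c hc) h1 σ).1 (h d ⟨c, hc, h1⟩)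
    · rintro h d ⟨c, hc, h1⟩
      exact (Constraint.sat_of_assign_eq_some (hφ c hc) h1 σ).2 (h c hc)
  | cons p Q ih =>
    obtain ⟨q, x⟩ := p
    have hx : x ∉ S := hQ (q, x) List.mem_cons_self
    have ih' := ih fun p hp => hQ p (List.mem_cons_of_mem _ hp)
    cases q <;> simp only [PrefixTrue, ih', update_override hx]

/-- A winning strategy for the shortened prefix can ignore the universal variables in `S`: the
matrix holds under the override at the end of each play, and `hdom` carries this over to the actual
play. -/
theorem prefixTrue_filter {φ : List Constraint} {S : Finset ℕ} {τ : ℕ → Bool}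
    (hdom : ∀ σ, (∀ c ∈ φ, c.Sat (override S τ σ)) → ∀ c ∈ φ, c.Sat σ)
    {Q : List (Quant × ℕ)} (hQ : ∀ p ∈ Q, p.2 ∈ S → p.1 = Quant.all) (σ : ℕ → Bool)
    (h : PrefixTrue φ (Q.filter fun p => p.2 ∉ S) (override S τ σ)) : PrefixTrue φ Q σ := by
  induction Q generalizing σ with
  | nil => exact hdom σ h
  | cons p Q ih =>
    obtain ⟨q, x⟩ := p
    have ih' := ih fun p hp => hQ p (List.mem_cons_of_mem _ hp)
    by_cases hx : x ∈ S
    · obtain rfl : q = Quant.all := hQ (q, x) List.mem_cons_self hx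
      intro b
      refine ih' _ ?_
      rw [override_update hx]
      simpa [hx] using h
    · rw [List.filter_cons_of_pos (by simpa using hx)] at h
      cases q with
      | all => exact fun b => ih' _ (by rw [update_override hx]; exact h b)
      | ex =>
        obtain ⟨b, hb⟩ := h
        exact ⟨b, ih' _ (by rw [update_override hx]; exact hb)⟩

/-- Each quantified variable of `S` is instantiated by its value under `τ`. The hypothesis `hσ` is
the invariant of the induction: a variable of `S` is still quantified or already agrees with `τ`. -/
theorem PrefixTrue.filter {φ : List Constraint} {S : Finset ℕ} {τ : ℕ → Bool}
    {Q : List (Quant × ℕ)} (hQ : ∀ p ∈ Q, p.2 ∈ S → p.1 = Quant.all) (σ : ℕ → Bool)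
    (hσ : ∀ v ∈ S, v ∈ Q.map Prod.snd ∨ σ v = τ v) (h : PrefixTrue φ Q σ) :
    PrefixTrue φ (Q.filter fun p => p.2 ∉ S) (override S τ σ) := by
  induction Q generalizing σ with
  | nil =>
    have : override S τ σ = σ := by
      funext v
      unfold override
      split
      · next hv => simpa using (hσ v hv).symm.imp_left Eq.symm
      · rfl
    rw [this]
    exact h
  | cons p Q ih =>
    obtain ⟨q, x⟩ := p
    have ih' := ih fun p hp => hQ p (List.mem_cons_of_mem _ hp)
    have hup : ∀ b, (x ∈ S → b = τ x) → ∀ v ∈ S, v ∈ Q.map Prod.snd ∨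
        Function.update σ x b v = τ v := by
      intro b hb v hv
      by_cases hvx : v = x
      · subst hvx
        simp [hb hv]
      · rw [Function.update_of_ne hvx]
        simpa [hvx] using hσ v hv
    by_cases hx : x ∈ S
    · obtain rfl : q = Quant.all := hQ (q, x) List.mem_cons_self hx
      have := ih' _ (hup (τ x) fun _ => rfl) (h (τ x))
      rw [override_update hx] at this
      simpa [hx] using this
    · rw [List.filter_cons_of_pos (by simpa using hx)]
      cases q with
      | all =>
        intro b
        rw [← update_override hx]
        exact ih' _ (hup b fun h => absurd h hx) (h b)
      | ex =>
        obtain ⟨b, hb⟩ := h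
        refine ⟨b, ?_⟩
        rw [← update_override hx]
        exact ih' _ (hup b fun h => absurd h hx) hb

namespace QBF

/-- Fixing universal variables preserves truth; domination `hdom` is needed for the converse only.
-/
theorem isTrue_assign_iff (Φ : QBF) {S : Finset ℕ} {τ : ℕ → Bool} (hS : S ⊆ Φ.vars)
    (huniv : ∀ v ∈ S, ∀ q, (q, v) ∈ Φ.prefx → q = Quant.all)
    (hdom : ∀ σ, (∀ c ∈ Φ.matrix, c.Sat (override S τ σ)) → ∀ c ∈ Φ.matrix, c.Sat σ) :
    (Φ.assign S τ).IsTrue ↔ Φ.IsTrue := by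
  have hQ : ∀ p ∈ Φ.prefx, p.2 ∈ S → p.1 = Quant.all := fun p hp hS => huniv p.2 hS p.1 hp
  have h1 : (Φ.assign S τ).IsTrue ↔ PrefixTrue Φ.matrix (Φ.prefx.filter fun p => p.2 ∉ S)
      (override S τ fun _ => false) :=
    prefixTrue_assign Φ.wellFormed (fun p hp => by simpa using (List.mem_filter.1 hp).2) _
  rw [h1]
  exact ⟨prefixTrue_filter hdom hQ _, PrefixTrue.filter hQ _ fun v hv =>
    Or.inl (by simpa [vars] using hS hv)⟩

end QBF

/-! ### Iterated assignments and subformulas -/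

namespace Constraint

theorem zip_projTuple (S : Finset ℕ) (xs : List ℕ) (t : List Bool) :
    (xs.filter fun v => v ∉ S).zip (projTuple S xs t) = (xs.zip t).filter fun p => p.1 ∉ S := by
  unfold projTuple
  induction xs generalizing t with
  | nil => simp
  | cons x xs ih =>
    cases t with
    | nil => simp
    | cons b t =>
      rw [List.zip_cons_cons]
      by_cases h : x ∈ S
      · simpa [h] using ih t
      · simpa [h] using ih t

/-- Variables of `S` are gone when `τ` is applied, so `σ` takes precedence on the overlap, as in
`override`. -/
theorem assign_assign (S T : Finset ℕ) (σ τ : ℕ → Bool) (c : Constraint) :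
    (c.assign S σ).bind (fun d => d.assign T τ) = c.assign (S ∪ T) (override S σ τ) := by
  cases c with
  | clause ls =>
    simp only [assign]
    by_cases h : ∃ l ∈ ls, l.var ∈ S ∧ σ l.var = l.sign
    · rw [if_pos h, if_pos]
      · rfl
      · obtain ⟨l, hl, h1, h2⟩ := h
        exact ⟨l, hl, by simp [h1], by rw [override, if_pos h1, h2]⟩
    · rw [if_neg h, Option.bind_some]
      simp only [List.filter_filter]
      have e : (∃ l ∈ ls.filter fun l => l.var ∉ S, l.var ∈ T ∧ τ l.var = l.sign) ↔
          ∃ l ∈ ls, l.var ∈ S ∪ T ∧ override S σ τ l.var = l.sign := by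
        simp only [List.mem_filter, decide_eq_true_eq, Finset.mem_union]
        constructor
        · rintro ⟨l, ⟨hl, h1⟩, h2, h3⟩
          exact ⟨l, hl, Or.inr h2, by rw [override, if_neg h1, h3]⟩
        · rintro ⟨l, hl, h1, h2⟩
          by_cases h3 : l.var ∈ S
          · rw [override, if_pos h3] at h2
            exact absurd ⟨l, hl, h3, h2⟩ h
          · rw [override, if_neg h3] at h2
            exact ⟨l, ⟨hl, h3⟩, h1.resolve_left h3, h2⟩
      simp only [e]
      congr 3
      refine List.filter_congr fun l _ => ?_
      simp [Bool.and_comm]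
  | affine A b =>
    simp only [assign, Option.bind_some, List.filter_filter, Option.some.injEq, affine.injEq]
    constructor
    · refine List.filter_congr fun v _ => ?_
      simp [Bool.and_comm]
    · rw [foldr_xor_filter (A.filter fun v => v ∈ S ∪ T) (override S σ τ) (· ∈ S)]
      simp only [List.filter_filter]
      have e1 : (A.filter fun v => decide (v ∈ S) && decide (v ∈ S ∪ T)).map (override S σ τ) =
          (A.filter fun v => v ∈ S).map σ := by
        have : (A.filter fun v => decide (v ∈ S) && decide (v ∈ S ∪ T)) =
            A.filter fun v => v ∈ S := List.filter_congr fun v _ => by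
          by_cases h : v ∈ S <;> simp [h]
        rw [this]
        exact List.map_congr_left fun v hv => by
          rw [override, if_pos (by simpa using (List.mem_filter.1 hv).2)]
      have e2 : (A.filter fun v => decide (¬ v ∈ S) && decide (v ∈ S ∪ T)).map (override S σ τ) =
          (A.filter fun v => decide (v ∈ T) && decide (v ∉ S)).map τ := by
        have : (A.filter fun v => decide (¬ v ∈ S) && decide (v ∈ S ∪ T)) =
            A.filter fun v => decide (v ∈ T) && decide (v ∉ S) := List.filter_congr fun v _ => by
          by_cases h : v ∈ S <;> simp [h]
        rw [this]
        exact List.map_congr_left fun v hv => by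
          have := (List.mem_filter.1 hv).2
          simp only [Bool.and_eq_true, decide_eq_true_eq] at this
          rw [override, if_neg this.2]
      rw [e1, e2, Bool.xor_assoc]
  | rel xs R =>
    simp only [assign, Option.bind_some, List.filter_filter, Option.some.injEq, rel.injEq]
    constructor
    · refine List.filter_congr fun v _ => ?_
      simp [Bool.and_comm]
    · rw [List.filter_map, List.map_map, List.filter_filter]
      have e : ∀ t, (projTuple T (xs.filter fun v => v ∉ S) ∘ projTuple S xs) t =
          projTuple (S ∪ T) xs t := by
        intro t
        rw [Function.comp_apply, projTuple, zip_projTuple, List.filter_filter, projTuple]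
        congr 1
        refine List.filter_congr fun v _ => ?_
        simp [Bool.and_comm]
      rw [funext e]
      congr 1
      refine List.filter_congr fun t _ => ?_
      rw [Function.comp_apply, zip_projTuple, Bool.eq_iff_iff]
      simp only [List.mem_filter, Bool.and_eq_true, decide_eq_true_eq, Finset.mem_union]
      constructor
      · rintro ⟨h1, h2⟩ p hp h3
        by_cases h4 : p.1 ∈ S
        · rw [override, if_pos h4, h2 p hp h4]
        · rw [override, if_neg h4, h1 p ⟨hp, h4⟩ (h3.resolve_left h4)]
      · intro h
        refine ⟨fun p hp h1 => ?_, fun p hp h1 => ?_⟩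
        · have := h p hp.1 (Or.inr h1)
          rwa [override, if_neg hp.2] at this
        · have := h p hp (Or.inl h1)
          rwa [override, if_pos h1] at this

end Constraint

namespace QBF

theorem assign_assign (Φ : QBF) (S T : Finset ℕ) (σ τ : ℕ → Bool) :
    (Φ.assign S σ).assign T τ = Φ.assign (S ∪ T) (override S σ τ) := by
  ext1
  · simp only [assign, List.filter_filter]
    refine List.filter_congr fun v _ => ?_
    simp [Bool.and_comm]
  · simp only [assign, List.filterMap_filterMap, Constraint.assign_assign]

theorem vars_assign (Φ : QBF) (S : Finset ℕ) (τ : ℕ → Bool) :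
    (Φ.assign S τ).vars = Φ.vars \ S :=
  toFinset_prefix_filter _ _

/-- Assigning `S` and then `T` is one assignment of `S ∪ T`; disjointness ensures that all of `T` is
still present. -/
theorem isBackdoor_assign {C : Set QBF} {Φ : QBF} {S T : Finset ℕ} (τ : ℕ → Bool)
    (h : IsBackdoor C Φ (S ∪ T)) (hST : Disjoint S T) : IsBackdoor C (Φ.assign S τ) T := by
  refine ⟨?_, fun τ' => ?_⟩
  · rw [vars_assign]
    exact Finset.subset_sdiff.2 ⟨Finset.union_subset_right h.1, hST.symm⟩
  · rw [assign_assign]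
    exact h.2 _

/-- The clauses satisfied by `τ` vanish and the others lose exactly their literals over `S ∪ T`. The
idle `delete ∅` fits the closure condition, which is applied with no further variables removed. -/
theorem sublist_delete_assign {φ : List Constraint} (hφ : ∀ c ∈ φ, c.IsClause) (S T : Finset ℕ)
    (τ : ℕ → Bool) :
    ((φ.filterMap fun c => c.assign S τ).map (Constraint.delete T)).Sublist
      ((φ.map (Constraint.delete (S ∪ T))).map (Constraint.delete ∅)) := by
  induction φ with
  | nil => exact List.Sublist.refl _
  | cons c φ ih =>
    have ih' := ih fun c hc => hφ c (List.mem_cons_of_mem _ hc)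
    have hc := hφ c List.mem_cons_self
    cases c with
    | clause ls =>
      rw [List.filterMap_cons]
      cases h : (Constraint.clause ls).assign S τ with
      | none => exact ih'.cons _
      | some d =>
        have : d.delete T = ((Constraint.clause ls).delete (S ∪ T)).delete ∅ := by
          simp only [Constraint.assign] at h
          split at h
          · simp at h
          · obtain rfl := Option.some.inj h
            simp only [Constraint.delete, List.filter_filter, Constraint.clause.injEq]
            refine List.filter_congr fun v _ => ?_
            simp [Bool.and_comm]
        simp only [List.map_cons, this]
        exact ih'.cons_cons _
    | affine A b => exact hc.elim
    | rel xs R => exact hc.elim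

theorem isDeletionBackdoor_assign {C : Set QBF} (hC : ClosedUnderSubformulas C) {Φ : QBF}
    {S T : Finset ℕ} (τ : ℕ → Bool) (h : IsDeletionBackdoor C Φ (S ∪ T)) (hST : Disjoint S T) :
    IsDeletionBackdoor C (Φ.assign S τ) T := by
  obtain ⟨h1, h2, h3⟩ := h
  refine ⟨?_, ?_, hC _ h3 ?_ ∅ _ ?_ ?_⟩
  · rw [vars_assign]
    exact Finset.subset_sdiff.2 ⟨Finset.union_subset_right h1, hST.symm⟩
  · intro d hd
    obtain ⟨c, hc, hd⟩ := List.mem_filterMap.1 hd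
    have := h2 c hc
    cases c with
    | clause ls =>
      simp only [Constraint.assign] at hd
      split at hd
      · simp at hd
      · obtain rfl := Option.some.inj hd
        trivial
    | affine A b => exact this.elim
    | rel xs R => exact this.elim
  · intro d hd
    obtain ⟨c, hc, rfl⟩ := List.mem_map.1 hd
    have := h2 c hc
    cases c with
    | clause ls => trivial
    | affine A b => exact this.elim
    | rel xs R => exact this.elim
  · simp only [delete, assign, List.filter_filter]
    refine List.filter_congr fun v _ => ?_
    simp [Bool.and_comm]
  · exact sublist_delete_assign h2 S T τ

/-! ### The universal part -/

theorem mem_exVars {Q : List (Quant × ℕ)} {B : List ℕ} {v : ℕ} :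
    v ∈ exVars Q B ↔ (Quant.ex, v) ∈ Q ∧ v ∉ B := by
  simp only [exVars, List.mem_map, List.mem_filter, Bool.and_eq_true, Bool.not_eq_true',
    decide_eq_false_iff_not]
  constructor
  · rintro ⟨⟨q, w⟩, ⟨h1, h2, h3⟩, rfl⟩
    cases q with
    | ex => exact ⟨h1, h3⟩
    | all => simp at h2
  · rintro ⟨h1, h2⟩
    exact ⟨_, ⟨h1, rfl, h2⟩, rfl⟩

theorem mem_reachStep {E₀ B E : List ℕ} {M : List Constraint} {v : ℕ} :
    v ∈ reachStep E₀ B M E ↔ v ∈ E₀ ∨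
      ∃ c ∈ M, v ∈ c.vars ∧ v ∉ B ∧ ∃ w ∈ c.vars, w ∉ B ∧ w ∈ E := by
  rw [reachStep, List.mem_append, List.mem_flatMap]
  refine or_congr_right (exists_congr fun c => and_congr_right fun _ => ?_)
  cases h : c.varList.any fun v => !decide (v ∈ B) && decide (v ∈ E) with
  | false =>
    simp only [List.any_eq_false, Bool.and_eq_true, Bool.not_eq_true', decide_eq_false_iff_not,
      decide_eq_true_eq, Constraint.mem_varList] at h
    simp only [cond_false, List.not_mem_nil, false_iff]
    rintro ⟨-, -, w, h1, h2⟩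
    exact h w h1 h2
  | true =>
    simp only [List.any_eq_true, Bool.and_eq_true, Bool.not_eq_true', decide_eq_false_iff_not,
      decide_eq_true_eq, Constraint.mem_varList] at h
    simp only [cond_true, List.mem_filter, Constraint.mem_varList, Bool.not_eq_true',
      decide_eq_false_iff_not]
    exact ⟨fun h1 => ⟨h1.1, h1.2, h⟩, fun h1 => ⟨h1.1, h1.2.1⟩⟩

theorem mem_universalPart {Φ : QBF} {B : Finset ℕ} {v : ℕ} : v ∈ Φ.universalPart B ↔
    v ∈ Φ.vars ∧ ∃ K : (Φ.primalGraphMinus B).ConnectedComponent,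
      (∃ w ∈ K.supp, w.1.1 = v) ∧ ∀ w ∈ K.supp, Φ.IsUniversal w.1.1 := by
  simp only [universalPart, Finset.mem_filter]

variable (Φ : QBF) (B : List ℕ)

theorem mem_vars {Φ : QBF} {q : Quant} {v : ℕ} (h : (q, v) ∈ Φ.prefx) : v ∈ Φ.vars := by
  simpa [vars] using ⟨q, h⟩

theorem quant_unique {Φ : QBF} {q q' : Quant} {v : ℕ} (h : (q, v) ∈ Φ.prefx)
    (h' : (q', v) ∈ Φ.prefx) : q = q' :=
  congrArg Prod.fst (List.inj_on_of_nodup_map Φ.nodup h h' rfl)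

theorem not_isUniversal_iff {Φ : QBF} {v : ℕ} (hv : v ∈ Φ.vars) :
    ¬ Φ.IsUniversal v ↔ (Quant.ex, v) ∈ Φ.prefx := by
  obtain ⟨⟨q, w⟩, h, rfl⟩ := List.mem_map.1 (List.mem_toFinset.1 hv)
  constructor
  · intro h1
    cases q with
    | ex => exact h
    | all => exact absurd h h1
  · intro h1 h2
    exact absurd (quant_unique h1 h2) (by simp)

/-- The vertices of the primal graph minus `B`. -/
abbrev Vertex : Type := ({w | w.1 ∉ B.toFinset} : Set {v : ℕ // v ∈ Φ.vars})

theorem reached_eq_iterate (Q : List (Quant × ℕ)) (M : List Constraint) :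
    reached Q M B = (reachStep (exVars Q B) B M)^[Q.length] (exVars Q B) := by
  have : ∀ (f : List ℕ → List ℕ) (l : List (Quant × ℕ)) (E : List ℕ),
      l.foldl (fun E _ => f E) E = f^[l.length] E := by
    intro f l
    induction l with
    | nil => intro E; rfl
    | cons a l ih => intro E; rw [List.foldl_cons, ih]; rfl
  exact this _ _ _

theorem exists_reachable_of_mem_iterate (i : ℕ) {v : ℕ}
    (h : v ∈ (reachStep (exVars Φ.prefx B) B Φ.matrix)^[i] (exVars Φ.prefx B)) :
    ∃ x w : Φ.Vertex B, x.1.1 = v ∧ (Quant.ex, w.1.1) ∈ Φ.prefx ∧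
      (Φ.primalGraphMinus B.toFinset).Reachable x w := by
  induction i generalizing v with
  | zero =>
    obtain ⟨h1, h2⟩ := mem_exVars.1 h
    exact ⟨⟨⟨v, mem_vars h1⟩, by simpa using h2⟩, _, rfl, h1, SimpleGraph.Reachable.refl _⟩
  | succ i ih =>
    rw [Function.iterate_succ_apply'] at h
    rcases mem_reachStep.1 h with h | ⟨c, hc, hv, hvB, w, hw, hwB, hE⟩
    · obtain ⟨h1, h2⟩ := mem_exVars.1 h
      exact ⟨⟨⟨v, mem_vars h1⟩, by simpa using h2⟩, _, rfl, h1, SimpleGraph.Reachable.refl _⟩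
    · obtain ⟨x, y, rfl, hy, hxy⟩ := ih hE
      refine ⟨⟨⟨v, Φ.closed c hc hv⟩, by simpa using hvB⟩, y, rfl, hy, ?_⟩
      by_cases he : (⟨⟨v, Φ.closed c hc hv⟩, by simpa using hvB⟩ : Φ.Vertex B) = x
      · rw [he]; exact hxy
      · refine SimpleGraph.Reachable.trans (SimpleGraph.Adj.reachable ?_) hxy
        exact ⟨fun h => he (Subtype.ext h), c, hc, hv, hw⟩

/-- Each round looks one edge further; a variable whose neighbour has a walk of length at most `i`
to an existential variable is found in round `i + 1`. -/
theorem mem_iterate_of_walk (i : ℕ) {x w : Φ.Vertex B}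
    (p : (Φ.primalGraphMinus B.toFinset).Walk x w) (hp : p.length ≤ i)
    (hw : (Quant.ex, w.1.1) ∈ Φ.prefx) :
    x.1.1 ∈ (reachStep (exVars Φ.prefx B) B Φ.matrix)^[i] (exVars Φ.prefx B) := by
  have hB : ∀ x : Φ.Vertex B, x.1.1 ∉ B := fun x => by simpa using x.2
  induction i generalizing x with
  | zero =>
    cases p with
    | nil => exact mem_exVars.2 ⟨hw, hB _⟩
    | cons h p => simp at hp
  | succ i ih =>
    rw [Function.iterate_succ_apply', mem_reachStep]
    cases p with
    | nil => exact Or.inl (mem_exVars.2 ⟨hw, hB _⟩)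
    | cons h p =>
      obtain ⟨c, hc, h1, h2⟩ := h.2
      exact Or.inr ⟨c, hc, h1, hB _, _, h2, hB _, ih p (by simpa using hp)⟩

theorem mem_reached_iff (x : Φ.Vertex B) : x.1.1 ∈ reached Φ.prefx Φ.matrix B ↔
    ∃ w : Φ.Vertex B, (Quant.ex, w.1.1) ∈ Φ.prefx ∧
      (Φ.primalGraphMinus B.toFinset).Reachable x w := by
  classical
  rw [reached_eq_iterate]
  constructor
  · intro h
    obtain ⟨y, w, h1, h2, h3⟩ := exists_reachable_of_mem_iterate Φ B _ h
    obtain rfl : y = x := Subtype.ext (Subtype.ext h1)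
    exact ⟨w, h2, h3⟩
  · rintro ⟨w, hw, h⟩
    obtain ⟨p, hp⟩ := h.exists_isPath
    have : Fintype (Φ.Vertex B) := Fintype.ofFinite _
    -- A path is shorter than the number of vertices, which is at most the length of the prefix.
    refine mem_iterate_of_walk Φ B _ p (hp.length_lt.le.trans ?_) hw
    calc Fintype.card (Φ.Vertex B) ≤ Fintype.card {v : ℕ // v ∈ Φ.vars} :=
          Fintype.card_le_of_injective Subtype.val Subtype.val_injective
      _ = Φ.vars.card := by simp
      _ ≤ (Φ.prefx.map Prod.snd).length := List.toFinset_card_le _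
      _ = _ := List.length_map _

/-- A component consists of universal variables exactly if no existential variable is reachable from
any of its vertices. -/
theorem toFinset_universalList :
    (universalList Φ.prefx Φ.matrix B).toFinset = Φ.universalPart B.toFinset := by
  ext v
  simp only [universalList, mem_universalPart, List.mem_toFinset, List.mem_filter,
    Bool.and_eq_true, Bool.not_eq_true', decide_eq_false_iff_not]
  have hv : v ∈ Φ.prefx.map Prod.snd ↔ v ∈ Φ.vars := List.mem_toFinset.symm
  rw [hv]
  refine and_congr_right fun hv => ?_
  constructor
  · rintro ⟨h1, h2⟩
    let x : Φ.Vertex B := ⟨⟨v, hv⟩, by simpa using h1⟩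
    refine ⟨(Φ.primalGraphMinus B.toFinset).connectedComponentMk x, ⟨x, rfl, rfl⟩, fun w hw => ?_⟩
    by_contra h3
    refine h2 ((mem_reached_iff Φ B x).2 ⟨w, (not_isUniversal_iff w.1.2).1 h3, ?_⟩)
    exact (SimpleGraph.ConnectedComponent.exact hw).symm
  · rintro ⟨K, ⟨x, hx, rfl⟩, hK⟩
    refine ⟨by simpa using x.2, fun h => ?_⟩
    obtain ⟨w, hw, hr⟩ := (mem_reached_iff Φ B x).1 h
    refine (not_isUniversal_iff w.1.2).2 hw (hK w ?_)
    have hx' : (Φ.primalGraphMinus B.toFinset).connectedComponentMk x = K := hx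
    rw [SimpleGraph.ConnectedComponent.mem_supp_iff, ← hx']
    exact SimpleGraph.ConnectedComponent.sound hr.symm

theorem universalPart_subset (B : Finset ℕ) : Φ.universalPart B ⊆ Φ.vars :=
  fun _ h => (mem_universalPart.1 h).1

theorem isUniversal_of_mem_universalPart {Φ : QBF} {B : Finset ℕ} {v : ℕ}
    (h : v ∈ Φ.universalPart B) : Φ.IsUniversal v := by
  obtain ⟨-, K, ⟨w, hw, rfl⟩, hK⟩ := mem_universalPart.1 h
  exact hK w hw

/-- A variable of `c` outside `B` equals `u` or is adjacent to it in the graph minus `B`, so it lies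
in the same, purely universal, component. -/
theorem vars_subset_of_touches {Φ : QBF} {B : Finset ℕ} {c : Constraint} (hc : c ∈ Φ.matrix)
    {u : ℕ} (hu : u ∈ c.vars) (hU : u ∈ Φ.universalPart B) :
    c.vars ⊆ B ∪ Φ.universalPart B := by
  intro v hv
  rw [Finset.mem_union, or_iff_not_imp_left]
  intro hvB
  obtain ⟨-, K, ⟨w, hw, rfl⟩, hK⟩ := mem_universalPart.1 hU
  refine mem_universalPart.2 ⟨Φ.closed c hc hv, K, ⟨⟨⟨v, Φ.closed c hc hv⟩, hvB⟩, ?_, rfl⟩, hK⟩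
  by_cases he : (⟨⟨v, Φ.closed c hc hv⟩, hvB⟩ : ({w | w.1 ∉ B} : Set {v : ℕ // v ∈ Φ.vars})) = w
  · rw [he]; exact hw
  · rw [SimpleGraph.ConnectedComponent.mem_supp_iff] at hw ⊢
    rw [← hw]
    exact SimpleGraph.ConnectedComponent.sound (SimpleGraph.Adj.reachable
      ⟨fun h => he (Subtype.ext h), c, hc, hv, hu⟩)

theorem card_inter_le_maxOcc {Φ : QBF} {c : Constraint} (hc : c ∈ Φ.matrix) (Y : Finset ℕ) :
    (c.vars ∩ Y).card ≤ Φ.maxOcc Y := by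
  unfold maxOcc
  have : ∀ (l : List ℕ), ∀ n ∈ l, n ≤ l.foldr max 0 := by
    intro l
    induction l with
    | nil => simp
    | cons a l ih =>
      intro n hn
      rw [List.foldr_cons]
      rcases List.mem_cons.1 hn with rfl | hn
      · exact le_max_left _ _
      · exact (ih n hn).trans (le_max_right _ _)
  exact this _ _ (List.mem_map_of_mem hc)

theorem card_vars_le {Φ : QBF} {B : Finset ℕ} {c : Constraint} (hc : c ∈ Φ.matrix)
    {u : ℕ} (hu : u ∈ c.vars) (hU : u ∈ Φ.universalPart B) :
    c.vars.card ≤ B.card + Φ.maxOcc (Φ.universalPart B) := by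
  calc c.vars.card ≤ (B ∪ c.vars ∩ Φ.universalPart B).card := by
        refine Finset.card_le_card fun v hv => ?_
        have := vars_subset_of_touches hc hu hU hv
        simp only [Finset.mem_union, Finset.mem_inter] at this ⊢
        tauto
    _ ≤ B.card + (c.vars ∩ Φ.universalPart B).card := Finset.card_union_le _ _
    _ ≤ _ := Nat.add_le_add_left (card_inter_le_maxOcc hc _) _

end QBF

/-! ### Correctness of the work loop -/

/-- If some term of the family holds, then this is still so after resetting the variables outside of
`X` according to `τ`. -/
def Covers (X : List ℕ) (τ : ℕ → Bool) (F : List Term) : Prop :=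
  ∀ σ : ℕ → Bool, (∃ t ∈ F, t.Holds σ) → ∃ t ∈ F, t.Holds (fun v => if v ∈ X then σ v else τ v)

/-- Terms of length at most `k` over distinct variables from `V`. -/
structure Term.Ok (V : Finset ℕ) (k : ℕ) (t : Term) : Prop where
  length_le : t.length ≤ k
  nodup : (t.map Prod.fst).Nodup
  mem : ∀ p ∈ t, p.1 ∈ V

theorem Term.Ok.sublist {V : Finset ℕ} {k : ℕ} {t u : Term} (h : t.Ok V k) (hu : u.Sublist t) :
    u.Ok V k :=
  ⟨hu.length_le.trans h.length_le, h.nodup.sublist (hu.map _), fun p hp => h.mem p (hu.mem hp)⟩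

theorem Term.avoids_iff {Z : List ℕ} {t : Term} : t.avoids Z = true ↔ ∀ p ∈ t, p.1 ∉ Z := by
  simp only [avoids, List.all_eq_true, Bool.not_eq_true', decide_eq_false_iff_not]

theorem Term.holds_iff {Z : List ℕ} {t : Term} {σ : ℕ → Bool} :
    t.Holds σ ↔ (t.restrict Z).Holds σ ∧ (t.remove Z).Holds σ := by
  simp only [Holds, restrict, remove, List.mem_filter, decide_eq_true_eq, Bool.not_eq_true',
    decide_eq_false_iff_not]
  exact ⟨fun h => ⟨fun p hp => h p hp.1, fun p hp => h p hp.1⟩, fun h p hp => by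
    by_cases hZ : p.1 ∈ Z
    · exact h.1 p ⟨hp, hZ⟩
    · exact h.2 p ⟨hp, hZ⟩⟩

theorem Term.length_remove_lt {Z : List ℕ} {t : Term} (h : t.avoids Z = false) :
    (t.remove Z).length < t.length := by
  rw [remove, List.length_filter_lt_length_iff_exists]
  have : ¬ ∀ p ∈ t, p.1 ∉ Z := by rw [← avoids_iff, h]; simp
  push Not at this
  simpa using this

theorem mem_splitFamily {Z : List ℕ} {F G : List Term} : G ∈ splitFamily Z F ↔
    ∃ t ∈ F, G = (F.filter fun u => decide (u.restrict Z = t.restrict Z)).map (Term.remove Z) := by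
  simp only [splitFamily, List.mem_map, List.mem_dedup]
  constructor
  · rintro ⟨_, ⟨t, ht, rfl⟩, rfl⟩
    exact ⟨t, ht, rfl⟩
  · rintro ⟨t, ht, rfl⟩
    exact ⟨_, ⟨t, ht, rfl⟩, rfl⟩

theorem exists_of_mem_splitFamily {Z : List ℕ} {F G : List Term} (h : G ∈ splitFamily Z F)
    {u : Term} (hu : u ∈ G) : ∃ t ∈ F, u = t.remove Z := by
  obtain ⟨t, -, rfl⟩ := mem_splitFamily.1 h
  obtain ⟨u, hu', rfl⟩ := List.mem_map.1 hu
  exact ⟨u, (List.mem_filter.1 hu').1, rfl⟩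

theorem ne_nil_of_mem_splitFamily {Z : List ℕ} {F G : List Term} (h : G ∈ splitFamily Z F) :
    G ≠ [] := by
  obtain ⟨t, ht, rfl⟩ := mem_splitFamily.1 h
  exact List.ne_nil_of_mem (List.mem_map.2 ⟨t, List.mem_filter.2 ⟨ht, by simp⟩, rfl⟩)

theorem esize_le_of_mem_splitFamily {Z : List ℕ} {F G : List Term} (h : G ∈ splitFamily Z F) :
    esize G ≤ esize F := by
  obtain ⟨t, -, rfl⟩ := mem_splitFamily.1 h
  have : ∀ l : List Term, esize (l.map (Term.remove Z)) ≤ esize l := by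
    intro l
    induction l with
    | nil => rfl
    | cons a l ih =>
      have : esize (a.remove Z) ≤ esize a := List.filter_sublist.esize_le
      simp only [List.map_cons, esize_cons]
      omega
  exact (this _).trans List.filter_sublist.esize_le

/-- If `t` holds, pass to the family of its class. The term found there comes from some `u` with the
same part on `Z` as `t`, and this part is unaffected by the reset because `Z` is contained in `X`.
-/
theorem covers_of_splitFamily {Z X : List ℕ} {τ : ℕ → Bool} {F : List Term} (hZ : Z ⊆ X)
    (h : ∀ G ∈ splitFamily Z F, Covers X τ G) : Covers X τ F := by
  rintro σ ⟨t, ht, hσ⟩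
  rw [Term.holds_iff (Z := Z)] at hσ
  obtain ⟨_, hu, hu'⟩ := h _ (mem_splitFamily.2 ⟨t, ht, rfl⟩) σ
    ⟨_, List.mem_map.2 ⟨t, List.mem_filter.2 ⟨ht, by simp⟩, rfl⟩, hσ.2⟩
  obtain ⟨u, hu₁, rfl⟩ := List.mem_map.1 hu
  obtain ⟨hu₂, he⟩ := List.mem_filter.1 hu₁
  refine ⟨u, hu₂, (Term.holds_iff (Z := Z)).2 ⟨?_, hu'⟩⟩
  rw [decide_eq_true_eq] at he
  rw [he]
  intro p hp
  have : p.1 ∈ Z := by simpa [Term.restrict] using (List.mem_filter.1 hp).2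
  simpa [hZ this] using hσ.1 p hp

theorem card_lists_le (S : Finset (ℕ × Bool)) (k : ℕ) (L : List Term) (hL : L.Nodup)
    (h : ∀ t ∈ L, t.length ≤ k ∧ ∀ p ∈ t, p ∈ S) : L.length ≤ (S.card + 1) ^ k := by
  have key : ∀ k : ℕ, ∃ T : Finset Term, T.card ≤ (S.card + 1) ^ k ∧
      ∀ t : Term, t.length ≤ k → (∀ p ∈ t, p ∈ S) → t ∈ T := by
    intro k
    induction k with
    | zero => exact ⟨{[]}, by simp, fun t ht _ => by simpa using ht⟩
    | succ k ih =>
      obtain ⟨T, hT, h⟩ := ih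
      -- A list is empty or has a head in `S`, and `1 + s * (s + 1) ^ k ≤ (s + 1) ^ (k + 1)`.
      refine ⟨insert [] ((S ×ˢ T).image fun q => q.1 :: q.2), ?_, fun t ht hS => ?_⟩
      · refine (Finset.card_insert_le _ _).trans ((Nat.succ_le_succ Finset.card_image_le).trans ?_)
        rw [Finset.card_product, pow_succ]
        have : 1 ≤ (S.card + 1) ^ k := Nat.one_le_pow _ _ (by omega)
        have := Nat.mul_le_mul_left S.card hT
        rw [mul_add, mul_one, mul_comm ((S.card + 1) ^ k)]
        omega
      · cases t with
        | nil => exact Finset.mem_insert_self _ _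
        | cons p t =>
          refine Finset.mem_insert_of_mem (Finset.mem_image.2 ⟨(p, t), Finset.mem_product.2
            ⟨hS p List.mem_cons_self, h t (by simpa using ht) fun q hq =>
              hS q (List.mem_cons_of_mem _ hq)⟩, rfl⟩)
  obtain ⟨T, hT, h'⟩ := key k
  rw [← List.toFinset_card_of_nodup hL]
  exact (Finset.card_le_card fun t ht => h' t (h t (by simpa using ht)).1
    (h t (by simpa using ht)).2).trans hT

/-- The families correspond to the parts on `Z`, which are lists over `2 * |Z|` pairs; the number of
terms in `F` plays no role. -/
theorem length_splitFamily_le {Z : List ℕ} {F : List Term} {k : ℕ} (h : ∀ t ∈ F, t.length ≤ k) :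
    (splitFamily Z F).length ≤ (2 * Z.length + 1) ^ k := by
  rw [splitFamily, List.length_map]
  refine (card_lists_le (Z.toFinset ×ˢ Finset.univ) k _ (List.nodup_dedup _) fun t ht => ?_).trans ?_
  · obtain ⟨u, hu, rfl⟩ := List.mem_map.1 (List.mem_dedup.1 ht)
    refine ⟨(List.length_filter_le _ _).trans (h u hu), fun p hp => ?_⟩
    simpa using (List.mem_filter.1 hp).2
  · refine Nat.pow_le_pow_left ?_ k
    rw [Finset.card_product, Finset.card_univ, Fintype.card_bool]
    have := List.toFinset_card_le Z
    omega

theorem workStep_cases (σ : WorkState) :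
    (σ.2.2.1 = [] ∧ workStep σ = σ) ∨
    (∃ F rest t, σ.2.2.1 = F :: rest ∧ t ∈ F ∧ (∀ p ∈ t, p.1 ∉ σ.1 ++ σ.2.1.map Prod.fst) ∧
      workStep σ = (σ.1, t ++ σ.2.1, rest, F :: σ.2.2.2)) ∨
    (∃ F rest, σ.2.2.1 = F :: rest ∧
      (∀ t ∈ F, Term.avoids (σ.1 ++ σ.2.1.map Prod.fst) t = false) ∧
      workStep σ = (σ.1 ++ σ.2.1.map Prod.fst, [],
        splitFamily (σ.1 ++ σ.2.1.map Prod.fst) F ++ (σ.2.2.2 ++ rest), [])) := by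
  obtain ⟨X, A, _ | ⟨F, rest⟩, D⟩ := σ
  · exact Or.inl ⟨rfl, rfl⟩
  · right
    simp only [workStep]
    cases h : F.filter (Term.avoids (X ++ A.map Prod.fst)) with
    | nil =>
      right
      exact ⟨F, rest, rfl, by simpa [List.filter_eq_nil_iff] using h, rfl⟩
    | cons t _ =>
      left
      obtain ⟨ht, h'⟩ := List.mem_filter.1 (h ▸ List.mem_cons_self : t ∈ F.filter _)
      exact ⟨F, rest, t, rfl, ht, Term.avoids_iff.1 h', rfl⟩

/-- The invariant of the work loop. -/
structure WorkInv (F₀ : List Term) (B V : Finset ℕ) (k : ℕ) (σ : WorkState) : Prop where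
  -- Stated for all larger `X'` and all `τ`, since the kept set still grows and the assignment may
  -- be discarded.
  covers : ∀ X' τ, σ.1 ⊆ X' → (∀ G ∈ σ.2.2.1 ++ σ.2.2.2, Covers X' τ G) → Covers X' τ F₀
  -- An empty family would offer no term to pick and could not be made smaller by splitting.
  ne_nil : ∀ G ∈ σ.2.2.1 ++ σ.2.2.2, G ≠ []
  ok : ∀ G ∈ σ.2.2.1 ++ σ.2.2.2, ∀ t ∈ G, t.Ok V k
  esize_le : ∀ G ∈ σ.2.2.1 ++ σ.2.2.2, esize G ≤ esize F₀
  base_subset : B ⊆ σ.1.toFinset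
  subset : σ.1.toFinset ⊆ V
  nodup : (σ.2.1.map Prod.fst).Nodup
  mem : ∀ p ∈ σ.2.1, p.1 ∈ V ∧ p.1 ∉ σ.1
  done : ∀ G ∈ σ.2.2.2, ∃ t ∈ G, t ⊆ σ.2.1

namespace WorkInv

variable {F₀ : List Term} {B V : Finset ℕ} {k : ℕ} {σ : WorkState}

theorem step (h : WorkInv F₀ B V k σ) : WorkInv F₀ B V k (workStep σ) := by
  rcases workStep_cases σ with ⟨-, e⟩ | ⟨F, rest, t, h1, ht, h2, e⟩ | ⟨F, rest, h1, h2, e⟩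
  · rwa [e]
  · have hF : F ∈ σ.2.2.1 ++ σ.2.2.2 := by simp [h1]
    have hperm : ∀ G, G ∈ rest ++ F :: σ.2.2.2 ↔ G ∈ σ.2.2.1 ++ σ.2.2.2 := by
      intro G
      simp only [h1, List.mem_append, List.mem_cons]
      tauto
    have hok := h.ok F hF t ht
    rw [e]
    refine ⟨fun X' τ hX hc => h.covers X' τ hX fun G hG => hc G ((hperm G).2 hG),
      fun G hG => h.ne_nil G ((hperm G).1 hG), fun G hG => h.ok G ((hperm G).1 hG),
      fun G hG => h.esize_le G ((hperm G).1 hG), h.base_subset, h.subset, ?_, ?_, ?_⟩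
    · simp only [List.map_append]
      refine hok.nodup.append h.nodup ?_
      intro v hv hv'
      obtain ⟨p, hp, rfl⟩ := List.mem_map.1 hv
      exact h2 p hp (List.mem_append_right _ hv')
    · intro p hp
      rcases List.mem_append.1 hp with hp | hp
      · exact ⟨hok.mem p hp, fun h' => h2 p hp (List.mem_append_left _ h')⟩
      · exact h.mem p hp
    · intro G hG
      rcases List.mem_cons.1 hG with rfl | hG
      · exact ⟨t, ht, List.subset_append_left _ _⟩
      · obtain ⟨u, hu, hu'⟩ := h.done G hG
        exact ⟨u, hu, fun p hp => List.mem_append_right _ (hu' hp)⟩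
  · have hF : F ∈ σ.2.2.1 ++ σ.2.2.2 := by simp [h1]
    set Z := σ.1 ++ σ.2.1.map Prod.fst with hZ
    have hmem : ∀ G, G ∈ splitFamily Z F ++ (σ.2.2.2 ++ rest) ++ [] ↔
        G ∈ splitFamily Z F ∨ G ∈ rest ++ σ.2.2.2 := by
      intro G
      simp only [List.mem_append, List.append_nil]
      tauto
    have hrest : ∀ G ∈ rest ++ σ.2.2.2, G ∈ σ.2.2.1 ++ σ.2.2.2 := by
      intro G hG
      rw [h1]
      exact List.mem_cons_of_mem _ hG
    rw [e]
    refine ⟨fun X' τ hX hc => h.covers X' τ (fun v hv => hX (List.mem_append_left _ hv))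
      fun G hG => ?_, fun G hG => ?_, fun G hG => ?_, fun G hG => ?_, ?_, ?_, List.nodup_nil,
      fun p hp => by simp at hp, fun G hG => by simp at hG⟩
    · rw [h1, List.cons_append, List.mem_cons] at hG
      rcases hG with rfl | hG
      · exact covers_of_splitFamily hX fun G' hG' => hc G' ((hmem G').2 (Or.inl hG'))
      · exact hc G ((hmem G).2 (Or.inr hG))
    · rcases (hmem G).1 hG with hG | hG
      · exact ne_nil_of_mem_splitFamily hG
      · exact h.ne_nil G (hrest G hG)
    · rcases (hmem G).1 hG with hG | hG
      · intro t ht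
        obtain ⟨u, hu, rfl⟩ := exists_of_mem_splitFamily hG ht
        exact (h.ok F hF u hu).sublist List.filter_sublist
      · exact h.ok G (hrest G hG)
    · rcases (hmem G).1 hG with hG | hG
      · exact (esize_le_of_mem_splitFamily hG).trans (h.esize_le F hF)
      · exact h.esize_le G (hrest G hG)
    · exact h.base_subset.trans fun v hv => by
        simp only [hZ, List.toFinset_append]
        exact Finset.mem_union_left _ hv
    · intro v hv
      simp only [hZ, List.toFinset_append, Finset.mem_union, List.mem_toFinset] at hv
      rcases hv with hv | hv
      · exact h.subset (List.mem_toFinset.2 hv)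
      · obtain ⟨p, hp, rfl⟩ := List.mem_map.1 hv
        exact (h.mem p hp).1

theorem iterate (h : WorkInv F₀ B V k σ) (n : ℕ) : WorkInv F₀ B V k (workStep^[n] σ) := by
  induction n with
  | zero => exact h
  | succ n ih => rw [Function.iterate_succ_apply']; exact ih.step

/-- Each finished family has a term inside the assignment, over variables outside the kept set; it
holds after the reset whatever held before. -/
theorem covers_of_done (h : WorkInv F₀ B V k σ) (hσ : σ.2.2.1 = []) :
    Covers σ.1 (valOf σ.2.1) F₀ := by
  refine h.covers σ.1 _ (List.Subset.refl _) fun G hG σ' _ => ?_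
  rw [hσ, List.nil_append] at hG
  obtain ⟨t, ht, hA⟩ := h.done G hG
  refine ⟨t, ht, fun p hp => ?_⟩
  beta_reduce
  rw [if_neg (h.mem p (hA hp)).2]
  exact Term.holds_valOf h.nodup p (hA hp)

theorem init {B' : List ℕ} (hB : B ⊆ V) (hB' : B'.toFinset = B) (h : ∀ t ∈ F₀, t.Ok V k) :
    WorkInv F₀ B V k (B', [], splitFamily B' F₀, []) := by
  refine ⟨fun X' τ hX hc => covers_of_splitFamily hX fun G hG => hc G (by simpa using hG),
    fun G hG => ne_nil_of_mem_splitFamily (by simpa using hG), fun G hG t ht => ?_,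
    fun G hG => esize_le_of_mem_splitFamily (by simpa using hG), hB'.ge, hB'.le.trans hB,
    List.nodup_nil, fun p hp => by simp at hp, fun G hG => by simp at hG⟩
  obtain ⟨u, hu, rfl⟩ := exists_of_mem_splitFamily (by simpa using hG) ht
  exact (h u hu).sublist List.filter_sublist

end WorkInv

/-! ### The number of steps of the work loop -/

/-- A bound on the growth of the state when a family is split. -/
def splitBound (s : ℕ) : ℕ := s + 1 + (2 * s + 1) ^ s

/-- A bound on the state and the number of steps until all families with terms of length at most `d`
have been treated. -/
def workBound : ℕ → ℕ → ℕ
  -- At most `s` terms are picked, each of length at most `s`; there is room for `s` earlier steps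
  -- as well.
  | 0, s => s + s * s + s
  -- There are at most `s` families of degree `d + 1`. Before each of them is split, the lower
  -- degrees are exhausted; after the last split they are exhausted once more.
  | d + 1, s => workBound d ((fun s => splitBound (workBound d s))^[s] s)

theorem le_splitBound (s : ℕ) : s ≤ splitBound s := by
  unfold splitBound; omega

theorem splitBound_mono : Monotone splitBound := by
  intro a b h
  unfold splitBound
  have : (2 * a + 1) ^ a ≤ (2 * b + 1) ^ b :=
    (Nat.pow_le_pow_left (by omega) a).trans (Nat.pow_le_pow_right (by omega) h)
  omega

theorem le_iterate_of_le {f : ℕ → ℕ} (hf : ∀ s, s ≤ f s) {m n : ℕ} (h : m ≤ n) (s : ℕ) :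
    f^[m] s ≤ f^[n] s := by
  induction n, h using Nat.le_induction with
  | base => rfl
  | succ n _ ih => rw [Function.iterate_succ_apply']; exact ih.trans (hf _)

theorem le_workBound (d s : ℕ) : s ≤ workBound d s := by
  induction d generalizing s with
  | zero => simp only [workBound]; omega
  | succ d ih =>
    exact (le_iterate_of_le (f := fun s => splitBound (workBound d s))
      (fun s => (ih s).trans (le_splitBound _)) (Nat.zero_le s) s).trans (ih _)

theorem workBound_mono (d : ℕ) : Monotone (workBound d) := by
  induction d with
  | zero =>
    intro a b h
    have := Nat.mul_le_mul h h
    simp only [workBound]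
    omega
  | succ d ih =>
    intro a b h
    have hm : Monotone fun s => splitBound (workBound d s) := splitBound_mono.comp ih
    exact ih ((hm.iterate a h).trans (le_iterate_of_le
      (fun s => (le_workBound d s).trans (le_splitBound _)) h b))

/-- The number of entries of a state. -/
def stateLength (σ : WorkState) : ℕ :=
  σ.1.length + σ.2.1.length + σ.2.2.1.length + σ.2.2.2.length

/-- The maximum length of a term of the family. -/
def familyDegree (F : List Term) : ℕ := (F.map List.length).foldr max 0

theorem length_le_familyDegree {F : List Term} {t : Term} (h : t ∈ F) :
    t.length ≤ familyDegree F := by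
  unfold familyDegree
  induction F with
  | nil => simp at h
  | cons u F ih =>
    rw [List.map_cons, List.foldr_cons]
    rcases List.mem_cons.1 h with rfl | h
    · exact le_max_left _ _
    · exact (ih h).trans (le_max_right _ _)

theorem familyDegree_le {F : List Term} {d : ℕ} (h : ∀ t ∈ F, t.length ≤ d) :
    familyDegree F ≤ d := by
  unfold familyDegree
  induction F with
  | nil => simp
  | cons u F ih =>
    rw [List.map_cons, List.foldr_cons]
    exact max_le (h u List.mem_cons_self) (ih fun t ht => h t (List.mem_cons_of_mem _ ht))

/-- Every term meets `Z`, so each loses at least one literal. -/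
theorem familyDegree_splitFamily_lt {Z : List ℕ} {F G : List Term}
    (h : ∀ t ∈ F, Term.avoids Z t = false) (hG : G ∈ splitFamily Z F) :
    familyDegree G < familyDegree F := by
  obtain ⟨t, ht, -⟩ := mem_splitFamily.1 hG
  have h0 : 0 < familyDegree F :=
    (Nat.zero_le _).trans_lt ((Term.length_remove_lt (h t ht)).trans_le (length_le_familyDegree ht))
  refine (Nat.lt_iff_le_pred h0).2 (familyDegree_le fun u hu => ?_)
  obtain ⟨t, ht, rfl⟩ := exists_of_mem_splitFamily hG hu
  exact Nat.le_pred_of_lt ((Term.length_remove_lt (h t ht)).trans_le (length_le_familyDegree ht))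

/-- The number of families of degree `e`. -/
def degreeCount (e : ℕ) (σ : WorkState) : ℕ :=
  (σ.2.2.1 ++ σ.2.2.2).countP fun F => decide (familyDegree F = e)

/-- The loop is finished, or the next family has to be split and has degree more than `d`. -/
def Stuck (d : ℕ) (σ : WorkState) : Prop :=
  σ.2.2.1 = [] ∨ ∃ F rest, σ.2.2.1 = F :: rest ∧
    (∀ t ∈ F, Term.avoids (σ.1 ++ σ.2.1.map Prod.fst) t = false) ∧ d < familyDegree F

section

variable {F₀ : List Term} {B V : Finset ℕ} {k : ℕ}

/-- Each pick shortens the queue, so at most `r` picks occur before the queue is empty or a split is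
due. A family to be split is nonempty and all its terms meet `Z`, so its degree is positive. -/
theorem exists_stuck_zero (r : ℕ) (σ : WorkState) (h : WorkInv F₀ B V k σ)
    (hr : σ.2.2.1.length ≤ r) : ∃ n ≤ r,
      (∀ m ≤ n, stateLength (workStep^[m] σ) ≤ stateLength σ + r * k) ∧
      Stuck 0 (workStep^[n] σ) ∧ ∀ e, degreeCount e (workStep^[n] σ) = degreeCount e σ := by
  have hzero : Stuck 0 σ → ∃ n ≤ r,
      (∀ m ≤ n, stateLength (workStep^[m] σ) ≤ stateLength σ + r * k) ∧
      Stuck 0 (workStep^[n] σ) ∧ ∀ e, degreeCount e (workStep^[n] σ) = degreeCount e σ :=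
    fun hs => ⟨0, Nat.zero_le _, fun m hm => by simp [Nat.le_zero.1 hm], hs, fun _ => rfl⟩
  induction r generalizing σ with
  | zero => exact hzero (Or.inl (by simpa using hr))
  | succ r ih =>
    rcases workStep_cases σ with ⟨h1, -⟩ | ⟨F, rest, t, h1, ht, h2, e⟩ | ⟨F, rest, h1, h2, e⟩
    · exact hzero (Or.inl h1)
    · have hF : F ∈ σ.2.2.1 ++ σ.2.2.2 := by simp [h1]
      have hk := (h.ok F hF t ht).length_le
      have hlen : stateLength (workStep σ) ≤ stateLength σ + k := by
        rw [e]
        simp only [stateLength, h1, List.length_append, List.length_cons]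
        omega
      have hcnt : ∀ e, degreeCount e (workStep σ) = degreeCount e σ := by
        intro d
        rw [e]
        simp only [degreeCount, h1, List.countP_append, List.countP_cons]
        omega
      obtain ⟨n, hn, h3, h4, h5⟩ := ih (workStep σ) h.step (by
        rw [e]
        simp only [h1, List.length_cons] at hr
        simpa using hr) (fun hs => ⟨0, Nat.zero_le _, fun m hm => by simp [Nat.le_zero.1 hm], hs,
          fun _ => rfl⟩)
      refine ⟨n + 1, by omega, fun m hm => ?_, h4, fun d => (h5 d).trans (hcnt d)⟩
      cases m with
      | zero => simp
      | succ m =>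
        refine (h3 m (by omega)).trans ?_
        rw [Nat.succ_mul]
        omega
    · refine hzero (Or.inr ⟨F, rest, h1, h2, ?_⟩)
      obtain ⟨t, ht⟩ := List.exists_mem_of_ne_nil F (h.ne_nil F (by simp [h1]))
      exact (Nat.zero_le _).trans_lt
        ((Term.length_remove_lt (h2 t ht)).trans_le (length_le_familyDegree ht))

/-- Work below degree `d` leaves the number of families of each higher degree unchanged. The number
`c` counts earlier steps, so that the same bound controls state and time. -/
theorem exists_stuck (d : ℕ) (s c : ℕ) (σ : WorkState) (h : WorkInv F₀ B V k σ)
    (hs : stateLength σ ≤ s) (hc : c ≤ s) (hk : k ≤ s) : ∃ n, c + n ≤ workBound d s ∧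
      (∀ m ≤ n, stateLength (workStep^[m] σ) ≤ workBound d s) ∧
      Stuck d (workStep^[n] σ) ∧ ∀ e, d < e → degreeCount e (workStep^[n] σ) = degreeCount e σ := by
  induction d generalizing s c σ with
  | zero =>
    have hr : σ.2.2.1.length ≤ s := by unfold stateLength at hs; omega
    obtain ⟨n, hn, h1, h2, h3⟩ := exists_stuck_zero s σ h hr
    refine ⟨n, ?_, fun m hm => (h1 m hm).trans ?_, h2, fun e _ => h3 e⟩
    · simp only [workBound]
      omega
    · have := Nat.mul_le_mul_left s hk
      simp only [workBound]
      omega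
  | succ d ih =>
    have hinf : ∀ s, s ≤ splitBound (workBound d s) :=
      fun s => (le_workBound d s).trans (le_splitBound _)
    -- Inner induction on a bound `r` for the number of families of degree `d + 1`; each split of
    -- such a family lowers this number by one.
    suffices key : ∀ (r s c : ℕ) (σ : WorkState), WorkInv F₀ B V k σ → stateLength σ ≤ s → c ≤ s →
        k ≤ s → degreeCount (d + 1) σ ≤ r →
        ∃ n, c + n ≤ workBound d ((fun s => splitBound (workBound d s))^[r] s) ∧
          (∀ m ≤ n, stateLength (workStep^[m] σ) ≤
            workBound d ((fun s => splitBound (workBound d s))^[r] s)) ∧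
          Stuck (d + 1) (workStep^[n] σ) ∧
          ∀ e, d + 1 < e → degreeCount e (workStep^[n] σ) = degreeCount e σ by
      refine key s s c σ h hs hc hk ((List.countP_le_length).trans ?_)
      unfold stateLength at hs
      rw [List.length_append]
      omega
    intro r
    induction r with
    | zero =>
      intro s c σ h hs hc hk hr
      obtain ⟨n, hn, h1, h2, h3⟩ := ih s c σ h hs hc hk
      refine ⟨n, hn, h1, ?_, fun e he => h3 e (by omega)⟩
      rcases h2 with h2 | ⟨F, rest, h4, h5, h6⟩
      · exact Or.inl h2
      · refine Or.inr ⟨F, rest, h4, h5, lt_of_le_of_ne h6 fun he => ?_⟩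
        have h7 := h3 (d + 1) (by omega)
        have : 0 < degreeCount (d + 1) (workStep^[n] σ) :=
          List.countP_pos_iff.2 ⟨F, by simp [h4], by simp [← he]⟩
        omega
    | succ r ihr =>
      intro s c σ h hs hc hk hr
      obtain ⟨n, hn, h1, h2, h3⟩ := ih s c σ h hs hc hk
      have hle : workBound d s ≤
          workBound d ((fun s => splitBound (workBound d s))^[r + 1] s) :=
        workBound_mono d (le_iterate_of_le hinf (Nat.zero_le (r + 1)) s)
      by_cases hst : Stuck (d + 1) (workStep^[n] σ)
      · exact ⟨n, hn.trans hle, fun m hm => (h1 m hm).trans hle, hst, fun e he => h3 e (by omega)⟩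
      · have hI := h.iterate n
        set σ' := workStep^[n] σ with hσ'
        rcases h2 with h2 | ⟨F, rest, h4, h5, h6⟩
        · exact absurd (Or.inl h2) hst
        -- The state is stuck at `d` but not at `d + 1`, which pins down the degree of the next
        -- family.
        have h7 : familyDegree F = d + 1 := by
          by_contra h7
          exact hst (Or.inr ⟨F, rest, h4, h5, by omega⟩)
        have hF : F ∈ σ'.2.2.1 ++ σ'.2.2.2 := by simp [h4]
        have e : workStep σ' = (σ'.1 ++ σ'.2.1.map Prod.fst, [],
            splitFamily (σ'.1 ++ σ'.2.1.map Prod.fst) F ++ (σ'.2.2.2 ++ rest), []) := by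
          rcases workStep_cases σ' with ⟨h8, -⟩ | ⟨F', rest', t, h8, ht, h9, -⟩ | ⟨F', rest', h8, -, h9⟩
          · rw [h4] at h8; simp at h8
          · rw [h4] at h8
            obtain ⟨rfl, rfl⟩ := List.cons.inj h8
            have := h5 t ht
            rw [Term.avoids_iff.2 h9] at this
            simp at this
          · rw [h4] at h8
            obtain ⟨rfl, rfl⟩ := List.cons.inj h8
            exact h9
        have hsl : stateLength σ' ≤ workBound d s := h1 n le_rfl
        have hlen : stateLength (workStep σ') ≤ splitBound (workBound d s) := by
          have h8 := length_splitFamily_le (Z := σ'.1 ++ σ'.2.1.map Prod.fst)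
            (fun t ht => (hI.ok F hF t ht).length_le)
          have h9 : (2 * (σ'.1 ++ σ'.2.1.map Prod.fst).length + 1) ^ k ≤
              (2 * workBound d s + 1) ^ workBound d s := by
            refine (Nat.pow_le_pow_left ?_ k).trans
              (Nat.pow_le_pow_right (by omega) (hk.trans (le_workBound d s)))
            unfold stateLength at hsl
            rw [List.length_append, List.length_map]
            omega
          rw [e]
          unfold stateLength at hsl ⊢
          unfold splitBound
          simp only [h4, List.length_append, List.length_map, List.length_cons,
            List.length_nil] at hsl h8 h9 ⊢
          omega
        have hcnt : ∀ e', d + 1 ≤ e' → degreeCount e' (workStep σ') +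
            (if familyDegree F = e' then 1 else 0) = degreeCount e' σ' := by
          intro e' he'
          have : (splitFamily (σ'.1 ++ σ'.2.1.map Prod.fst) F).countP
              (fun F => decide (familyDegree F = e')) = 0 := by
            rw [List.countP_eq_zero]
            intro G hG
            have := familyDegree_splitFamily_lt h5 hG
            simp only [decide_eq_true_eq]
            omega
          rw [e]
          simp only [degreeCount, h4, List.countP_append, List.countP_cons, this,
            List.countP_nil, decide_eq_true_eq]
          omega
        obtain ⟨n', hn', k1, k2, k3⟩ := ihr (splitBound (workBound d s)) (c + n + 1) (workStep σ')
          hI.step hlen (by have := hn; unfold splitBound; omega) (hk.trans (hinf s)) (by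
            have := hcnt (d + 1) le_rfl
            rw [if_pos h7] at this
            have := h3 (d + 1) (by omega)
            omega)
        have hit : ∀ m, workStep^[m + 1 + n] σ = workStep^[m] (workStep σ') := fun m => by
          rw [Function.iterate_add_apply, Function.iterate_succ_apply]
        refine ⟨n' + 1 + n, ?_, fun m hm => ?_, by rw [hit]; exact k2, fun e' he' => ?_⟩
        · rw [Function.iterate_succ_apply]
          omega
        · by_cases hmn : m ≤ n
          · exact (h1 m hmn).trans hle
          · obtain ⟨m', rfl⟩ : ∃ m', m = m' + 1 + n := ⟨m - n - 1, by omega⟩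
            rw [hit, Function.iterate_succ_apply]
            exact k1 m' (by omega)
        · rw [hit, k3 e' he']
          have := hcnt e' (by omega)
          rw [if_neg (by omega)] at this
          exact this.trans (h3 e' (by omega))

theorem exists_finished (s : ℕ) (σ : WorkState) (h : WorkInv F₀ B V k σ)
    (hs : stateLength σ ≤ s) (hk : k ≤ s) : ∃ n ≤ workBound k s,
      (∀ m ≤ n, stateLength (workStep^[m] σ) ≤ workBound k s) ∧
      (∀ m < n, workTest (workStep^[m] σ) = true) ∧ workTest (workStep^[n] σ) = false := by
  obtain ⟨n, hn, h1, h2, -⟩ := exists_stuck k s 0 σ h hs (Nat.zero_le _) hk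
  have h3 : workTest (workStep^[n] σ) = false := by
    rcases h2 with h2 | ⟨F, rest, h4, -, h6⟩
    · simp [workTest, h2]
    -- No family has degree above `k`, so being stuck at `k` means that the queue is empty.
    · have := familyDegree_le fun t ht => ((h.iterate n).ok F (by simp [h4]) t ht).length_le
      omega
  have hex : ∃ n, workTest (workStep^[n] σ) = false := ⟨n, h3⟩
  classical
  -- The program stops at the first failure of the test, which may come before step `n`.
  have hle : Nat.find hex ≤ n := Nat.find_min' hex h3
  refine ⟨Nat.find hex, by omega, fun m hm => h1 m (hm.trans hle), fun m hm => ?_,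
    Nat.find_spec hex⟩
  simpa using Nat.find_min hex hm

end

/-! ### Computability of the bounds -/

open Nat.Partrec (Code)

theorem Nat.Partrec.Code.eval_comp_eq {cf cg : Code} {m n : ℕ} (h : cg.eval n = Part.some m) :
    (Code.comp cf cg).eval n = cf.eval m := by
  change (cg.eval n).bind cf.eval = _
  rw [h]
  exact Part.bind_some _ _

theorem Nat.Partrec.Code.eval_pair_eq {cf cg : Code} {a b n : ℕ} (ha : cf.eval n = Part.some a)
    (hb : cg.eval n = Part.some b) : (Code.pair cf cg).eval n = Part.some (Nat.pair a b) := by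
  change Nat.pair <$> cf.eval n <*> cg.eval n = _
  rw [ha, hb]
  simp [Seq.seq]

theorem Nat.Partrec.Code.eval_right_pair (a b : ℕ) :
    Code.right.eval (Nat.pair a b) = Part.some b := by
  rw [Code.eval]
  simp

/-- A code for `s ↦ g ((h ∘ g)^[s] s)`, from codes for `h` and `g`. -/
def iterateCode (ch c : Code) : Code :=
  Code.comp c (Code.comp (Code.prec Code.id (Code.comp ch (Code.comp c (Code.comp Code.right
    Code.right)))) (Code.pair Code.id Code.id))

theorem eval_iterateCode {ch c : Code} {h g : ℕ → ℕ} (hh : ∀ s, ch.eval s = Part.some (h s))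
    (hg : ∀ s, c.eval s = Part.some (g s)) (s : ℕ) :
    (iterateCode ch c).eval s = Part.some (g ((fun s => h (g s))^[s] s)) := by
  have key : ∀ a n, (Code.prec Code.id (Code.comp ch (Code.comp c (Code.comp Code.right
      Code.right)))).eval (Nat.pair a n) = Part.some ((fun s => h (g s))^[n] a) := by
    intro a n
    induction n with
    | zero => rw [Code.eval_prec_zero]; simp
    | succ n ih =>
      rw [Code.eval_prec_succ, ih, Function.iterate_succ_apply']
      refine (Part.bind_some _ _).trans ?_
      rw [Code.eval_comp_eq (m := g ((fun s => h (g s))^[n] a)), hh]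
      rw [Code.eval_comp_eq (m := (fun s => h (g s))^[n] a), hg]
      rw [Code.eval_comp_eq (Code.eval_right_pair _ _), Code.eval_right_pair]
  rw [iterateCode, Code.eval_comp_eq (m := (fun s => h (g s))^[s] s), hg]
  rw [Code.eval_comp_eq (Code.eval_pair_eq (Code.eval_id s) (Code.eval_id s)), key]

theorem primrec₂_pow : Primrec₂ (fun a b : ℕ => a ^ b) := by
  refine (Primrec.nat_rec (f := fun _ : ℕ => 1) (g := fun a p => p.2 * a) (Primrec.const 1)
    (Primrec.nat_mul.comp (Primrec.snd.comp Primrec.snd) Primrec.fst)).of_eq fun a b => ?_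
  induction b with
  | zero => rfl
  | succ b ih => rw [pow_succ, ← ih]

theorem computable_splitBound : Computable splitBound := by
  have h2 : Primrec fun s : ℕ => 2 * s + 1 :=
    Primrec.succ.comp (Primrec.nat_mul.comp (Primrec.const 2) Primrec.id)
  exact (Primrec.nat_add.comp Primrec.succ (primrec₂_pow.comp h2 Primrec.id)).to_comp

/-- The recursion on `d` transforms a whole function of `s`, so primitive recursion on numbers does
not apply directly. Instead a code for `workBound d` is computed primitive recursively from `d` and
then run by the universal function. -/
theorem computable₂_workBound : Computable₂ workBound := by
  have h0 : Computable (workBound 0) := by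
    exact (Primrec.nat_add.comp (Primrec.nat_add.comp Primrec.id
      (Primrec.nat_mul.comp Primrec.id Primrec.id)) Primrec.id).to_comp
  obtain ⟨c₀, hc₀⟩ := Code.exists_code.1 (Partrec.nat_iff.1 h0)
  obtain ⟨ch, hch⟩ := Code.exists_code.1 (Partrec.nat_iff.1 computable_splitBound)
  let code : ℕ → Code := fun d => Nat.rec c₀ (fun _ c => iterateCode ch c) d
  have hcode : Primrec code := by
    refine Primrec.nat_rec₁ _ ?_
    have hr : Primrec fun c : Code => iterateCode ch c := by
      have k : ∀ d : Code, Primrec fun _ : Code => d := fun d => Primrec.const d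
      exact Code.primrec₂_comp.comp Primrec.id (Code.primrec₂_comp.comp
        (Code.primrec₂_prec.comp (k _) (Code.primrec₂_comp.comp (k ch)
          (Code.primrec₂_comp.comp Primrec.id (k _)))) (k _))
    exact hr.comp Primrec.snd
  have heval : ∀ d s, (code d).eval s = Part.some (workBound d s) := by
    intro d
    induction d with
    | zero => intro s; rw [show code 0 = c₀ from rfl, hc₀]; rfl
    | succ d ih => exact eval_iterateCode (fun s => by rw [hch]; rfl) ih
  exact Partrec.of_eq_tot (f := fun p : ℕ × ℕ => (code p.1).eval p.2)
    (Code.eval_part.comp (hcode.to_comp.comp Computable.fst) Computable.snd)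
    fun p => by rw [heval]; exact Part.mem_some _

theorem computable_sum {f : ℕ → ℕ} (hf : Computable f) :
    Computable fun n => ∑ i ∈ Finset.range n, f i := by
  refine (Computable.nat_rec (f := fun n : ℕ => n) (g := fun _ => 0)
    (h := fun (_ : ℕ) (p : ℕ × ℕ) => p.2 + f p.1) Computable.id (Computable.const 0) ?_).of_eq
      fun n => ?_
  · exact Primrec.nat_add.to_comp.comp (Computable.snd.comp Computable.snd)
      (hf.comp (Computable.fst.comp Computable.snd))
  · induction n with
    | zero => rfl
    | succ n ih => rw [Finset.sum_range_succ, ← ih]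

/-! ### Fixed-parameter running times -/

/-- The function `g` is at most `G (κ i) * (N i + 1) ^ c` on all `i` in `P`, where `G` is a
computable monotone function. -/
def FptBdd {ι : Type} (P : ι → Prop) (κ N g : ι → ℕ) : Prop :=
  ∃ (G : ℕ → ℕ) (c : ℕ), Computable G ∧ Monotone G ∧ ∀ i, P i → g i ≤ G (κ i) * (N i + 1) ^ c

namespace FptBdd

variable {ι : Type} {P : ι → Prop} {κ N f g : ι → ℕ}

theorem mono (hg : FptBdd P κ N g) (h : ∀ i, P i → f i ≤ g i) : FptBdd P κ N f := by
  obtain ⟨G, c, h1, h2, h3⟩ := hg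
  exact ⟨G, c, h1, h2, fun i hi => (h i hi).trans (h3 i hi)⟩

theorem param {G : ℕ → ℕ} (hG : Computable G) (hm : Monotone G) :
    FptBdd P κ N (fun i => G (κ i)) :=
  ⟨G, 0, hG, hm, fun i _ => by simp⟩

theorem const (n : ℕ) : FptBdd P κ N (fun _ => n) :=
  param (G := fun _ => n) (Computable.const n) monotone_const

theorem kappa : FptBdd P κ N κ := param (G := fun k => k) Computable.id monotone_id

theorem size : FptBdd P κ N N :=
  ⟨fun _ => 1, 1, Computable.const 1, monotone_const, fun i _ => by simp⟩

theorem add (hf : FptBdd P κ N f) (hg : FptBdd P κ N g) : FptBdd P κ N (fun i => f i + g i) := by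
  obtain ⟨F, c, h1, h2, h3⟩ := hf
  obtain ⟨G, d, k1, k2, k3⟩ := hg
  refine ⟨fun k => F k + G k, c + d, Primrec.nat_add.to_comp.comp h1 k1, h2.add k2, fun i hi => ?_⟩
  rw [add_mul]
  exact Nat.add_le_add
    ((h3 i hi).trans (Nat.mul_le_mul_left _ (Nat.pow_le_pow_right (by omega) (by omega))))
    ((k3 i hi).trans (Nat.mul_le_mul_left _ (Nat.pow_le_pow_right (by omega) (by omega))))

theorem mul (hf : FptBdd P κ N f) (hg : FptBdd P κ N g) : FptBdd P κ N (fun i => f i * g i) := by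
  obtain ⟨F, c, h1, h2, h3⟩ := hf
  obtain ⟨G, d, k1, k2, k3⟩ := hg
  refine ⟨fun k => F k * G k, c + d, Primrec.nat_mul.to_comp.comp h1 k1, fun a b h =>
    Nat.mul_le_mul (h2 h) (k2 h), fun i hi => ?_⟩
  calc f i * g i ≤ (F (κ i) * (N i + 1) ^ c) * (G (κ i) * (N i + 1) ^ d) :=
        Nat.mul_le_mul (h3 i hi) (k3 i hi)
    _ = _ := by rw [pow_add]; ring

theorem pow (hf : FptBdd P κ N f) (n : ℕ) : FptBdd P κ N (fun i => f i ^ n) := by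
  induction n with
  | zero => simpa using const 1
  | succ n ih => simpa only [pow_succ] using ih.mul hf

theorem poly {α : Type} [Enc α] {g : α → ℕ} (hg : PolyBdd g) {u : ι → α}
    (hu : FptBdd P κ N fun i => esize (u i)) : FptBdd P κ N (fun i => g (u i)) := by
  obtain ⟨c, hc⟩ := hg
  exact ((hu.add (const 1)).pow c).mono fun i _ => hc (u i)

/-- Change of parameter and size. -/
theorem trans {ι' : Type} {P' : ι' → Prop} {κ' N' g : ι' → ℕ} (hg : FptBdd P' κ' N' g) {j : ι → ι'}
    (hP : ∀ i, P i → P' (j i)) {H : ℕ → ℕ} (hH : Computable H) (hm : Monotone H)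
    (hκ : ∀ i, P i → κ' (j i) ≤ H (κ i)) (hN : FptBdd P κ N fun i => N' (j i)) :
    FptBdd P κ N (fun i => g (j i)) := by
  obtain ⟨G, c, h1, h2, h3⟩ := hg
  refine ((param (G := fun k => G (H k)) (h1.comp hH) (h2.comp hm)).mul
    ((hN.add (const 1)).pow c)).mono fun i hi => ?_
  exact (h3 _ (hP i hi)).trans (Nat.mul_le_mul_right _ (h2 (hκ i hi)))

end FptBdd

section

variable {ι : Type} {α β γ : Type} [Enc α] [Enc β] [Enc γ]

/-- A single program computes `v i` from `u i` in fixed-parameter time, for all `i` in `P`. -/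
def FptRuns (P : ι → Prop) (κ N : ι → ℕ) (u : ι → α) (v : ι → β) : Prop :=
  (∃ (p : Prog) (T : ι → ℕ), FptBdd P κ N T ∧ ∀ i, P i → p.Runs (enc (u i)) (enc (v i)) (T i)) ∧
    FptBdd P κ N fun i => esize (v i)

namespace FptRuns

variable {P : ι → Prop} {κ N : ι → ℕ} {u : ι → α} {v : ι → β} {w : ι → γ}

theorem of_polyTime {f : α → β} (hf : PolyTime f) (hu : FptBdd P κ N fun i => esize (u i)) :
    FptRuns P κ N u (fun i => f (u i)) := by
  obtain ⟨⟨p, T, hT, hp⟩, hs⟩ := hf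
  exact ⟨⟨p, _, .poly hT hu, fun i _ => hp (u i)⟩, .poly hs hu⟩

theorem trans (h : FptRuns P κ N u v) (h' : FptRuns P κ N v w) : FptRuns P κ N u w := by
  obtain ⟨⟨p, T, hT, hp⟩, -⟩ := h
  obtain ⟨⟨q, U, hU, hq⟩, hs⟩ := h'
  exact ⟨⟨p.seq q, _, hT.add hU, fun i hi => (hp i hi).seq (hq i hi)⟩, hs⟩

theorem pair (h : FptRuns P κ N u v) (h' : FptRuns P κ N u w) :
    FptRuns P κ N u (fun i => (v i, w i)) := by
  obtain ⟨⟨p, T, hT, hp⟩, hs⟩ := h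
  obtain ⟨⟨q, U, hU, hq⟩, hs'⟩ := h'
  exact ⟨⟨p.pairing q, _, (hT.add hU).add (.const 8), fun i hi => (hp i hi).pairing (hq i hi)⟩,
    (hs.add hs').add (.const 1)⟩

theorem comp {f : β → γ} (hf : PolyTime f) (h : FptRuns P κ N u v) :
    FptRuns P κ N u (fun i => f (v i)) :=
  h.trans (of_polyTime hf h.2)

theorem id (hu : FptBdd P κ N fun i => esize (u i)) : FptRuns P κ N u u :=
  of_polyTime PolyTime.id hu

/-- In contrast to `PolyTime.foldl`, the accumulator may be large in terms of the parameter. -/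
theorem fold {c : ι → γ} {l : ι → List α} {b : ι → List α → β} {p : Prog} {T : ι → ℕ}
    (hT : FptBdd P κ N T)
    (hp : ∀ i, P i → ∀ l₁ a l₂, l i = l₁ ++ a :: l₂ →
      p.Runs (enc (c i, (b i l₁, a))) (enc (b i (l₁ ++ [a]))) (T i))
    (hl : FptBdd P κ N fun i => (l i).length) (hb : FptBdd P κ N fun i => esize (b i (l i))) :
    FptRuns P κ N (fun i => (c i, (b i [], l i))) (fun i => b i (l i)) :=
  ⟨⟨p.fold, _, (hl.add (.const 1)).mul (hT.add (.const 22)), fun i hi =>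
    Prog.Runs.fold enc (enc (c i)) (fun l₁ => enc (b i l₁)) (l i) (T i) (hp i hi)⟩, hb⟩

theorem iterate {step : α → α} {test : α → Bool} (hs : PolyTime step) (ht : PolyTime test)
    {n S : ι → ℕ} (hn : FptBdd P κ N n) (hS : FptBdd P κ N S)
    (h1 : ∀ i, P i → ∀ m < n i, test (step^[m] (u i)) = true)
    (h2 : ∀ i, P i → test (step^[n i] (u i)) = false)
    (h3 : ∀ i, P i → ∀ m ≤ n i, esize (step^[m] (u i)) ≤ S i) :
    FptRuns P κ N u (fun i => step^[n i] (u i)) := by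
  obtain ⟨p, c, hp⟩ := PolyTime.runs_while hs ht
  exact ⟨⟨p, _, (hn.add (.const 1)).mul (((FptBdd.const 2).mul ((hS.add (.const 1)).pow c)).add
    (.const 6)), fun i hi => hp (u i) (n i) (S i) (h1 i hi) (h2 i hi) (h3 i hi)⟩,
    hS.mono fun i hi => h3 i hi _ le_rfl⟩

end FptRuns

end

/-! ### The falsifying terms in fixed-parameter time -/

theorem esize_term_le {t : Term} {m : ℕ} (h : ∀ p ∈ t, esize p.1 ≤ m) :
    esize t ≤ t.length * (m + 5) + 1 :=
  esize_le_of_forall (m := m + 4) fun p hp => by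
    have h1 := h p hp
    have h2 := esize_bool p.2
    have h3 : esize p = esize p.1 + esize p.2 + 1 := rfl
    omega

theorem esize_allTerms_le {l : List ℕ} {m : ℕ} (h : ∀ v ∈ l, esize v ≤ m) :
    esize (allTerms l) ≤ 2 ^ l.length * (l.length * (m + 5) + 2) + 1 := by
  rw [← length_allTerms]
  refine esize_le_of_forall (m := l.length * (m + 5) + 1) fun t ht => ?_
  have hk := mem_allTerms.1 ht
  have hl : t.length = l.length := by rw [← List.length_map Prod.fst, hk, List.length_reverse]
  rw [← hl]
  refine esize_term_le fun p hp => h _ ?_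
  rw [← List.mem_reverse, ← hk]
  exact List.mem_map_of_mem hp

theorem computable_two_pow : Computable fun n : ℕ => 2 ^ n :=
  (primrec₂_pow.comp (Primrec.const 2) Primrec.id).to_comp

theorem two_pow_mono : Monotone fun n : ℕ => 2 ^ n :=
  fun _ _ h => Nat.pow_le_pow_right (by omega) h

theorem fptRuns_falsifyingTerms :
    FptRuns (fun _ => True) (fun c : Constraint => c.vars.card) esize (fun c => c)
      Constraint.falsifyingTerms := by
  have hv : PolyTime fun c : Constraint => c.varList.dedup :=
    PolyTime.dedup Constraint.polyTime_varList
  -- The Boolean is a dummy context, present because folds pass data of the form `(c, (b, a))`.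
  let f : Bool × (List Term × ℕ) → List Term := fun y =>
    y.2.1.map (fun t => (y.2.2, false) :: t) ++ y.2.1.map (fun t => (y.2.2, true) :: t)
  have hcons : ∀ b : Bool, PolyTime fun y : Bool × (List Term × ℕ) =>
      y.2.1.map fun t => (y.2.2, b) :: t := fun b =>
    PolyTime.map (f := fun z : (Bool × (List Term × ℕ)) × Term => (z.1.2.2, b) :: z.2)
      (((PolyTime.snd.comp (PolyTime.snd.comp PolyTime.fst)).pair (PolyTime.const b)).cons
        PolyTime.snd) (PolyTime.fst.comp PolyTime.snd)
  have hf : PolyTime f := (hcons false).append (hcons true)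
  obtain ⟨⟨p, T, ⟨e, he⟩, hp⟩, -⟩ := hf
  have hN : FptBdd (fun _ => True) (fun c : Constraint => c.vars.card) esize
      fun c => esize c := FptBdd.size
  have hdl : FptBdd (fun _ => True) (fun c : Constraint => c.vars.card) esize
      fun c => c.varList.dedup.length :=
    FptBdd.kappa.mono fun c _ => (c.length_dedup_varList).le
  have hm : FptBdd (fun _ => True) (fun c : Constraint => c.vars.card) esize
      fun c => esize c.varList.dedup := FptBdd.poly hv.2 hN
  -- There are `2 ^ r` assignments of `r` variables, each a list of `r` pairs.
  let S : Constraint → ℕ := fun c =>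
    2 ^ c.vars.card * (c.vars.card * (esize c.varList.dedup + 5) + 2) + 1
  have hS : FptBdd (fun _ => True) (fun c : Constraint => c.vars.card) esize S :=
    ((FptBdd.param computable_two_pow two_pow_mono).mul
      ((FptBdd.kappa.mul (hm.add (.const 5))).add (.const 2))).add (.const 1)
  have hle : ∀ (c : Constraint) (l₁ : List ℕ), l₁ <+: c.varList.dedup →
      esize (allTerms l₁) ≤ S c := by
    intro c l₁ h
    refine (esize_allTerms_le (m := esize c.varList.dedup) fun v hv =>
      (esize_lt_of_mem (h.mem hv)).le).trans ?_
    have : l₁.length ≤ c.vars.card := h.length_le.trans c.length_dedup_varList.le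
    have h2 : 2 ^ l₁.length ≤ 2 ^ c.vars.card := Nat.pow_le_pow_right (by omega) this
    exact Nat.add_le_add_right (Nat.mul_le_mul h2
      (Nat.add_le_add_right (Nat.mul_le_mul_right _ this) _)) _
  have h1 : FptRuns (fun _ => True) (fun c : Constraint => c.vars.card) esize
      (fun c => (true, (allTerms [], c.varList.dedup))) (fun c => allTerms c.varList.dedup) := by
    refine FptRuns.fold (p := p) (T := fun c => (3 + (S c + esize c.varList.dedup + 1) + 1 + 1) ^ e)
      (c := fun _ => true) (l := fun c => c.varList.dedup) (b := fun _ l => allTerms l)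
      (((((FptBdd.const 3).add ((hS.add hm).add (.const 1))).add (.const 1)).add (.const 1)).pow e)
      (fun c _ l₁ a l₂ h => ?_) hdl (hS.mono fun c _ => hle c _ (List.prefix_refl _))
    have e1 : allTerms (l₁ ++ [a]) = f (true, (allTerms l₁, a)) := by
      rw [allTerms, List.foldl_append]
      rfl
    rw [e1]
    refine (hp (true, (allTerms l₁, a))).mono ((he _).trans (Nat.pow_le_pow_left ?_ e))
    have h2 := hle c l₁ ⟨_, h.symm⟩
    have h3 : esize a < esize c.varList.dedup := esize_lt_of_mem (by simp [h])
    have h4 := esize_bool true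
    simp only [esize_pair]
    omega
  have h2 : FptRuns (fun _ => True) (fun c : Constraint => c.vars.card) esize
      (fun c => c) (fun c => (true, (allTerms [], c.varList.dedup))) :=
    FptRuns.of_polyTime ((PolyTime.const true).pair ((PolyTime.const (allTerms [])).pair hv)) hN
  have h3 := (FptRuns.id hN).pair (h2.trans h1)
  exact FptRuns.comp (f := fun y : Constraint × List Term => y.2.filter y.1.falsifiedBy)
    (PolyTime.filter (p := fun z : (Constraint × List Term) × Term => z.1.1.falsifiedBy z.2)
      (Constraint.polyTime_falsifiedBy (PolyTime.fst.comp PolyTime.fst) PolyTime.snd)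
      PolyTime.snd) h3

theorem esize_flatMap_le {α β : Type} [Enc β] {l : List α} {f : α → List β} {q : ℕ}
    (h : ∀ a ∈ l, esize (f a) ≤ q) : esize (l.flatMap f) ≤ l.length * q + 1 := by
  induction l with
  | nil => simp
  | cons a l ih =>
    have h1 := ih fun b hb => h b (List.mem_cons_of_mem _ hb)
    have h2 := h a List.mem_cons_self
    have h3 := esize_append (f a) (l.flatMap f)
    rw [List.flatMap_cons, List.length_cons, Nat.succ_mul]
    omega

theorem FptRuns.reindex {ι ι' : Type} {α β : Type} [Enc α] [Enc β] {P : ι → Prop} {κ N : ι → ℕ}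
    {P' : ι' → Prop} {κ' N' : ι' → ℕ} {u : ι' → α} {v : ι' → β} (h : FptRuns P' κ' N' u v)
    {j : ι → ι'} (hP : ∀ i, P i → P' (j i)) {H : ℕ → ℕ} (hH : Computable H) (hm : Monotone H)
    (hκ : ∀ i, P i → κ' (j i) ≤ H (κ i)) (hN : FptBdd P κ N fun i => N' (j i)) :
    FptRuns P κ N (fun i => u (j i)) (fun i => v (j i)) := by
  obtain ⟨⟨p, T, hT, hp⟩, hs⟩ := h
  exact ⟨⟨p, fun i => T (j i), hT.trans hP hH hm hκ hN, fun i hi => hp _ (hP i hi)⟩,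
    hs.trans hP hH hm hκ hN⟩

/-- Listing falsifying terms is exponential in the number of variables of a constraint; `hκ` bounds
this number by the parameter, uniformly over the list. -/
theorem fptRuns_flatMap_falsifyingTerms {ι : Type} {P : ι → Prop} {κ N : ι → ℕ}
    {M : ι → List Constraint} (hM : FptBdd P κ N fun i => esize (M i))
    (hκ : ∀ i, P i → ∀ c ∈ M i, c.vars.card ≤ κ i) :
    FptRuns P κ N M (fun i => (M i).flatMap Constraint.falsifyingTerms) := by
  let A := List Term × Constraint
  have h1 : FptRuns (fun _ => True) (fun x : A => x.2.vars.card) (fun x : A => esize x)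
      (fun x : A => (true, x)) (fun x => x.1 ++ x.2.falsifyingTerms) := by
    have hN : FptBdd (fun _ => True) (fun x : A => x.2.vars.card) (fun x : A => esize x)
      fun x => esize x := FptBdd.size
    have hN' : FptBdd (fun _ => True) (fun x : A => x.2.vars.card) (fun x : A => esize x)
      fun x => esize (true, x) := ((FptBdd.const 3).add hN).add (.const 1)
    have hb : FptRuns (fun _ => True) (fun x : A => x.2.vars.card) (fun x : A => esize x)
        (fun x : A => (true, x)) (fun x => x) :=
      FptRuns.of_polyTime (f := fun y : Bool × A => y.2) PolyTime.snd hN'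
    have hc : FptRuns (fun _ => True) (fun x : A => x.2.vars.card) (fun x : A => esize x)
        (fun x : A => x.2) (fun x => x.2.falsifyingTerms) :=
      fptRuns_falsifyingTerms.reindex (j := fun x : A => x.2) (fun _ _ => trivial)
        (H := fun k => k) Computable.id monotone_id (fun _ _ => le_rfl)
        (FptBdd.poly PolyTime.snd.2 hN)
    have hd := (hb.comp (f := fun x : A => x.1) PolyTime.fst).pair
      ((hb.comp (f := fun x : A => x.2) PolyTime.snd).trans hc)
    exact hd.comp (f := fun y : List Term × List Term => y.1 ++ y.2)
      (PolyTime.append PolyTime.fst PolyTime.snd)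
  obtain ⟨⟨p, T, ⟨G, e, hG, hGm, hT⟩, hp⟩, -⟩ := h1
  obtain ⟨-, G', e', hG', hGm', hs⟩ := fptRuns_falsifyingTerms
  let q : ι → ℕ := fun i => G' (κ i) * (esize (M i) + 1) ^ e'
  have hq : FptBdd P κ N q := (FptBdd.param hG' hGm').mul ((hM.add (.const 1)).pow e')
  have hl : FptBdd P κ N fun i => (M i).length := hM.mono fun i _ => (length_lt_esize _).le
  have hle : ∀ i, P i → ∀ l₁, l₁ <+: M i →
      esize (l₁.flatMap Constraint.falsifyingTerms) ≤ (M i).length * q i + 1 := by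
    intro i hi l₁ h
    refine (esize_flatMap_le (q := q i) fun c hc => (hs c trivial).trans ?_).trans
      (Nat.succ_le_succ (Nat.mul_le_mul_right _ h.length_le))
    have := esize_lt_of_mem (h.mem hc)
    exact Nat.mul_le_mul (hGm' (hκ i hi c (h.mem hc))) (Nat.pow_le_pow_left (by omega) e')
  have h2 : FptRuns P κ N (fun i => (true, ([].flatMap Constraint.falsifyingTerms, M i)))
      (fun i => (M i).flatMap Constraint.falsifyingTerms) := by
    refine FptRuns.fold (p := p) (T := fun i =>
        G (κ i) * (((M i).length * q i + 1) + esize (M i) + 1 + 1) ^ e) (c := fun _ => true)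
      (l := M) (b := fun _ l => l.flatMap Constraint.falsifyingTerms)
      ((FptBdd.param hG hGm).mul ((((((hl.mul hq).add (.const 1)).add hM).add (.const 1)).add
        (.const 1)).pow e)) (fun i hi l₁ a l₂ h => ?_) hl
      (((hl.mul hq).add (.const 1)).mono fun i hi => hle i hi _ (List.prefix_refl _))
    have hmem : a ∈ M i := by simp [h]
    have e1 : (l₁ ++ [a]).flatMap Constraint.falsifyingTerms =
        l₁.flatMap Constraint.falsifyingTerms ++ a.falsifyingTerms := by simp
    rw [e1]
    refine (hp (l₁.flatMap Constraint.falsifyingTerms, a) trivial).mono ((hT _ trivial).trans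
      (Nat.mul_le_mul (hGm (hκ i hi a hmem)) (Nat.pow_le_pow_left ?_ e)))
    have h3 := hle i hi l₁ ⟨_, h.symm⟩
    have h4 := esize_lt_of_mem hmem
    have h5 : esize ((l₁.flatMap Constraint.falsifyingTerms, a) : List Term × Constraint) =
        esize (l₁.flatMap Constraint.falsifyingTerms) + esize a + 1 := esize_pair _ _
    exact (Nat.add_le_add_right h5.le 1).trans (by omega)
  exact (FptRuns.of_polyTime (f := fun l : List Constraint => (true, (([] : List Term), l)))
    ((PolyTime.const true).pair ((PolyTime.const []).pair PolyTime.id)) hM).trans h2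

/-! ### The reduction -/

/-- The parts of an instance. -/
abbrev RawInstance := (List (Quant × ℕ) × List Constraint) × List ℕ

/-- An instance without the proofs. -/
def rawInstance (I : QBF × List ℕ) : RawInstance := ((I.1.prefx, I.1.matrix), I.2)

/-- The encoding ignores the proofs carried by a formula, so programs can be analysed on raw data.
-/
theorem enc_rawInstance (I : QBF × List ℕ) : enc (rawInstance I) = Data.ofInstance I := rfl

theorem esize_rawInstance (I : QBF × List ℕ) : esize (rawInstance I) = (Data.ofInstance I).size :=
  rfl

/-- The parameter: the size of the backdoor plus the number of variables of the universal part in a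
constraint. -/
noncomputable def enhancedParam (I : QBF × List ℕ) : ℕ :=
  I.2.toFinset.card + I.1.maxOcc (I.1.universalPart I.2.toFinset)

/-- The list of variables in the universal part of an instance. -/
def universalOf (x : RawInstance) : List ℕ := universalList x.1.1 x.1.2 x.2

/-- The terms that falsify a constraint with a variable in the universal part. -/
def termsOf (x : RawInstance) : List Term :=
  (touching (universalOf x) x.1.2).flatMap Constraint.falsifyingTerms

/-- The initial state of the work loop. -/
def initState (B : List ℕ) (F : List Term) : WorkState := (B.dedup, [], splitFamily B.dedup F, [])

/-- The result of the reduction, when the work loop ends in the state `σ`. -/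
def outputOf (x : RawInstance) (σ : WorkState) : RawInstance :=
  let Y := (universalOf x).filter fun v => !decide (v ∈ σ.1)
  ((x.1.1.filter fun p => !decide (p.2 ∈ Y), x.1.2.flatMap (Constraint.assignList Y σ.2.1)), σ.1)

theorem polyTime_universalOf : PolyTime universalOf :=
  polyTime_universalList (PolyTime.fst.comp PolyTime.fst) (PolyTime.snd.comp PolyTime.fst)
    PolyTime.snd

theorem polyTime_initState : PolyTime fun y : RawInstance × List Term => initState y.1.2 y.2 := by
  have hB : PolyTime fun y : RawInstance × List Term => y.1.2.dedup :=
    PolyTime.dedup (PolyTime.snd.comp PolyTime.fst)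
  exact hB.pair ((PolyTime.const []).pair ((polyTime_splitFamily hB PolyTime.snd).pair
    (PolyTime.const [])))

theorem polyTime_outputOf : PolyTime fun y : RawInstance × WorkState => outputOf y.1 y.2 := by
  have hY : PolyTime fun y : RawInstance × WorkState =>
      (universalOf y.1).filter fun v => !decide (v ∈ y.2.1) :=
    PolyTime.filter (p := fun z : (RawInstance × WorkState) × ℕ => !decide (z.2 ∈ z.1.2.1))
      (polyTime_notMem PolyTime.snd (PolyTime.fst.comp (PolyTime.snd.comp PolyTime.fst)))
      (polyTime_universalOf.comp PolyTime.fst)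
  refine PolyTime.pair (PolyTime.pair (PolyTime.filter
    (p := fun z : (RawInstance × WorkState) × (Quant × ℕ) => !decide (z.2.2 ∈
      (universalOf z.1.1).filter fun v => !decide (v ∈ z.1.2.1)))
    (polyTime_notMem (PolyTime.snd.comp PolyTime.snd) (hY.comp PolyTime.fst))
    (PolyTime.fst.comp (PolyTime.fst.comp PolyTime.fst))) (PolyTime.flatMap
      (f := fun z : (RawInstance × WorkState) × Constraint => z.2.assignList
        ((universalOf z.1.1).filter fun v => !decide (v ∈ z.1.2.1)) z.1.2.2.1)
    (Constraint.polyTime_assignList (hY.comp PolyTime.fst)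
      (PolyTime.fst.comp (PolyTime.snd.comp (PolyTime.snd.comp PolyTime.fst))) PolyTime.snd)
    (PolyTime.snd.comp (PolyTime.fst.comp PolyTime.fst))))
    (PolyTime.fst.comp PolyTime.snd)

/-- The bound on the number of kept variables. -/
def keepBound (k : ℕ) : ℕ := workBound k (splitBound k)

theorem computable_keepBound : Computable keepBound :=
  computable₂_workBound.comp Computable.id computable_splitBound

theorem workBound_mono_left (s : ℕ) : Monotone fun d => workBound d s :=
  monotone_nat_of_le_succ fun d => workBound_mono d (le_iterate_of_le
    (fun s => (le_workBound d s).trans (le_splitBound _)) (Nat.zero_le s) s)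

theorem keepBound_mono : Monotone keepBound := fun _ _ h =>
  (workBound_mono _ (splitBound_mono h)).trans (workBound_mono_left _ h)

/-! ### Correctness of the reduction -/

section

variable {I : QBF × List ℕ}

theorem mem_touching {U : List ℕ} {M : List Constraint} {c : Constraint} :
    c ∈ touching U M ↔ c ∈ M ∧ ∃ v ∈ c.vars, v ∈ U := by
  simp [touching, Constraint.mem_varList]

theorem mem_universalOf {v : ℕ} : v ∈ universalOf (rawInstance I) ↔
    v ∈ I.1.universalPart I.2.toFinset := by
  rw [← QBF.toFinset_universalList, List.mem_toFinset]
  rfl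

theorem card_vars_le_of_mem_touching {c : Constraint}
    (h : c ∈ touching (universalOf (rawInstance I)) I.1.matrix) :
    c.vars.card ≤ enhancedParam I := by
  obtain ⟨hc, v, hv, hU⟩ := mem_touching.1 h
  exact QBF.card_vars_le hc hv (mem_universalOf.1 hU)

theorem ok_of_mem_termsOf {t : Term} (h : t ∈ termsOf (rawInstance I)) :
    t.Ok (I.2.toFinset ∪ I.1.universalPart I.2.toFinset) (enhancedParam I) := by
  obtain ⟨c, hc, ht⟩ := List.mem_flatMap.1 h
  obtain ⟨hcM, v, hv, hU⟩ := mem_touching.1 hc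
  refine ⟨(Constraint.length_of_mem_falsifyingTerms ht).le.trans (card_vars_le_of_mem_touching hc),
    Constraint.nodup_of_mem_falsifyingTerms ht, fun p hp => ?_⟩
  refine QBF.vars_subset_of_touches hcM hv (mem_universalOf.1 hU) ?_
  rw [← Constraint.toFinset_keys_of_mem_falsifyingTerms ht, List.mem_toFinset]
  exact List.mem_map_of_mem hp

theorem workInv_initState : WorkInv (termsOf (rawInstance I)) I.2.toFinset
    (I.2.toFinset ∪ I.1.universalPart I.2.toFinset) (enhancedParam I)
    (initState I.2 (termsOf (rawInstance I))) :=
  WorkInv.init Finset.subset_union_left (by ext v; simp) fun _ => ok_of_mem_termsOf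

theorem stateLength_initState_le :
    stateLength (initState I.2 (termsOf (rawInstance I))) ≤ splitBound (enhancedParam I) := by
  have h1 : I.2.dedup.length ≤ enhancedParam I := by
    rw [← List.card_toFinset]
    exact Nat.le_add_right _ _
  have h2 := length_splitFamily_le (Z := I.2.dedup) (k := enhancedParam I)
    fun t ht => (ok_of_mem_termsOf (I := I) ht).length_le
  have h3 : (2 * I.2.dedup.length + 1) ^ enhancedParam I ≤
      (2 * enhancedParam I + 1) ^ enhancedParam I := Nat.pow_le_pow_left (by omega) _
  simp only [stateLength, initState, splitBound, List.length_nil]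
  omega

theorem esize_le_of_mem_vars {v : ℕ} (h : v ∈ I.1.vars) : esize v ≤ (Data.ofInstance I).size := by
  obtain ⟨⟨q, w⟩, hp, rfl⟩ := List.mem_map.1 (List.mem_toFinset.1 h)
  have h1 := esize_lt_of_mem hp
  rw [← esize_rawInstance, rawInstance, esize_pair, esize_pair]
  simp only [esize_pair] at h1 ⊢
  omega

/-- The number of entries is bounded by the parameter, and each entry is a variable, a literal or a
family no larger than `F₀`. -/
theorem esize_state_le {F₀ : List Term} {B : Finset ℕ} {V : Finset ℕ} {k m W : ℕ} {σ : WorkState}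
    (h : WorkInv F₀ B V k σ) (hV : ∀ v ∈ V, esize v ≤ m) (hW : stateLength σ ≤ W) :
    esize σ ≤ 4 * (W * (esize F₀ + m + 5) + 1) + 3 := by
  obtain ⟨X, A, todo, done⟩ := σ
  simp only [stateLength] at hW
  have key : ∀ {n q : ℕ}, n ≤ W → q ≤ esize F₀ + m + 5 →
      n * q + 1 ≤ W * (esize F₀ + m + 5) + 1 :=
    fun h1 h2 => Nat.succ_le_succ (Nat.mul_le_mul h1 h2)
  have h1 : esize X ≤ X.length * (m + 1) + 1 :=
    esize_le_of_forall fun v hv => hV v (h.subset (List.mem_toFinset.2 hv))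
  have h2 : esize A ≤ A.length * (m + 5) + 1 := esize_term_le fun p hp => hV _ (h.mem p hp).1
  have h3 : esize todo ≤ todo.length * (esize F₀ + 1) + 1 :=
    esize_le_of_forall fun G hG => h.esize_le G (List.mem_append_left _ hG)
  have h4 : esize done ≤ done.length * (esize F₀ + 1) + 1 :=
    esize_le_of_forall fun G hG => h.esize_le G (List.mem_append_right _ hG)
  have k1 := h1.trans (key (by omega) (by omega))
  have k2 := h2.trans (key (by omega) (by omega))
  have k3 := h3.trans (key (by omega) (by omega))
  have k4 := h4.trans (key (by omega) (by omega))
  simp only [esize_pair]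
  omega

/-- The result of the reduction as a formula with a list of variables. -/
def reducedInstance (I : QBF × List ℕ) (σ : WorkState) : QBF × List ℕ :=
  (I.1.assign ((universalOf (rawInstance I)).filter fun v => !decide (v ∈ σ.1)).toFinset
    (valOf σ.2.1), σ.1)

theorem rawInstance_reducedInstance (σ : WorkState) :
    rawInstance (reducedInstance I σ) = outputOf (rawInstance I) σ := by
  simp only [rawInstance, reducedInstance, outputOf, QBF.assign, List.filterMap_eq_flatMap_toList,
    Prod.mk.injEq, and_true, ← Constraint.assignList_eq]
  refine List.filter_congr fun p _ => ?_
  simp only [List.mem_toFinset, decide_not]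
  congr

/-- Domination is `Covers` read contrapositively: if some constraint is violated, then some
constraint is still violated after the reset. -/
theorem isTrue_reducedInstance {σ : WorkState} {k : ℕ} (hσ : σ.2.2.1 = [])
    (h : WorkInv (termsOf (rawInstance I)) I.2.toFinset
      (I.2.toFinset ∪ I.1.universalPart I.2.toFinset) k σ) :
    (reducedInstance I σ).1.IsTrue ↔ I.1.IsTrue := by
  have hc := h.covers_of_done hσ
  have hY : ∀ v, v ∈ ((universalOf (rawInstance I)).filter fun v => !decide (v ∈ σ.1)).toFinset ↔
      v ∈ I.1.universalPart I.2.toFinset ∧ v ∉ σ.1 := by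
    intro v
    rw [List.mem_toFinset, List.mem_filter, mem_universalOf]
    simp
  refine QBF.isTrue_assign_iff _ (fun v hv => ?_) (fun v hv q hq => ?_) fun τ hτ c hcM => ?_
  · exact QBF.universalPart_subset _ _ ((hY v).1 hv).1
  · exact QBF.quant_unique hq (QBF.isUniversal_of_mem_universalPart ((hY v).1 hv).1)
  · by_contra hsat
    by_cases ht : ∃ v ∈ c.vars, v ∈ I.1.universalPart I.2.toFinset
    · have hct : c ∈ touching (universalOf (rawInstance I)) I.1.matrix :=
        mem_touching.2 ⟨hcM, ht.imp fun v hv => ⟨hv.1, mem_universalOf.2 hv.2⟩⟩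
      obtain ⟨t, htc, htτ⟩ := Constraint.exists_falsifyingTerm (I.1.wellFormed c hcM) hsat
      -- `Covers` resets everything outside the kept set, `override` only the removed variables of
      -- `U`. The two agree on the constraint `c'` of the new term, whose variables lie in `B ∪ U`.
      obtain ⟨t', ht', htτ'⟩ := hc τ ⟨t, List.mem_flatMap.2 ⟨c, hct, htc⟩, htτ⟩
      obtain ⟨c', hc', htc'⟩ := List.mem_flatMap.1 ht'
      obtain ⟨hcM', w, hw, hwU⟩ := mem_touching.1 hc'
      refine Constraint.not_sat_of_mem_falsifyingTerms (I.1.wellFormed c' hcM') htc' htτ'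
        ((Constraint.sat_congr fun v hv => ?_).1 (hτ c' hcM'))
      have h1 := QBF.vars_subset_of_touches hcM' hw (mem_universalOf.1 hwU) hv
      unfold override
      by_cases hX : v ∈ σ.1
      · rw [if_pos hX, if_neg fun h' => ((hY v).1 h').2 hX]
      · have hB : v ∉ I.2.toFinset := fun h' => hX (List.mem_toFinset.1 (h.base_subset h'))
        rw [if_neg hX, if_pos ((hY v).2 ⟨(Finset.mem_union.1 h1).resolve_left hB, hX⟩)]
    -- A constraint that does not meet `U` does not notice the reset.
    · refine hsat ((Constraint.sat_congr fun v hv => ?_).1 (hτ c hcM))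
      rw [override, if_neg fun h' => ht ⟨v, hv, ((hY v).1 h').1⟩]

/-- The invariant puts the kept set between `B` and `B ∪ U`, so removed and kept variables together
form the enhanced backdoor. -/
theorem union_reducedInstance {σ : WorkState} {F₀ : List Term} {k : ℕ}
    (h : WorkInv F₀ I.2.toFinset (I.2.toFinset ∪ I.1.universalPart I.2.toFinset) k σ) :
    ((universalOf (rawInstance I)).filter fun v => !decide (v ∈ σ.1)).toFinset ∪ σ.1.toFinset =
      I.2.toFinset ∪ I.1.universalPart I.2.toFinset := by
  ext v
  have h1 : v ∈ I.2.toFinset → v ∈ σ.1.toFinset := fun hv => h.base_subset hv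
  have h2 : v ∈ σ.1.toFinset → v ∈ I.2.toFinset ∪ I.1.universalPart I.2.toFinset :=
    fun hv => h.subset hv
  simp only [Finset.mem_union, List.mem_toFinset, List.mem_filter, mem_universalOf,
    Bool.not_eq_true', decide_eq_false_iff_not] at h1 h2 ⊢
  tauto

end

/-- The reduction, with its running time. -/
theorem exists_reduction : ∃ σ : QBF × List ℕ → WorkState,
    (∀ I, I.2.toFinset ⊆ I.1.vars → (σ I).2.2.1 = [] ∧ (σ I).1.length ≤ keepBound (enhancedParam I) ∧
      WorkInv (termsOf (rawInstance I)) I.2.toFinset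
        (I.2.toFinset ∪ I.1.universalPart I.2.toFinset) (enhancedParam I) (σ I)) ∧
    FptRuns (fun I => I.2.toFinset ⊆ I.1.vars) enhancedParam (fun I => (Data.ofInstance I).size)
      rawInstance (fun I => rawInstance (reducedInstance I (σ I))) := by
  let P : QBF × List ℕ → Prop := fun I => I.2.toFinset ⊆ I.1.vars
  let N : QBF × List ℕ → ℕ := fun I => (Data.ofInstance I).size
  have hfin := fun I => exists_finished (splitBound (enhancedParam I)) _ (workInv_initState (I := I))
    stateLength_initState_le (le_splitBound _)
  -- `n I` occurs only in the analysis; the program runs until its test fails.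
  choose n hn h1 h2 h3 using hfin
  let σ₀ : QBF × List ℕ → WorkState := fun I => initState I.2 (termsOf (rawInstance I))
  refine ⟨fun I => workStep^[n I] (σ₀ I), fun I _ => ⟨?_, ?_, workInv_initState.iterate _⟩, ?_⟩
  · simpa [workTest] using h3 I
  · refine le_trans ?_ (h1 I (n I) le_rfl)
    simp only [stateLength, σ₀]
    omega
  have hN : FptBdd P enhancedParam N fun I => esize (rawInstance I) := FptBdd.size
  have hid : FptRuns P enhancedParam N rawInstance rawInstance := FptRuns.id hN
  have ht : FptRuns P enhancedParam N rawInstance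
      fun I => touching (universalOf (rawInstance I)) (rawInstance I).1.2 :=
    FptRuns.of_polyTime (f := fun x : RawInstance => touching (universalOf x) x.1.2)
      (polyTime_touching polyTime_universalOf (PolyTime.snd.comp PolyTime.fst)) hN
  have hF : FptRuns P enhancedParam N rawInstance fun I => termsOf (rawInstance I) :=
    ht.trans (fptRuns_flatMap_falsifyingTerms ht.2 fun I _ c hc => card_vars_le_of_mem_touching hc)
  have hi : FptRuns P enhancedParam N rawInstance σ₀ :=
    FptRuns.comp (f := fun y : RawInstance × List Term => initState y.1.2 y.2) polyTime_initState
      (hid.pair hF)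
  have hw : FptRuns P enhancedParam N σ₀ fun I => workStep^[n I] (σ₀ I) := by
    refine FptRuns.iterate (n := n) (S := fun I => 4 * (keepBound (enhancedParam I) *
      (esize (termsOf (rawInstance I)) + N I + 5) + 1) + 3) polyTime_workStep polyTime_workTest
      ((FptBdd.param computable_keepBound keepBound_mono).mono fun I _ => hn I)
      (((FptBdd.const 4).mul (((FptBdd.param computable_keepBound keepBound_mono).mul
        ((hF.2.add FptBdd.size).add (.const 5))).add (.const 1))).add (.const 3))
      (fun I _ => h2 I) (fun I _ => h3 I) fun I hI m hm => ?_
    refine esize_state_le (workInv_initState.iterate m) (fun v hv => esize_le_of_mem_vars ?_)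
      (h1 I m hm)
    exact Finset.union_subset hI (QBF.universalPart_subset _ _) hv
  have ho := FptRuns.comp (f := fun y : RawInstance × WorkState => outputOf y.1 y.2)
    polyTime_outputOf (hid.pair (hi.trans hw))
  simpa only [rawInstance_reducedInstance] using ho

/-- The program `q` expects all variables but `0` to be `nil`, and `p` may leave values in `2`, `3`,
`4` only, so these are cleared in between. -/
theorem Prog.outputs_of_runs {p q : Prog} {d e g : Data} {t u : ℕ} (hp : p.Runs d e t)
    (hq : q.Outputs e g u) :
    ∃ n ≤ t + 3 + u, ((p.seq ((setNil 2).seq ((setNil 3).seq (setNil 4)))).seq q).Outputs d g n := by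
  have h := hp (Function.update (fun _ => Data.nil) 0 d) (by simp)
  obtain ⟨s, m, hm, he, h0, h1, h5⟩ := h
  obtain ⟨s', hs', hg⟩ := hq
  have hclear : Exec ((setNil 2).seq ((setNil 3).seq (setNil 4))) s
      (Function.update (fun _ => Data.nil) 0 e) (1 + (1 + 1)) := by
    convert Exec.seq (Exec.setNil 2 s) (Exec.seq (Exec.setNil 3 _) (Exec.setNil 4 _)) using 1
    funext i
    by_cases hi0 : i = 0
    · subst hi0; simp [h0]
    by_cases hi1 : i = 1
    · subst hi1; simp [h1]
    by_cases hi4 : i = 4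
    · subst hi4; simp
    by_cases hi3 : i = 3
    · subst hi3; simp
    by_cases hi2 : i = 2
    · subst hi2; simp
    simp [hi0, hi2, hi3, hi4, h5 i (by omega)]
  exact ⟨m + (1 + (1 + 1)) + u, by omega, s', (he.seq hclear).seq hs', hg⟩

/-- Common to both parts of the theorem; the kind of backdoor enters through `hprom` alone. -/
theorem FixedParameterTractable.of_reduction {prom prom' : QBF × List ℕ → Prop}
    (h : FixedParameterTractable Data.ofInstance prom (fun I => I.1.IsTrue)
      (fun I => I.2.toFinset.card))
    (hsub : ∀ I, prom' I → I.2.toFinset ⊆ I.1.vars)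
    (hprom : ∀ (I : QBF × List ℕ) (S : Finset ℕ) (τ : ℕ → Bool) (X : List ℕ), prom' I →
      S ∪ X.toFinset = I.2.toFinset ∪ I.1.universalPart I.2.toFinset → Disjoint S X.toFinset →
      prom (I.1.assign S τ, X)) :
    FixedParameterTractable Data.ofInstance prom' (fun I => I.1.IsTrue)
      (fun I => I.2.toFinset.card + I.1.maxOcc (I.1.universalPart I.2.toFinset)) := by
  obtain ⟨q, f, c, hf, hq⟩ := h
  obtain ⟨σ, hσ, ⟨p, T, hT, hp⟩, hs⟩ := exists_reduction
  -- The given `f` need not be monotone; a sum over all values up to `keepBound k` replaces it.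
  let F : ℕ → ℕ := fun k => ∑ i ∈ Finset.range (keepBound k + 1), f i
  have hF : Computable F :=
    (computable_sum hf).comp (Computable.succ.comp computable_keepBound)
  have hFm : Monotone F := fun a b h => Finset.sum_le_sum_of_subset
    (Finset.range_mono (Nat.succ_le_succ (keepBound_mono h)))
  obtain ⟨G, e, hG, hGm, hbd⟩ := (hT.add (.const 3)).add
    ((FptBdd.param hF hFm).mul (hs.pow c))
  refine ⟨(p.seq ((Prog.setNil 2).seq ((Prog.setNil 3).seq (Prog.setNil 4)))).seq q,
    -- The factor `2 ^ e` turns `(N + 1) ^ e` into `N ^ e`, as `N ≥ 1`.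
    fun k => G k * 2 ^ e, e, Primrec.nat_mul.to_comp.comp hG (Computable.const (2 ^ e)),
    fun I hI => ?_⟩
  obtain ⟨h1, h2, h3⟩ := hσ I (hsub I hI)
  have hdis : Disjoint ((universalOf (rawInstance I)).filter
      fun v => !decide (v ∈ (σ I).1)).toFinset (σ I).1.toFinset := by
    rw [Finset.disjoint_left]
    intro v hv
    rw [List.mem_toFinset, List.mem_filter] at hv
    simpa using hv.2
  obtain ⟨g, u, hout, hu, hyes⟩ := hq (reducedInstance I (σ I))
    (hprom I _ _ _ hI (union_reducedInstance h3) hdis)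
  have hrun := hp I (hsub I hI)
  rw [enc_rawInstance, enc_rawInstance] at hrun
  obtain ⟨n, hn, hout'⟩ := Prog.outputs_of_runs hrun hout
  refine ⟨g, n, hout', ?_, hyes.trans (isTrue_reducedInstance h1 h3)⟩
  have hfc : f (reducedInstance I (σ I)).2.toFinset.card ≤ F (enhancedParam I) :=
    Finset.single_le_sum (f := f) (fun i _ => Nat.zero_le _) (Finset.mem_range.2
      (Nat.lt_succ_of_le ((List.toFinset_card_le _).trans h2)))
  have hpos : 1 ≤ (Data.ofInstance I).size := Data.size_pos _
  calc n ≤ T I + 3 + u := hn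
    _ ≤ T I + 3 + F (enhancedParam I) * esize (rawInstance (reducedInstance I (σ I))) ^ c :=
        Nat.add_le_add_left (hu.trans (Nat.mul_le_mul_right _ hfc)) _
    _ ≤ G (enhancedParam I) * ((Data.ofInstance I).size + 1) ^ e := hbd I (hsub I hI)
    _ ≤ G (enhancedParam I) * (2 * (Data.ofInstance I).size) ^ e :=
        Nat.mul_le_mul_left _ (Nat.pow_le_pow_left (by omega) e)
    _ = _ := by rw [mul_pow, mul_assoc]; rfl

theorem mainTheorem4 (C : Set QBF) :
    (QBF.Extendable C →
      FixedParameterTractable Data.ofInstance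
        (fun I => QBF.IsEnhancedBackdoor C I.1 I.2.toFinset)
        (fun I => I.1.IsTrue)
        (fun I => I.2.toFinset.card + I.1.maxOcc (I.1.universalPart I.2.toFinset))) ∧
    (QBF.ClosedUnderSubformulas C → QBF.DeletionExtendable C →
      FixedParameterTractable Data.ofInstance
        (fun I => QBF.IsEnhancedDeletionBackdoor C I.1 I.2.toFinset)
        (fun I => I.1.IsTrue)
        (fun I => I.2.toFinset.card + I.1.maxOcc (I.1.universalPart I.2.toFinset))) := by
  refine ⟨fun h => ?_, fun hC h => ?_⟩
  · exact FixedParameterTractable.of_reduction h (fun I hI => hI.1) fun I S τ X hI hSX hdis =>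
      QBF.isBackdoor_assign τ (by rw [hSX]; exact hI.2) hdis
  · exact FixedParameterTractable.of_reduction h (fun I hI => hI.1) fun I S τ X hI hSX hdis =>
      QBF.isDeletionBackdoor_assign hC τ (by rw [hSX]; exact hI.2) hdis
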